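/- Conventions. For $n\ge 0$, an abstract $n$-polytope is a poset with a least and a greatest face in which every flag (maximal chain) has exactly $n+2$ faces (so faces have ranks $-1,0,\dots,n$), in which there are exactly two $j$-faces strictly between any two incident faces of ranks $j-1$ and $j+1$, and in which the flag graph of every section $G/F=\{H: F\le H\le G\}$ is connected. $\Gamma(\mathcal P)$ is the group of order automorphisms; $\mathcal P$ is regular if $\Gamma(\mathcal P)$ is transitive on flags, and semiregular if its facets are regular and $\Gamma(\mathcal P)$ is transitive on vertices. A tail-triangle C-group is a group $\Gamma$ generated by involutions $\alpha_0,\dots,\alpha_{n-1},\beta_{n-1}$ such that $\alpha_i\alpha_j=\alpha_j\alpha_i$ for $|i-j|\ge 2$, $\alpha_i\beta_{n-1}=\beta_{n-1}\alpha_i$ for $i\le n-3$, and $\langle I\rangle\cap\langle J\rangle=\langle I\cap J\rangle$ for all subsets $I,J$ of the set of generators. For such $\Gamma$ let $\mathcal S(\Gamma)$ have two improper faces, of ranks $-1$ and $n+1$, and as proper faces the right cosets of the following subgroups: for rank $0\le j\le n-2$, $\Gamma_j$, generated by all generators but $\alpha_j$; for rank $n-1$, $\Gamma_{n-1}=\langle\alpha_0,\dots,\alpha_{n-2}\rangle$;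 for rank $n$, $\Gamma_n^{\mathcal P}=\langle\alpha_0,\dots,\alpha_{n-1}\rangle$ and $\Gamma_n^{\mathcal Q}=\langle\alpha_0,\dots,\alpha_{n-2},\beta_{n-1}\rangle$. A proper face is strictly below another if it has smaller rank and the two cosets intersect; the improper faces are the least and the greatest face. $\Gamma$ acts by translation of cosets. Theorem. Let $n\ge 1$, and let $\mathcal P$ and $\mathcal Q$ be regular $n$-polytopes with isomorphic facets $\mathcal K$. Choose base flags of $\mathcal P$ and $\mathcal Q$, and identify their facets with $\mathcal K$ so that both base flags induce the same flag of $\mathcal K$. Let $\alpha_0,\dots,\alpha_{n-1}$ be the standard generators of $\Gamma(\mathcal P)$ ($\alpha_j$ maps the base flag to its $j$-adjacent flag), and let $\beta_{n-1}$ be the last standard generator of $\Gamma(\mathcal Q)$. The automorphisms of $\mathcal K$ extend uniquely to automorphisms of $\mathcal P$ and of $\mathcal Q$, which gives embeddings of $\Gamma(\mathcal K)$ into $\Gamma(\mathcal P)$ and $\Gamma(\mathcal Q)$. Let $\Pi=\Gamma(\mathcal P)*_{\Gamma(\mathcal K)}\Gamma(\mathcal Q)$ be the resulting amalgamated product; in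 $\Pi$ the first $n-1$ standard generators of $\Gamma(\mathcal Q)$ coincide with $\alpha_0,\dots,\alpha_{n-2}$. Then: 1. $\Pi$, with the generators $\alpha_0,\dots,\alpha_{n-1},\beta_{n-1}$, is a tail-triangle C-group, and $\alpha_{n-1}\beta_{n-1}$ has infinite order. 2. $\mathcal U=\mathcal U_{\mathcal P,\mathcal Q}:=\mathcal S(\Pi)$ is a semiregular $(n+1)$-polytope, on which $\Pi$ acts faithfully as a group of automorphisms. 3. The facets of $\mathcal U$ that are cosets of $\Gamma_n^{\mathcal P}$ are isomorphic to $\mathcal P$, and those that are cosets of $\Gamma_n^{\mathcal Q}$ are isomorphic to $\mathcal Q$. Each $(n-1)$-face (ridge) of $\mathcal U$ is isomorphic to $\mathcal K$ and lies in exactly one facet of each kind. For each $(n-2)$-face $\mathcal R$ the section of $\mathcal U$ above $\mathcal R$ is an apeirogon $\{\infty\}$, around which the facets of the two kinds alternate. 4. $\mathcal U$ is regular if and only if $\mathcal P$ and $\mathcal Q$ are isomorphic. In this case $\Gamma(\mathcal U)=\Pi\rtimes C_2$, where the generator of $C_2$ interchanges $\alpha_{n-1}$ and $\beta_{n-1}$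 and fixes $\alpha_0,\dots,\alpha_{n-2}$. If $\mathcal P$ and $\mathcal Q$ are not isomorphic, then $\Gamma(\mathcal U)=\Pi$. -/

import Mathlib

universe u v w

/-! ### Abstract polytopes -/

/-- The rank of an element `x` of a poset: one less than the length of a longest chain that ends
at `x`.  In an abstract polytope every longest chain below a face has the same (finite) length, and
this is the usual rank function, with value `-1` on the least face. -/
noncomputable def rk {P : Type*} [PartialOrder P] (x : P) : ℤ :=
  ((Order.height x).toNat : ℤ) - 1

/-- Two flags (maximal chains) are `j`-adjacent if they are distinct but have the same faces in
every rank other than `j`. -/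
def FlagAdj {P : Type*} [PartialOrder P] (j : ℤ) (s t : Flag P) : Prop :=
  s ≠ t ∧ ∀ x : P, rk x ≠ j → (x ∈ s ↔ x ∈ t)

/-- Connectedness of the flag graph. -/
def FlagConnected (P : Type*) [PartialOrder P] : Prop :=
  ∀ s t : Flag P, Relation.ReflTransGen (fun s t => ∃ j : ℤ, FlagAdj j s t) s t

/-- Abstract `n`-polytopes. -/
structure IsPolytope (n : ℕ) (P : Type*) [PartialOrder P] : Prop where
  /-- There is a least face. -/
  exists_least : ∃ b : P, ∀ x, b ≤ x
  /-- There is a greatest face. -/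
  exists_greatest : ∃ t : P, ∀ x, x ≤ t
  /-- Each flag contains exactly `n + 2` faces. -/
  flag_card : ∀ s : Flag P, (s : Set P).encard = n + 2
  /-- If `F < G` have ranks `j - 1` and `j + 1`, there are exactly two faces strictly between. -/
  diamond : ∀ F G : P, F < G → rk G = rk F + 2 → (Set.Ioo F G).encard = 2
  /-- The flag graph of each section is connected. -/
  strongly_connected : ∀ F G : P, F ≤ G → FlagConnected (Set.Icc F G)

/-- Regularity of a polytope: the automorphism group `P ≃o P` is transitive on flags. -/
def FlagTransitive (P : Type*) [PartialOrder P] : Prop :=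
  ∀ s t : Flag P, ∃ g : P ≃o P, Flag.map g s = t

/-- Semiregularity of an `n`-polytope: the facets are regular and the automorphism group is
transitive on vertices.  (`Set.Iic F` is the section of all faces below `F`.) -/
def IsSemiregular (n : ℕ) (P : Type*) [PartialOrder P] : Prop :=
  (∀ F : P, rk F = (n : ℤ) - 1 → FlagTransitive (Set.Iic F)) ∧
    ∀ x y : P, rk x = 0 → rk y = 0 → ∃ g : P ≃o P, g x = y

/-- The standard generator of the automorphism group of a regular polytope, relative to the base
flag `Φ`: the automorphism that maps `Φ` to its `j`-adjacent flag. -/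
noncomputable def stdGen {P : Type*} [PartialOrder P] (Φ : Flag P) (j : ℤ) : P ≃o P :=
  Classical.epsilon fun g : P ≃o P => FlagAdj j Φ (Flag.map g Φ)

/-! ### The apeirogon -/

/-- The faces of the apeirogon `{∞}`: the edge `i` joins the vertices `i` and `i + 1`. -/
inductive Apeirogon where
  | bot : Apeirogon
  | vertex (i : ℤ) : Apeirogon
  | edge (i : ℤ) : Apeirogon
  | top : Apeirogon

namespace Apeirogon

/-- Incidence in the apeirogon. -/
def le : Apeirogon → Apeirogon → Prop
  | bot, _ => True
  | _, top => True
  | vertex i, vertex j => i = j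
  | vertex i, edge j => i = j ∨ i = j + 1
  | edge i, edge j => i = j
  | _, _ => False

instance : PartialOrder Apeirogon where
  le := le
  le_refl a := by cases a <;> simp [le]
  le_trans a b c hab hbc := by
    cases a <;> cases b <;> cases c <;> simp_all [le]
  le_antisymm a b hab hba := by
    cases a <;> cases b <;> simp_all [le]

end Apeirogon

/-! ### Amalgamation of the automorphism groups along the group of a common facet -/

/-- Let `e` identify `K` with the section below a face `F` of `P`.  The homomorphism
`ι : Γ(K) → Γ(P)` is compatible with `e` if each `ι k` restricts to `k` on that section. -/
def ExtendsAut {K : Type v} {P : Type u} [PartialOrder K] [PartialOrder P] {F : P}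
    (e : K ≃o Set.Iic F) (ι : (K ≃o K) →* (P ≃o P)) : Prop :=
  ∀ (k : K ≃o K) (x : K), ι k (e x : P) = (e (k x) : P)

/-- The canonical homomorphism `Γ(K) → Γ(P)` for a facet `K` of a regular polytope `P`, which
extends each automorphism of the facet to an automorphism of `P`. -/
noncomputable def facetHom {K : Type v} {P : Type u} [PartialOrder K] [PartialOrder P] {F : P}
    (e : K ≃o Set.Iic F) : (K ≃o K) →* (P ≃o P) :=
  Classical.epsilon fun ι => ExtendsAut e ι

/-- The two groups `Γ(P)` and `Γ(Q)` as a family over `Bool`. -/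
def AutFamily (P Q : Type u) [PartialOrder P] [PartialOrder Q] : Bool → Type u
  | true => P ≃o P
  | false => Q ≃o Q

noncomputable instance (P Q : Type u) [PartialOrder P] [PartialOrder Q] :
    ∀ i, Group (AutFamily P Q i)
  | true => inferInstanceAs (Group (P ≃o P))
  | false => inferInstanceAs (Group (Q ≃o Q))

section Amalgam

variable {P Q : Type u} {K : Type v} [PartialOrder P] [PartialOrder Q] [PartialOrder K]
  {F : P} {G : Q}

/-- The two homomorphisms `Γ(K) → Γ(P)` and `Γ(K) → Γ(Q)`. -/
noncomputable def autFamilyHom (eP : K ≃o Set.Iic F) (eQ : K ≃o Set.Iic G) :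
    ∀ i, (K ≃o K) →* AutFamily P Q i
  | true => facetHom eP
  | false => facetHom eQ

/-- The amalgamated product `Γ(P) ∗_{Γ(K)} Γ(Q)`. -/
abbrev Amalgam (eP : K ≃o Set.Iic F) (eQ : K ≃o Set.Iic G) : Type (max u v) :=
  Monoid.PushoutI (autFamilyHom eP eQ)

/-- The canonical homomorphism from `Γ(P)` to the amalgamated product. -/
noncomputable def Amalgam.inP (eP : K ≃o Set.Iic F) (eQ : K ≃o Set.Iic G) :
    (P ≃o P) →* Amalgam eP eQ :=
  Monoid.PushoutI.of (φ := autFamilyHom eP eQ) true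

/-- The canonical homomorphism from `Γ(Q)` to the amalgamated product. -/
noncomputable def Amalgam.inQ (eP : K ≃o Set.Iic F) (eQ : K ≃o Set.Iic G) :
    (Q ≃o Q) →* Amalgam eP eQ :=
  Monoid.PushoutI.of (φ := autFamilyHom eP eQ) false

end Amalgam

/-! ### Tail-triangle C-groups and Wythoff's construction

The generators are `α 0, …, α (n - 1)` and `β` (which plays the role of `β_{n-1}`). They are indexed
by `Option (Fin n)`, where `none` is the index of `β`. -/

/-- The list of all `n + 1` generators. -/
def ttGen {Γ : Type*} {n : ℕ} (α : Fin n → Γ) (β : Γ) : Option (Fin n) → Γ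
  | some i => α i
  | none => β

/-- Tail-triangle C-groups: groups generated by involutions, with the commutation relations implicit
in the tail-triangle diagram, which satisfy the intersection condition. -/
structure IsTailTriangleCGroup {Γ : Type*} [Group Γ] {n : ℕ} (α : Fin n → Γ) (β : Γ) : Prop where
  closure_eq_top : Subgroup.closure (Set.range (ttGen α β)) = ⊤
  orderOf_eq_two : ∀ i, orderOf (ttGen α β i) = 2
  commute_tail : ∀ i j : Fin n, (i : ℕ) + 1 < j → Commute (α i) (α j)
  commute_right : ∀ i : Fin n, (i : ℕ) + 2 < n → Commute (α i) β
  intersection : ∀ I J : Set (Option (Fin n)),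
    Subgroup.closure (ttGen α β '' I) ⊓ Subgroup.closure (ttGen α β '' J) =
      Subgroup.closure (ttGen α β '' (I ∩ J))

/-- The kinds of faces in Wythoff's construction: the two improper faces, the faces of rank
`0 ≤ j ≤ n - 1`, and two kinds of facets. -/
inductive FaceKind (n : ℕ) where
  | bot : FaceKind n
  | proper (j : Fin n) : FaceKind n
  | facetP : FaceKind n
  | facetQ : FaceKind n
  | top : FaceKind n

namespace FaceKind

/-- The rank belonging to a kind of faces. -/
def rank {n : ℕ} : FaceKind n → ℤ
  | bot => -1
  | proper j => ((j : ℕ) : ℤ)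
  | facetP => n
  | facetQ => n
  | top => (n : ℤ) + 1

/-- The generators of the stabilizer of the basic face of a given kind: all but `α j` for the
rank `j ≤ n - 2`; `α 0, …, α (n - 2)` for the rank `n - 1`; `α 0, …, α (n - 1)` for the first kind of
facets; `α 0, …, α (n - 2), β` for the second kind; all generators for the improper faces. -/
def gens {n : ℕ} : FaceKind n → Set (Option (Fin n))
  | bot => Set.univ
  | proper j => {x | x ≠ some j ∧ ((j : ℕ) + 1 = n → x ≠ none)}
  | facetP => {x | x ≠ none}
  | facetQ => {x | ∀ i : Fin n, x = some i → (i : ℕ) + 1 < n}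
  | top => Set.univ

end FaceKind

section Wythoff

variable {Γ : Type w} [Group Γ] {n : ℕ}

/-- The distinguished subgroup `Γ_j` for each kind of faces. -/
def stabSubgroup (α : Fin n → Γ) (β : Γ) (t : FaceKind n) : Subgroup Γ :=
  Subgroup.closure (ttGen α β '' t.gens)

/-- The faces of `S(Γ)`: the cosets of the distinguished subgroups, tagged with their kinds. -/
def WythoffFace (α : Fin n → Γ) (β : Γ) : Type w :=
  Σ t : FaceKind n, Γ ⧸ stabSubgroup α β t

/-- The kind of a face. -/
def WythoffFace.kind {α : Fin n → Γ} {β : Γ} (x : WythoffFace α β) : FaceKind n := x.1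

/-- Strict incidence: the rank increases and the two cosets have a common element. -/
def WythoffFace.Below {α : Fin n → Γ} {β : Γ} (x y : WythoffFace α β) : Prop :=
  x.kind.rank < y.kind.rank ∧
    ∃ g : Γ, (QuotientGroup.mk g : Γ ⧸ stabSubgroup α β x.1) = x.2 ∧
      (QuotientGroup.mk g : Γ ⧸ stabSubgroup α β y.1) = y.2

/-- The action of `Γ` on faces by translation of cosets. -/
def WythoffFace.translate {α : Fin n → Γ} {β : Γ} (g : Γ) (x : WythoffFace α β) :
    WythoffFace α β :=
  ⟨x.1, g • x.2⟩

end Wythoff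

/-! ### Graded posets -/

/-! A regular polytope is encoded in its group. Automorphisms correspond to flags, and strong
flag-connectedness shows that the standard generators with ranks in `I` generate exactly the
stabilizer of the base faces with ranks outside `I` (`IsRegularPolytope.flagStab_eq_closure`). Every
automorphism of a facet extends uniquely, so `Γ(K)` sits in `Γ(P)` and in `Γ(Q)` as the stabilizer
of the base facet.

The core is the intersection condition in the amalgamated product. A set of generators determines a
subgroup of each factor, and the two subgroups belonging to one set meet `Γ(K)` in the same
subgroup. An element of two generated subgroups has a reduced word for each of them. Both words run
through the same sequence of factors, and their initial parts differ by an element of `Γ(K)`. The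
product formula `IsRegularPolytope.exists_factor` splits that element into a part from each
subgroup, so a common first letter can be taken off (`PushoutWords.iSup_inf_iSup_le`). Reduced words
also show that the product of the last two generators has infinite order.

In a tail-triangle C-group the stabilizer of a face is the product of two commuting parts, generated
below and above its rank; hence incidence is transitive. By the intersection condition the faces
below a facet form a copy of `P` or `Q`, so sections inside facets cause no trouble. For sections
that end in the greatest face, a ridge lies in one facet of each kind, and connectedness follows by
writing a stabilizer element as a word in generators, each of which fixes one of the two base
facets. Above a face of rank `n - 2` one sees the cosets in an infinite dihedral group, that is, an
apeirogon.

An automorphism of the face poset is determined by its effect on one facet. If it preserves the kind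
of the base facet, it is a translation (`IsFacetEmbedding.exists_act_eq`). If it changes the kind,
then `P` and `Q` are isomorphic. Conversely, an isomorphism that matches base flags interchanges the
factors of the amalgamated product and induces an involution of the face poset. -/

theorem IsChain.exists_flag {P : Type*} [PartialOrder P] {c : Set P} (hc : IsChain (· ≤ ·) c) :
    ∃ s : Flag P, c ⊆ s := by
  obtain ⟨M, hM, hcM⟩ := hc.exists_maxChain
  exact ⟨Flag.ofIsMaxChain M hM, hcM⟩

theorem exists_flag_pair {P : Type*} [PartialOrder P] {x y : P} (hxy : x ≤ y) :
    ∃ s : Flag P, x ∈ s ∧ y ∈ s := by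
  obtain ⟨s, hs⟩ := IsChain.exists_flag (c := {x, y}) (IsChain.insert IsChain.singleton (by
    rintro b rfl -; exact Or.inl hxy))
  exact ⟨s, hs (by simp), hs (by simp)⟩

/-- `r` is a rank function on a poset with a least face of rank `-1` and a greatest face of
rank `n`. -/
structure IsRankFun {P : Type*} [PartialOrder P] (r : P → ℤ) (n : ℤ) : Prop where
  strictMono : StrictMono r
  exists_least : ∃ b : P, (∀ x, b ≤ x) ∧ r b = -1
  exists_greatest : ∃ t : P, (∀ x, x ≤ t) ∧ r t = n
  exists_succ : ∀ x y : P, x < y → ∃ z, x < z ∧ z ≤ y ∧ r z = r x + 1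

namespace IsRankFun

variable {P : Type*} [PartialOrder P] {r : P → ℤ} {n : ℤ}

theorem exists_le (h : IsRankFun r n) {x y : P} {j : ℤ} (hxy : x ≤ y) (hx : r x ≤ j)
    (hy : j ≤ r y) : ∃ z, x ≤ z ∧ z ≤ y ∧ r z = j := by
  obtain ⟨k, rfl⟩ := Int.le.dest hx
  clear hx
  induction k with
  | zero => exact ⟨x, le_rfl, hxy, by simp⟩
  | succ k ih =>
    obtain ⟨z, hxz, hzy, hz⟩ := ih (by push_cast at hy; omega)
    obtain ⟨w, hzw, hwy, hw⟩ := h.exists_succ z y (lt_of_le_of_ne hzy (by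
      rintro rfl; push_cast at hy; omega))
    exact ⟨w, hxz.trans hzw.le, hwy, by push_cast; omega⟩

theorem neg_one_le (h : IsRankFun r n) (x : P) : -1 ≤ r x := by
  obtain ⟨b, hb, hr⟩ := h.exists_least
  rw [← hr]; exact h.strictMono.monotone (hb x)

theorem le_top (h : IsRankFun r n) (x : P) : r x ≤ n := by
  obtain ⟨b, hb, hr⟩ := h.exists_greatest
  rw [← hr]; exact h.strictMono.monotone (hb x)

/-- Strict monotonicity bounds the height from above; a face of rank one less, found above the least
face, bounds it from below. Thus any function with these properties is `rk`, and ranks may be read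
off from whichever description is convenient. -/
theorem height_eq (h : IsRankFun r n) (k : ℕ) :
    ∀ x : P, r x + 1 = k → Order.height x = k := by
  induction k using Nat.strong_induction_on with
  | _ k ih =>
    intro x hx
    have key : ∀ y < x, ∃ m : ℕ, m < k ∧ Order.height y = m := by
      intro y hy
      have h1 := h.strictMono hy
      have h2 := h.neg_one_le y
      refine ⟨(r y + 1).toNat, by omega, ih _ (by omega) y (by omega)⟩
    have hle : Order.height x ≤ k := by
      rw [Order.height_le_coe_iff]
      intro y hy
      obtain ⟨m, hm, hm'⟩ := key y hy
      rw [hm']; exact_mod_cast hm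
    refine Order.height_eq_coe_iff.2 ⟨lt_of_le_of_lt hle (ENat.natCast_lt_top k), ?_, ?_⟩
    · rcases Nat.eq_zero_or_pos k with h0 | h0
      · exact Or.inl h0
      · right
        obtain ⟨b, hb, hbr⟩ := h.exists_least
        obtain ⟨z, -, hzx, hz⟩ := h.exists_le (j := r x - 1) (hb x) (by omega) (by omega)
        refine ⟨z, lt_of_le_of_ne hzx (by rintro rfl; omega), ?_⟩
        rw [ih (k - 1) (by omega) z (by omega)]
        push_cast [h0]; rfl
    · intro y hy
      obtain ⟨m, hm, hm'⟩ := key y hy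
      rw [hm']; exact_mod_cast hm

theorem rk_eq (h : IsRankFun r n) (x : P) : rk x = r x := by
  have h1 := h.neg_one_le x
  rw [rk, h.height_eq (r x + 1).toNat x (by omega), ENat.toNat_natCast]
  omega

theorem to_rk (h : IsRankFun r n) : IsRankFun (rk : P → ℤ) n := by
  rwa [show (rk : P → ℤ) = r from funext h.rk_eq]

theorem le_of_rank_eq_neg_one (h : IsRankFun r n) {x : P} (hx : r x = -1) (y : P) : x ≤ y := by
  obtain ⟨b, hb, hr⟩ := h.exists_least
  rcases (hb x).eq_or_lt with rfl | hlt
  · exact hb y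
  · have := h.strictMono hlt; omega

theorem le_of_rank_eq_top (h : IsRankFun r n) {x : P} (hx : r x = n) (y : P) : y ≤ x := by
  obtain ⟨b, hb, hr⟩ := h.exists_greatest
  rcases (hb x).eq_or_lt with rfl | hlt
  · exact hb y
  · have := h.strictMono hlt; omega

theorem eq_of_comparable (h : IsRankFun r n) {x y : P} (hxy : x ≤ y ∨ y ≤ x) (hr : r x = r y) :
    x = y := by
  rcases hxy with hxy | hxy
  · rcases hxy.eq_or_lt with h' | h'
    · exact h'
    · have := h.strictMono h'; omega
  · rcases hxy.eq_or_lt with h' | h'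
    · exact h'.symm
    · have := h.strictMono h'; omega

theorem lt_of_comparable (h : IsRankFun r n) {x y : P} (hxy : x ≤ y ∨ y ≤ x) (hr : r x < r y) :
    x < y := by
  rcases hxy with hxy | hxy
  · exact lt_of_le_of_ne hxy (by rintro rfl; omega)
  · have := h.strictMono.monotone hxy; omega

theorem le_of_comparable (h : IsRankFun r n) {x y : P} (hxy : x ≤ y ∨ y ≤ x) (hr : r x ≤ r y) :
    x ≤ y := by
  rcases hr.eq_or_lt with h' | h'
  · exact (h.eq_of_comparable hxy h').le
  · exact (h.lt_of_comparable hxy h').le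

/-! Flags of graded posets. -/

theorem flag_inj (h : IsRankFun r n) (s : Flag P) {x y : P} (hx : x ∈ s) (hy : y ∈ s)
    (hr : r x = r y) : x = y :=
  h.eq_of_comparable (s.le_or_le hx hy) hr

theorem flag_le (h : IsRankFun r n) (s : Flag P) {x y : P} (hx : x ∈ s) (hy : y ∈ s)
    (hr : r x ≤ r y) : x ≤ y :=
  h.le_of_comparable (s.le_or_le hx hy) hr

theorem flag_lt (h : IsRankFun r n) (s : Flag P) {x y : P} (hx : x ∈ s) (hy : y ∈ s)
    (hr : r x < r y) : x < y :=
  h.lt_of_comparable (s.le_or_le hx hy) hr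

/-- Take the faces of `s` whose ranks are nearest to `j` from below and from above. A face of rank
`j` between them is comparable with all of `s`, so it belongs to `s` by maximality. -/
theorem exists_mem_flag (h : IsRankFun r n) (s : Flag P) {j : ℤ} (h1 : -1 ≤ j) (h2 : j ≤ n) :
    ∃ x ∈ s, r x = j := by
  obtain ⟨b, hb, hbr⟩ := h.exists_least
  obtain ⟨t, ht, htr⟩ := h.exists_greatest
  have hbs : b ∈ s := Flag.mem_iff_forall_le_or_ge.2 fun c _ => Or.inl (hb c)
  have hts : t ∈ s := Flag.mem_iff_forall_le_or_ge.2 fun c _ => Or.inr (ht c)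
  obtain ⟨lo, ⟨hlo, x, hx, hxr⟩, hlomax⟩ := Int.exists_greatest_of_bdd
    (P := fun k => k ≤ j ∧ ∃ x ∈ s, r x = k) ⟨j, fun k hk => hk.1⟩ ⟨-1, h1, b, hbs, hbr⟩
  obtain ⟨hi, ⟨hhi, y, hy, hyr⟩, hhimin⟩ := Int.exists_least_of_bdd
    (P := fun k => j ≤ k ∧ ∃ x ∈ s, r x = k) ⟨j, fun k hk => hk.1⟩ ⟨n, h2, t, hts, htr⟩
  have hxy := h.flag_le s hx hy (by omega)
  obtain ⟨z, hxz, hzy, hz⟩ := h.exists_le (j := j) hxy (by omega) (by omega)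
  refine ⟨z, Flag.mem_iff_forall_le_or_ge.2 fun c hc => ?_, hz⟩
  rcases le_total (r c) j with hcj | hcj
  · exact Or.inr ((h.flag_le s hc hx (by rw [hxr]; exact hlomax _ ⟨hcj, c, hc, rfl⟩)).trans hxz)
  · exact Or.inl (hzy.trans (h.flag_le s hy hc (by rw [hyr]; exact hhimin _ ⟨hcj, c, hc, rfl⟩)))

theorem isMaxChain (h : IsRankFun r n) {s : Set P} (hs : IsChain (· ≤ ·) s)
    (hr : ∀ j, -1 ≤ j → j ≤ n → ∃ x ∈ s, r x = j) : IsMaxChain (· ≤ ·) s := by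
  refine ⟨hs, fun t ht hst => hst.antisymm fun x hx => ?_⟩
  obtain ⟨y, hy, hyr⟩ := hr (r x) (h.neg_one_le x) (h.le_top x)
  rwa [← h.eq_of_comparable (ht.total (hst hy) hx) hyr]

theorem flag_encard (h : IsRankFun r n) (s : Flag P) {m : ℕ} (hm : n = m) :
    (s : Set P).encard = m + 2 := by
  have himg : r '' (s : Set P) = Set.Icc (-1) n := by
    ext j
    constructor
    · rintro ⟨x, -, rfl⟩; exact ⟨h.neg_one_le x, h.le_top x⟩
    · rintro ⟨h1, h2⟩; exact h.exists_mem_flag s h1 h2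
  have hinj : Set.InjOn r (s : Set P) := fun x hx y hy hxy => h.flag_inj s hx hy hxy
  rw [← hinj.encard_image, himg, ← Finset.coe_Icc, Set.encard_coe_eq_coe_finsetCard, Int.card_Icc]
  rw [show (n + 1 - -1).toNat = m + 2 by omega]
  push_cast; rfl

/-! Sections and isomorphisms. -/

/-- The shift by `r F + 1` gives `F`, now the least face, the rank `-1`. -/
theorem icc (h : IsRankFun r n) {F G : P} (hFG : F ≤ G) :
    IsRankFun (fun x : Set.Icc F G => r x - r F - 1) (r G - r F - 1) where
  strictMono x y hxy := by have := h.strictMono (show (x : P) < y from hxy); simp; omega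
  exists_least := ⟨⟨F, le_rfl, hFG⟩, fun x => x.2.1, by simp⟩
  exists_greatest := ⟨⟨G, hFG, le_rfl⟩, fun x => x.2.2, rfl⟩
  exists_succ x y hxy := by
    obtain ⟨z, h1, h2, h3⟩ := h.exists_succ x y hxy
    exact ⟨⟨z, x.2.1.trans h1.le, h2.trans y.2.2⟩, h1, h2, by simp; omega⟩

theorem iic (h : IsRankFun r n) (G : P) :
    IsRankFun (fun x : Set.Iic G => r x) (r G) where
  strictMono x y hxy := h.strictMono (show (x : P) < y from hxy)
  exists_least := by
    obtain ⟨b, hb, hr⟩ := h.exists_least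
    exact ⟨⟨b, hb G⟩, fun x => hb x, hr⟩
  exists_greatest := ⟨⟨G, le_rfl⟩, fun x => x.2, rfl⟩
  exists_succ x y hxy := by
    obtain ⟨z, h1, h2, h3⟩ := h.exists_succ x y hxy
    exact ⟨⟨z, h2.trans y.2⟩, h1, h2, h3⟩

theorem rk_iic (h : IsRankFun (rk : P → ℤ) n) {G : P} (x : Set.Iic G) : rk x = rk (x : P) :=
  (h.iic G).rk_eq x

theorem rk_icc (h : IsRankFun (rk : P → ℤ) n) {F G : P} (x : Set.Icc F G) :
    rk x = rk (x : P) - rk F - 1 :=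
  (h.icc (x.2.1.trans x.2.2)).rk_eq x

end IsRankFun

theorem rk_orderIso {P Q : Type*} [PartialOrder P] [PartialOrder Q] (e : P ≃o Q) (x : P) :
    rk (e x) = rk x := by
  simp [rk, Order.height_orderIso]

theorem IsRankFun.congr {P Q : Type*} [PartialOrder P] [PartialOrder Q] (e : P ≃o Q) {n : ℤ}
    (h : IsRankFun (rk : P → ℤ) n) : IsRankFun (rk : Q → ℤ) n where
  strictMono x y hxy := by
    rw [← rk_orderIso e.symm x, ← rk_orderIso e.symm y]
    exact h.strictMono (e.symm.lt_iff_lt.2 hxy)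
  exists_least := by
    obtain ⟨b, hb, hr⟩ := h.exists_least
    exact ⟨e b, fun x => by rw [← e.le_symm_apply]; exact hb _, by rw [rk_orderIso, hr]⟩
  exists_greatest := by
    obtain ⟨b, hb, hr⟩ := h.exists_greatest
    exact ⟨e b, fun x => by rw [← e.symm_apply_le]; exact hb _, by rw [rk_orderIso, hr]⟩
  exists_succ x y hxy := by
    obtain ⟨z, h1, h2, h3⟩ := h.exists_succ (e.symm x) (e.symm y) (e.symm.lt_iff_lt.2 hxy)
    refine ⟨e z, ?_, ?_, ?_⟩
    · rwa [← e.symm_apply_lt]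
    · rwa [← e.le_symm_apply]
    · rw [rk_orderIso, h3, rk_orderIso]

/-! The rank function of a polytope. -/

section

variable {P : Type*} [PartialOrder P]

theorem IsChain.encard_le_of_flag {m : ℕ} (hf : ∀ s : Flag P, (s : Set P).encard = m)
    {c : Set P} (hc : IsChain (· ≤ ·) c) : c.encard ≤ m := by
  obtain ⟨M, hM, hcM⟩ := hc.exists_maxChain
  rw [← hf (Flag.ofIsMaxChain M hM)]
  exact Set.encard_le_encard hcM

theorem LTSeries.isChain_range (p : LTSeries P) : IsChain (· ≤ ·) (Set.range p) := by
  rintro _ ⟨i, rfl⟩ _ ⟨j, rfl⟩ -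
  rcases le_total i j with h | h
  · exact Or.inl (p.monotone h)
  · exact Or.inr (p.monotone h)

theorem LTSeries.encard_range (p : LTSeries P) : (Set.range p).encard = p.length + 1 := by
  rw [← Set.image_univ, p.strictMono.injective.injOn.encard_image, Set.encard_univ]
  simp

/-- If all flags have the same finite size, the height of a face is the number of faces below it
in any flag through it. -/
theorem height_eq_of_mem_flag {m : ℕ} (hf : ∀ s : Flag P, (s : Set P).encard = m)
    (s : Flag P) {x : P} (hx : x ∈ s) :
    Order.height x = ((s : Set P) ∩ Set.Iio x).encard := by
  have hfin : (s : Set P).Finite := Set.finite_of_encard_eq_coe (hf s)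
  apply le_antisymm
  · refine Order.height_le fun p hp => ?_
    -- A chain ending at `x` is continued by the part of `s` above `x`. The union has at most `m`
    -- elements, and cancelling the upper part bounds the length of the chain.
    have hchain : IsChain (· ≤ ·) (Set.range p ∪ ((s : Set P) \ Set.Iic x)) := by
      have hle : ∀ i, p i ≤ x := fun i => by
        rw [← hp]; exact p.monotone (Fin.le_last i)
      have hlt : ∀ y ∈ (s : Set P) \ Set.Iic x, x ≤ y := fun y hy =>
        (s.le_or_le hx hy.1).resolve_right hy.2
      rintro y (⟨i, rfl⟩ | hy) z (⟨j, rfl⟩ | hz) hyz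
      · exact p.isChain_range ⟨i, rfl⟩ ⟨j, rfl⟩ hyz
      · exact Or.inl ((hle i).trans (hlt z hz))
      · exact Or.inr ((hle j).trans (hlt y hy))
      · exact s.le_or_le hy.1 hz.1
    have hdisj : Disjoint (Set.range p) ((s : Set P) \ Set.Iic x) := by
      rw [Set.disjoint_left]
      rintro _ ⟨i, rfl⟩ hi
      exact hi.2 (by rw [← hp]; exact p.monotone (Fin.le_last i))
    have h1 := hchain.encard_le_of_flag hf
    rw [Set.encard_union_eq hdisj, p.encard_range, ← hf s] at h1
    have h2 : (s : Set P).encard =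
        ((s : Set P) ∩ Set.Iio x).encard + 1 + ((s : Set P) \ Set.Iic x).encard := by
      rw [← Set.encard_sdiff_add_encard_inter (s : Set P) (Set.Iic x)]
      have : (s : Set P) ∩ Set.Iic x = insert x ((s : Set P) ∩ Set.Iio x) := by
        ext y
        simp only [Set.mem_inter_iff, Set.mem_Iic, Set.mem_insert_iff, Set.mem_Iio, le_iff_eq_or_lt]
        constructor
        · rintro ⟨h1, h2 | h2⟩
          · exact Or.inl h2
          · exact Or.inr ⟨h1, h2⟩
        · rintro (rfl | h)
          · exact ⟨hx, Or.inl rfl⟩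
          · exact ⟨h.1, Or.inr h.2⟩
      rw [this, Set.encard_insert_of_notMem (by simp), add_comm]
    rw [h2] at h1
    have hf1 : ((s : Set P) \ Set.Iic x).encard ≠ ⊤ :=
      (Set.encard_ne_top_iff.2 (hfin.subset Set.sdiff_subset))
    have h3 := (ENat.add_le_add_iff_right hf1).1 h1
    exact (ENat.add_le_add_iff_right (by simp)).1 h3
  -- For the lower bound, descend along `s`: `y` is the largest face of `s` below `x`.
  · obtain ⟨k, hk⟩ : ∃ k : ℕ, ((s : Set P) ∩ Set.Iio x).encard = k :=
      ⟨_, (hfin.subset Set.inter_subset_left).encard_eq_coe⟩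
    rw [hk]
    clear hf
    induction k generalizing x with
    | zero => simp
    | succ k ih =>
      have hfi : ((s : Set P) ∩ Set.Iio x).Finite := hfin.subset Set.inter_subset_left
      have hne : ((s : Set P) ∩ Set.Iio x).Nonempty := by
        rw [← Set.encard_ne_zero, hk]; simp
      obtain ⟨y, hy⟩ := hfi.exists_maximal hne
      have hy1 := hy.1
      have hset : (s : Set P) ∩ Set.Iio x = insert y ((s : Set P) ∩ Set.Iio y) := by
        ext z
        constructor
        · intro hz
          rcases s.le_or_le hz.1 hy1.1 with h | h
          · rcases h.eq_or_lt with h | h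
            · exact Or.inl h
            · exact Or.inr ⟨hz.1, h⟩
          · exact Or.inl ((hy.2 hz h).antisymm h)
        · rintro (rfl | hz)
          · exact hy1
          · exact ⟨hz.1, lt_trans hz.2 hy1.2⟩
      rw [hset, Set.encard_insert_of_notMem (by simp)] at hk
      have hk' : ((s : Set P) ∩ Set.Iio y).encard = k := by
        push_cast at hk
        exact ENat.add_left_injective_of_ne_top (by simp) hk
      have := ih hy1.1 hk'
      calc ((k + 1 : ℕ) : ℕ∞) = k + 1 := by push_cast; rfl
        _ ≤ Order.height y + 1 := by gcongr
        _ ≤ _ := Order.height_add_one_le hy1.2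

end

/-- The axioms prescribe only the size of flags. Since height equals position in any flag through
the face, consecutive faces of a flag differ in rank by one, and the greatest face has rank `n`. -/
theorem IsPolytope.isRankFun {P : Type*} [PartialOrder P] {n : ℕ} (h : IsPolytope n P) :
    IsRankFun (rk : P → ℤ) n := by
  have hf : ∀ s : Flag P, (s : Set P).encard = (n + 2 : ℕ) := fun s => by
    rw [h.flag_card]; push_cast; rfl
  have hfin : ∀ s : Flag P, (s : Set P).Finite := fun s => Set.finite_of_encard_eq_coe (hf s)
  have key : ∀ (s : Flag P) (x : P), x ∈ s → ((s : Set P) ∩ Set.Iio x).encard = (rk x + 1).toNat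
      ∧ 0 ≤ rk x + 1 := by
    intro s x hx
    have h1 := height_eq_of_mem_flag hf s hx
    have h2 := ((hfin s).subset (Set.inter_subset_left (t := Set.Iio x))).encard_eq_coe
    rw [h2] at h1 ⊢
    rw [rk, h1]
    simp
  have hsucc : ∀ x y : P, x < y → ∃ z, x < z ∧ z ≤ y ∧ rk z = rk x + 1 := by
    intro x y hxy
    obtain ⟨s, hx, hy⟩ := exists_flag_pair hxy.le
    obtain ⟨z, hz⟩ := ((hfin s).subset (Set.inter_subset_left (t := Set.Ioi x))).exists_minimal
      ⟨y, hy, hxy⟩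
    have hz1 := hz.1
    have hzy : z ≤ y := by
      rcases s.le_or_le hz1.1 hy with h | h
      · exact h
      · exact hz.2 ⟨hy, hxy⟩ h
    refine ⟨z, hz1.2, hzy, ?_⟩
    have hset : (s : Set P) ∩ Set.Iio z = insert x ((s : Set P) ∩ Set.Iio x) := by
      ext w
      constructor
      · intro hw
        rcases s.le_or_le hw.1 hx with h | h
        · rcases h.eq_or_lt with h | h
          · exact Or.inl h
          · exact Or.inr ⟨hw.1, h⟩
        · rcases h.eq_or_lt with h | h
          · exact Or.inl h.symm
          · exact absurd (hz.2 ⟨hw.1, h⟩ hw.2.le) (not_le_of_gt hw.2)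
      · rintro (rfl | hw)
        · exact ⟨hx, hz1.2⟩
        · exact ⟨hw.1, lt_trans hw.2 hz1.2⟩
    have h1 := congrArg Set.encard hset
    rw [Set.encard_insert_of_notMem (by simp), (key s z hz1.1).1, (key s x hx).1] at h1
    have h2 : (rk z + 1).toNat = (rk x + 1).toNat + 1 := by exact_mod_cast h1
    have := (key s x hx).2
    omega
  have hmono : StrictMono (rk : P → ℤ) := by
    intro x y hxy
    have hfi : Order.height y ≠ ⊤ := by
      obtain ⟨s, hs⟩ := IsChain.exists_flag (c := {y}) IsChain.singleton
      rw [height_eq_of_mem_flag hf s (hs rfl)]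
      exact Set.encard_ne_top_iff.2 ((hfin s).subset Set.inter_subset_left)
    have h1 := Order.height_add_one_le hxy
    lift Order.height y to ℕ using hfi with b hb
    have hfx : Order.height x ≠ ⊤ := by
      intro hx; rw [hx] at h1; simp at h1
    rw [rk, rk, ← hb]
    lift Order.height x to ℕ using hfx with a ha
    simp only [ENat.toNat_natCast]
    have : a + 1 ≤ b := by exact_mod_cast h1
    omega
  obtain ⟨b, hb⟩ := h.exists_least
  obtain ⟨t, ht⟩ := h.exists_greatest
  refine ⟨hmono, ⟨b, hb, ?_⟩, ⟨t, ht, ?_⟩, hsucc⟩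
  · have : Order.height b = 0 := Order.height_eq_zero.2 fun y _ => hb y
    simp [rk, this]
  · obtain ⟨s, hs⟩ := IsChain.exists_flag (c := {t}) IsChain.singleton
    have hts : t ∈ s := hs rfl
    have h1 := (key s t hts).1
    have h2 := (key s t hts).2
    have hset : (s : Set P) = insert t ((s : Set P) ∩ Set.Iio t) := by
      ext w
      constructor
      · intro hw
        rcases (ht w).eq_or_lt with h | h
        · exact Or.inl h
        · exact Or.inr ⟨hw, h⟩
      · rintro (rfl | hw)
        · exact hts
        · exact hw.1
    have h3 := hf s
    rw [hset, Set.encard_insert_of_notMem (by simp), h1] at h3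
    have : (rk t + 1).toNat + 1 = n + 2 := by exact_mod_cast h3
    omega

/-! ### Flags of graded posets: restriction, gluing, adjacency -/

theorem Flag.eq_of_forall_mem {P : Type*} [PartialOrder P] {s t : Flag P}
    (h : ∀ x ∈ s, x ∈ t) : s = t :=
  Flag.ext (s.max_chain' t.chain_le h)

namespace IsRankFun

variable {P : Type*} [PartialOrder P] {n : ℤ} {F G : P}

theorem least_mem_flag (h : IsRankFun (rk : P → ℤ) n) (s : Flag P) {x : P} (hx : rk x = -1) :
    x ∈ s :=
  Flag.mem_iff_forall_le_or_ge.2 fun y _ => Or.inl (h.le_of_rank_eq_neg_one hx y)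

theorem greatest_mem_flag (h : IsRankFun (rk : P → ℤ) n) (s : Flag P) {x : P} (hx : rk x = n) :
    x ∈ s :=
  Flag.mem_iff_forall_le_or_ge.2 fun y _ => Or.inr (h.le_of_rank_eq_top hx y)

/-- The flag that a flag through `F` and `G` induces on the section `G / F`. -/
def restrictFlag (h : IsRankFun (rk : P → ℤ) n) (s : Flag P) (hF : F ∈ s) (hG : G ∈ s)
    (hFG : F ≤ G) : Flag (Set.Icc F G) :=
  Flag.ofIsMaxChain {x | (x : P) ∈ s} <| (h.icc hFG).isMaxChain
    (fun x hx y hy _ => s.le_or_le hx hy) fun j h1 h2 => by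
      have hb := h.neg_one_le F
      have ht := h.le_top G
      obtain ⟨x, hx, hxr⟩ := h.exists_mem_flag s (j := j + rk F + 1) (by omega) (by omega)
      exact ⟨⟨x, h.flag_le s hF hx (by omega), h.flag_le s hx hG (by omega)⟩, hx, by simp; omega⟩

/-- Replace the part of a flag between two of its faces by a given flag of the section. -/
def glueFlag (h : IsRankFun (rk : P → ℤ) n) (s : Flag P) (hF : F ∈ s) (hG : G ∈ s)
    (hFG : F ≤ G) (u : Flag (Set.Icc F G)) : Flag P :=
  Flag.ofIsMaxChain
    {x | (x ∈ s ∧ (x ≤ F ∨ G ≤ x)) ∨ ∃ hx : x ∈ Set.Icc F G, (⟨x, hx⟩ : Set.Icc F G) ∈ u} <|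
    h.isMaxChain (by
      rintro x (⟨hx, hx'⟩ | ⟨hx, hx'⟩) y (⟨hy, hy'⟩ | ⟨hy, hy'⟩) -
      · exact s.le_or_le hx hy
      · rcases hx' with hx' | hx'
        · exact Or.inl (hx'.trans hy.1)
        · exact Or.inr (hy.2.trans hx')
      · rcases hy' with hy' | hy'
        · exact Or.inr (hy'.trans hx.1)
        · exact Or.inl (hx.2.trans hy')
      · exact u.le_or_le hx' hy') fun j h1 h2 => by
      by_cases hj : rk F ≤ j ∧ j ≤ rk G
      · obtain ⟨x, hx, hxr⟩ := (h.icc hFG).exists_mem_flag u (j := j - rk F - 1) (by omega)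
          (by omega)
        exact ⟨x, Or.inr ⟨x.2, hx⟩, by simp at hxr; omega⟩
      · obtain ⟨x, hx, hxr⟩ := h.exists_mem_flag s h1 h2
        refine ⟨x, Or.inl ⟨hx, ?_⟩, hxr⟩
        by_cases hj' : j < rk F
        · exact Or.inl (h.flag_le s hx hF (by omega))
        · exact Or.inr (h.flag_le s hG hx (by omega))

theorem mem_glueFlag (h : IsRankFun (rk : P → ℤ) n) (s : Flag P) (hF : F ∈ s) (hG : G ∈ s)
    (hFG : F ≤ G) (u : Flag (Set.Icc F G)) (x : P) : x ∈ h.glueFlag s hF hG hFG u ↔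
      (x ∈ s ∧ (x ≤ F ∨ G ≤ x)) ∨ ∃ hx : x ∈ Set.Icc F G, (⟨x, hx⟩ : Set.Icc F G) ∈ u := Iff.rfl

theorem left_mem_flag_icc (h : IsRankFun (rk : P → ℤ) n) (hFG : F ≤ G) (u : Flag (Set.Icc F G)) :
    (⟨F, le_rfl, hFG⟩ : Set.Icc F G) ∈ u :=
  (h.icc hFG).to_rk.least_mem_flag u (by rw [h.rk_icc]; simp)

theorem right_mem_flag_icc (h : IsRankFun (rk : P → ℤ) n) (hFG : F ≤ G) (u : Flag (Set.Icc F G)) :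
    (⟨G, hFG, le_rfl⟩ : Set.Icc F G) ∈ u :=
  (h.icc hFG).to_rk.greatest_mem_flag u (by rw [h.rk_icc])

theorem mem_glueFlag_iff (h : IsRankFun (rk : P → ℤ) n) (s : Flag P) (hF : F ∈ s) (hG : G ∈ s)
    (hFG : F ≤ G) (u : Flag (Set.Icc F G)) (x : Set.Icc F G) :
    (x : P) ∈ h.glueFlag s hF hG hFG u ↔ x ∈ u := by
  rw [mem_glueFlag]
  constructor
  · rintro (⟨_, hx | hx⟩ | ⟨_, hx⟩)
    · rw [show x = ⟨F, le_rfl, hFG⟩ from Subtype.ext (hx.antisymm x.2.1)]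
      exact h.left_mem_flag_icc hFG u
    · rw [show x = ⟨G, hFG, le_rfl⟩ from Subtype.ext (x.2.2.antisymm hx)]
      exact h.right_mem_flag_icc hFG u
    · exact hx
  · exact fun hx => Or.inr ⟨x.2, hx⟩

theorem restrictFlag_glueFlag (h : IsRankFun (rk : P → ℤ) n) (s : Flag P) (hF : F ∈ s)
    (hG : G ∈ s) (hFG : F ≤ G) (u : Flag (Set.Icc F G)) (hF' hG') :
    h.restrictFlag (h.glueFlag s hF hG hFG u) hF' hG' hFG = u :=
  SetLike.ext fun x => h.mem_glueFlag_iff s hF hG hFG u x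

theorem left_mem_glueFlag (h : IsRankFun (rk : P → ℤ) n) (s : Flag P) (hF : F ∈ s) (hG : G ∈ s)
    (hFG : F ≤ G) (u : Flag (Set.Icc F G)) : F ∈ h.glueFlag s hF hG hFG u :=
  Or.inl ⟨hF, Or.inl le_rfl⟩

theorem right_mem_glueFlag (h : IsRankFun (rk : P → ℤ) n) (s : Flag P) (hF : F ∈ s) (hG : G ∈ s)
    (hFG : F ≤ G) (u : Flag (Set.Icc F G)) : G ∈ h.glueFlag s hF hG hFG u :=
  Or.inl ⟨hG, Or.inr le_rfl⟩

/-- The least and the greatest face lie in every flag, so they cannot be exchanged. -/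
theorem flagAdj_bounds (h : IsRankFun (rk : P → ℤ) n) {j : ℤ} {s t : Flag P}
    (hst : FlagAdj j s t) : 0 ≤ j ∧ j < n := by
  by_contra hj
  refine hst.1 (Flag.eq_of_forall_mem fun x hx => ?_)
  by_cases hxj : rk x = j
  · have h1 := h.neg_one_le x
    have h2 := h.le_top x
    by_cases h3 : rk x = -1
    · exact h.least_mem_flag t h3
    · exact h.greatest_mem_flag t (by omega)
  · exact (hst.2 x hxj).1 hx

theorem flagAdj_glueFlag (h : IsRankFun (rk : P → ℤ) n) (s : Flag P) (hF : F ∈ s) (hG : G ∈ s)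
    (hFG : F ≤ G) {u v : Flag (Set.Icc F G)} {j : ℤ} (huv : FlagAdj j u v) :
    rk F < j + rk F + 1 ∧ j + rk F + 1 < rk G ∧
      FlagAdj (j + rk F + 1) (h.glueFlag s hF hG hFG u) (h.glueFlag s hF hG hFG v) := by
  have hb := (h.icc hFG).to_rk.flagAdj_bounds huv
  refine ⟨by omega, by omega, fun he => huv.1 ?_, fun x hx => ?_⟩
  · ext x
    exact (h.mem_glueFlag_iff s hF hG hFG u x).symm.trans
      ((by rw [he]) : _ ↔ _) |>.trans (h.mem_glueFlag_iff s hF hG hFG v x)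
  · rw [mem_glueFlag, mem_glueFlag]
    refine or_congr Iff.rfl (exists_congr fun hx' => huv.2 _ ?_)
    rw [h.rk_icc]; simp; omega

/-- Flags through `F` and `G` are connected, by changes between `F` and `G`, to all flags
that differ only between `F` and `G`, if the section `G / F` is flag-connected. -/
theorem section_connected (h : IsRankFun (rk : P → ℤ) n) {s t : Flag P} (hF : F ∈ s) (hG : G ∈ s)
    (hF' : F ∈ t) (hG' : G ∈ t) (hFG : F ≤ G) (hc : FlagConnected (Set.Icc F G)) :
    ∃ s' : Flag P, (∀ x, x ∈ s' ↔ (x ∈ s ∧ (x ≤ F ∨ G ≤ x)) ∨ (x ∈ t ∧ F ≤ x ∧ x ≤ G)) ∧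
      Relation.ReflTransGen (fun s t => ∃ j, rk F < j ∧ j < rk G ∧ FlagAdj j s t) s s' := by
  refine ⟨h.glueFlag s hF hG hFG (h.restrictFlag t hF' hG' hFG), fun x => ?_, ?_⟩
  · rw [mem_glueFlag]
    exact or_congr Iff.rfl ⟨fun ⟨h1, h2⟩ => ⟨h2, h1⟩, fun ⟨h1, h2⟩ => ⟨h2, h1⟩⟩
  · have hs : h.glueFlag s hF hG hFG (h.restrictFlag s hF hG hFG) = s :=
      Flag.eq_of_forall_mem fun x hx => by
        rcases hx with hx | ⟨_, hx⟩
        · exact hx.1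
        · exact hx
    have := (hc (h.restrictFlag s hF hG hFG) (h.restrictFlag t hF' hG' hFG)).lift
      (p := fun s t => ∃ j, rk F < j ∧ j < rk G ∧ FlagAdj j s t)
      (h.glueFlag s hF hG hFG) fun u v ⟨j, huv⟩ => ⟨_, h.flagAdj_glueFlag s hF hG hFG huv⟩
    rwa [Function.onFun, hs] at this

/-- A section is flag-connected if any two flags through its ends are connected via such flags. -/
theorem flagConnected_icc (h : IsRankFun (rk : P → ℤ) n) (hFG : F ≤ G)
    (H : ∀ s t : Flag P, F ∈ s → G ∈ s → F ∈ t → G ∈ t →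
      Relation.ReflTransGen (fun s t => (∃ j, FlagAdj j s t) ∧ F ∈ t ∧ G ∈ t) s t) :
    FlagConnected (Set.Icc F G) := by
  intro u v
  obtain ⟨s₀, hF₀, hG₀⟩ := exists_flag_pair hFG
  have key : ∀ s t : Flag P, ∀ (h1 : F ∈ s) (h2 : G ∈ s),
      Relation.ReflTransGen (fun s t => (∃ j, FlagAdj j s t) ∧ F ∈ t ∧ G ∈ t) s t →
      ∃ (h3 : F ∈ t) (h4 : G ∈ t), Relation.ReflTransGen (fun s t => ∃ j, FlagAdj j s t)
        (h.restrictFlag s h1 h2 hFG) (h.restrictFlag t h3 h4 hFG) := by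
    intro s t h1 h2 hst
    induction hst with
    | refl => exact ⟨h1, h2, .refl⟩
    | tail _ hbc ih =>
      obtain ⟨h5, h6, ih⟩ := ih
      obtain ⟨⟨j, hj⟩, h7, h8⟩ := hbc
      refine ⟨h7, h8, ?_⟩
      -- A step that changes a face outside the section leaves the restricted flag as it is and is
      -- dropped.
      by_cases he : h.restrictFlag _ h5 h6 hFG = h.restrictFlag _ h7 h8 hFG
      · rwa [← he]
      · refine ih.tail ⟨j - rk F - 1, he, fun x hx => ?_⟩
        rw [h.rk_icc] at hx
        exact hj.2 _ fun h' => hx (by omega)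
  obtain ⟨_, _, h3⟩ := key _ _ (h.left_mem_glueFlag s₀ hF₀ hG₀ hFG u)
    (h.right_mem_glueFlag s₀ hF₀ hG₀ hFG u) (H _ _ (h.left_mem_glueFlag s₀ hF₀ hG₀ hFG u)
    (h.right_mem_glueFlag s₀ hF₀ hG₀ hFG u) (h.left_mem_glueFlag s₀ hF₀ hG₀ hFG v)
    (h.right_mem_glueFlag s₀ hF₀ hG₀ hFG v))
  rwa [restrictFlag_glueFlag, restrictFlag_glueFlag] at h3

end IsRankFun

/-! ### Transfer along isomorphisms -/

theorem Flag.mem_map {P Q : Type*} [PartialOrder P] [PartialOrder Q] (e : P ≃o Q) (s : Flag P)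
    (y : Q) : y ∈ Flag.map e s ↔ e.symm y ∈ s := by
  rw [← Flag.mem_coe_iff, Flag.coe_map]
  constructor
  · rintro ⟨x, hx, rfl⟩; simpa using hx
  · intro hy; exact ⟨e.symm y, hy, by simp⟩

theorem Flag.apply_mem_map {P Q : Type*} [PartialOrder P] [PartialOrder Q] (e : P ≃o Q)
    (s : Flag P) (x : P) : e x ∈ Flag.map e s ↔ x ∈ s := by
  rw [Flag.mem_map, e.symm_apply_apply]

theorem FlagAdj.map {P Q : Type*} [PartialOrder P] [PartialOrder Q] (e : P ≃o Q) {j : ℤ}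
    {s t : Flag P} (h : FlagAdj j s t) : FlagAdj j (Flag.map e s) (Flag.map e t) := by
  refine ⟨fun he => h.1 ((Flag.map e).injective he), fun y hy => ?_⟩
  rw [Flag.mem_map, Flag.mem_map]
  exact h.2 _ (by rwa [rk_orderIso])

theorem FlagConnected.congr {P Q : Type*} [PartialOrder P] [PartialOrder Q] (e : P ≃o Q)
    (h : FlagConnected P) : FlagConnected Q := by
  intro s t
  have := (h (Flag.map e.symm s) (Flag.map e.symm t)).lift
    (p := fun s t => ∃ j : ℤ, FlagAdj j s t) (Flag.map e) fun u v ⟨j, huv⟩ => ⟨j, huv.map e⟩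
  have hs : ∀ s, Flag.map e (Flag.map e.symm s) = s := fun s => by
    ext y; simp
  rwa [Function.onFun, hs, hs] at this

theorem FlagTransitive.congr {P Q : Type*} [PartialOrder P] [PartialOrder Q] (e : P ≃o Q)
    (h : FlagTransitive P) : FlagTransitive Q := by
  intro s t
  obtain ⟨g, hg⟩ := h (Flag.map e.symm s) (Flag.map e.symm t)
  refine ⟨(e.symm.trans g).trans e, SetLike.ext fun y => ?_⟩
  have := SetLike.ext_iff.1 hg (e.symm y)
  rw [Flag.mem_map, Flag.mem_map, Flag.mem_map] at this
  rw [Flag.mem_map]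
  simpa using this

/-- Corresponding sections of isomorphic posets are isomorphic. -/
def OrderIso.iccCongr {P Q : Type*} [PartialOrder P] [PartialOrder Q] (e : P ≃o Q) (F G : P) :
    Set.Icc F G ≃o Set.Icc (e F) (e G) where
  toFun x := ⟨e x, e.le_iff_le.2 x.2.1, e.le_iff_le.2 x.2.2⟩
  invFun y := ⟨e.symm y, e.le_symm_apply.2 y.2.1, e.symm_apply_le.2 y.2.2⟩
  left_inv x := by simp
  right_inv y := by simp
  map_rel_iff' := by intro a b; exact e.le_iff_le

/-- Corresponding lower sections of isomorphic posets are isomorphic. -/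
def OrderIso.iicCongr {P Q : Type*} [PartialOrder P] [PartialOrder Q] (e : P ≃o Q) (G : P) :
    Set.Iic G ≃o Set.Iic (e G) where
  toFun x := ⟨e x, e.le_iff_le.2 x.2⟩
  invFun y := ⟨e.symm y, e.symm_apply_le.2 y.2⟩
  left_inv x := by simp
  right_inv y := by simp
  map_rel_iff' := by intro a b; exact e.le_iff_le

/-- Sections of a lower section. -/
def iccIicIso {P : Type*} [PartialOrder P] {H : P} (F G : Set.Iic H) :
    Set.Icc F G ≃o Set.Icc (F : P) (G : P) where
  toFun x := ⟨x, x.2.1, x.2.2⟩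
  invFun y := ⟨⟨y, y.2.2.trans G.2⟩, y.2.1, y.2.2⟩
  left_inv _ := rfl
  right_inv _ := rfl
  map_rel_iff' := Iff.rfl

/-- Lower sections of a lower section. -/
def iicIicIso {P : Type*} [PartialOrder P] {H : P} (G : Set.Iic H) :
    Set.Iic G ≃o Set.Iic (G : P) where
  toFun x := ⟨x, x.2⟩
  invFun y := ⟨⟨y, y.2.trans G.2⟩, y.2⟩
  left_inv _ := rfl
  right_inv _ := rfl
  map_rel_iff' := Iff.rfl

theorem encard_Ioo_orderIso {P Q : Type*} [PartialOrder P] [PartialOrder Q] (e : P ≃o Q) (F G : P) :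
    (Set.Ioo (e F) (e G)).encard = (Set.Ioo F G).encard := by
  rw [← OrderIso.image_Ioo, e.injective.encard_image]

theorem encard_Ioo_iic {P : Type*} [PartialOrder P] {H : P} (F G : Set.Iic H) :
    (Set.Ioo (F : P) (G : P)).encard = (Set.Ioo F G).encard := by
  rw [← Subtype.val_injective.encard_image]
  congr 1
  ext x
  constructor
  · intro hx; exact ⟨⟨x, hx.2.le.trans G.2⟩, hx, rfl⟩
  · rintro ⟨y, hy, rfl⟩; exact hy

/-! ### Polytopes of integral rank -/

/-- An equivalent description of polytopes in terms of the rank function, where the rank of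
the polytope may be any integer `≥ -1`. -/
structure IsGradedPolytope (n : ℤ) (P : Type*) [PartialOrder P] : Prop where
  isRankFun : IsRankFun (rk : P → ℤ) n
  diamond : ∀ F G : P, F < G → rk G = rk F + 2 → (Set.Ioo F G).encard = 2
  strongly_connected : ∀ F G : P, F ≤ G → FlagConnected (Set.Icc F G)

theorem IsPolytope.isGradedPolytope {P : Type*} [PartialOrder P] {n : ℕ} (h : IsPolytope n P) :
    IsGradedPolytope n P :=
  ⟨h.isRankFun, h.diamond, h.strongly_connected⟩

namespace IsGradedPolytope

variable {P : Type*} [PartialOrder P] {n : ℤ}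

theorem isPolytope {m : ℕ} (h : IsGradedPolytope m P) : IsPolytope m P where
  exists_least := h.isRankFun.exists_least.imp fun _ hb => hb.1
  exists_greatest := h.isRankFun.exists_greatest.imp fun _ hb => hb.1
  flag_card s := h.isRankFun.flag_encard s rfl
  diamond := h.diamond
  strongly_connected := h.strongly_connected

theorem iic (h : IsGradedPolytope n P) (H : P) : IsGradedPolytope (rk H) (Set.Iic H) where
  isRankFun := (h.isRankFun.iic H).to_rk
  diamond F G hFG hr := by
    rw [← encard_Ioo_iic]
    refine h.diamond _ _ hFG ?_
    rwa [h.isRankFun.rk_iic, h.isRankFun.rk_iic] at hr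
  strongly_connected F G hFG :=
    (h.strongly_connected (F : P) (G : P) hFG).congr (iccIicIso F G).symm

theorem congr {Q : Type*} [PartialOrder Q] (e : P ≃o Q) (h : IsGradedPolytope n P) :
    IsGradedPolytope n Q where
  isRankFun := h.isRankFun.congr e
  diamond F G hFG hr := by
    rw [← encard_Ioo_orderIso e.symm]
    exact h.diamond _ _ (e.symm.lt_iff_lt.2 hFG) (by rwa [rk_orderIso, rk_orderIso])
  strongly_connected F G hFG := by
    have := (h.strongly_connected _ _ (e.symm.monotone hFG)).congr (e.iccCongr (e.symm F) (e.symm G))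
    rwa [e.apply_symm_apply, e.apply_symm_apply] at this

/-- If two faces lie strictly between `x` and `y` and differ from a third, they are equal. -/
theorem eq_of_diamond (h : IsGradedPolytope n P) {x y a b c : P} (hr : rk y = rk x + 2)
    (ha : a ∈ Set.Ioo x y) (hb : b ∈ Set.Ioo x y) (hc : c ∈ Set.Ioo x y) (hab : b ≠ a)
    (hac : c ≠ a) : b = c := by
  obtain ⟨p, q, hpq, he⟩ := Set.encard_eq_two.1 (h.diamond x y (ha.1.trans ha.2) hr)
  rw [he] at ha hb hc
  simp only [Set.mem_insert_iff, Set.mem_singleton_iff] at ha hb hc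
  grind

/-- The new face lies in the diamond spanned by the neighbouring faces of `s`, which offers only one
alternative. -/
theorem flagAdj_unique (h : IsGradedPolytope n P) {j : ℤ} {s t t' : Flag P}
    (ht : FlagAdj j s t) (ht' : FlagAdj j s t') : t = t' := by
  have hR := h.isRankFun
  obtain ⟨h0, h1⟩ := hR.flagAdj_bounds ht
  obtain ⟨x, hx, hxr⟩ := hR.exists_mem_flag s (j := j - 1) (by omega) (by omega)
  obtain ⟨y, hy, hyr⟩ := hR.exists_mem_flag s (j := j + 1) (by omega) (by omega)
  obtain ⟨a, ha, har⟩ := hR.exists_mem_flag s (j := j) (by omega) (by omega)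
  have key : ∀ t, FlagAdj j s t → ∃ b ∈ t, rk b = j ∧ b ≠ a ∧ b ∈ Set.Ioo x y := by
    intro t ht
    obtain ⟨b, hb, hbr⟩ := hR.exists_mem_flag t (j := j) (by omega) (by omega)
    refine ⟨b, hb, hbr, ?_, hR.flag_lt t ((ht.2 x (by omega)).1 hx) hb (by omega),
      hR.flag_lt t hb ((ht.2 y (by omega)).1 hy) (by omega)⟩
    rintro rfl
    refine ht.1 (Flag.eq_of_forall_mem fun z hz => ?_)
    by_cases hzj : rk z = j
    · rwa [hR.flag_inj s hz ha (by omega)]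
    · exact (ht.2 z hzj).1 hz
  obtain ⟨b, hb, hbr, hba, hb'⟩ := key t ht
  obtain ⟨c, hc, hcr, hca, hc'⟩ := key t' ht'
  have hbc := h.eq_of_diamond (by omega) ⟨hR.flag_lt s hx ha (by omega),
    hR.flag_lt s ha hy (by omega)⟩ hb' hc' hba hca
  refine Flag.eq_of_forall_mem fun z hz => ?_
  by_cases hzj : rk z = j
  · rwa [hR.flag_inj t hz hb (by omega), hbc]
  · exact (ht'.2 z hzj).1 ((ht.2 z hzj).2 hz)

theorem exists_flagAdj (h : IsGradedPolytope n P) (s : Flag P) {j : ℤ} (h0 : 0 ≤ j) (h1 : j < n) :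
    ∃ t, FlagAdj j s t := by
  have hR := h.isRankFun
  obtain ⟨x, hx, hxr⟩ := hR.exists_mem_flag s (j := j - 1) (by omega) (by omega)
  obtain ⟨y, hy, hyr⟩ := hR.exists_mem_flag s (j := j + 1) (by omega) (by omega)
  obtain ⟨a, ha, har⟩ := hR.exists_mem_flag s (j := j) (by omega) (by omega)
  have hxy := hR.flag_lt s hx hy (by omega)
  have hxa := hR.flag_lt s hx ha (by omega)
  have hay := hR.flag_lt s ha hy (by omega)
  obtain ⟨b, hb, hba⟩ : ∃ b ∈ Set.Ioo x y, b ≠ a := by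
    obtain ⟨p, q, hpq, he⟩ := Set.encard_eq_two.1 (h.diamond x y hxy (by omega))
    by_cases hpa : p = a
    · exact ⟨q, by rw [he]; simp, fun hq => hpq (hpa.trans hq.symm)⟩
    · exact ⟨p, by rw [he]; simp, hpa⟩
  have hbr : rk b = j := by
    have h2 := hR.strictMono hb.1
    have h3 := hR.strictMono hb.2
    omega
  -- Replace the face of rank `j` by the other face of its diamond.
  have hmax : IsMaxChain (· ≤ ·) (insert b {z | z ∈ s ∧ rk z ≠ j}) := by
    refine hR.isMaxChain ?_ fun k hk1 hk2 => ?_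
    · refine IsChain.insert (fun z hz w hw _ => s.le_or_le hz.1 hw.1) fun z hz _ => ?_
      rcases lt_or_gt_of_ne hz.2 with hz' | hz'
      · exact Or.inr ((hR.flag_le s hz.1 hx (by omega)).trans hb.1.le)
      · exact Or.inl (hb.2.le.trans (hR.flag_le s hy hz.1 (by omega)))
    · by_cases hkj : k = j
      · exact ⟨b, Set.mem_insert _ _, by omega⟩
      · obtain ⟨z, hz, hzr⟩ := hR.exists_mem_flag s hk1 hk2
        exact ⟨z, Set.mem_insert_of_mem _ ⟨hz, by omega⟩, hzr⟩
  refine ⟨Flag.ofIsMaxChain _ hmax, fun he => hba ?_, fun z hz => ?_⟩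
  · have : b ∈ s := by rw [he]; exact Set.mem_insert _ _
    exact hR.flag_inj s this ha (by omega)
  · constructor
    · exact fun h' => Set.mem_insert_of_mem _ ⟨h', hz⟩
    · rintro (rfl | h')
      · exact absurd hbr hz
      · exact h'.1

/-- Strong flag-connectedness: two flags with the same faces of all ranks outside `I` are connected
by changes of faces with ranks in `I`. -/
theorem connected_of_agree (h : IsGradedPolytope n P) (I : Set ℤ) (s t : Flag P)
    (hst : ∀ x, rk x ∉ I → x ∈ s → x ∈ t) :
    Relation.ReflTransGen (fun s t => ∃ j ∈ I, FlagAdj j s t) s t := by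
  classical
  have hR := h.isRankFun
  -- Induction on the number of ranks in which `s` has a face missing from `t`.
  generalize hd : ((Finset.Icc (-1) n).filter fun j => ∃ x ∈ s, rk x = j ∧ x ∉ t).card = d
  induction d using Nat.strong_induction_on generalizing s with
  | _ d ih =>
    by_cases hex : ∃ x ∈ s, x ∉ t
    swap
    · push Not at hex
      rw [Flag.eq_of_forall_mem hex]
    obtain ⟨x, hx, hxt⟩ := hex
    obtain ⟨b, hb, hbr⟩ := hR.exists_least
    obtain ⟨e, he, her⟩ := hR.exists_greatest
    -- `F` and `G` are the common faces of `s` and `t` nearest to `x` from below and above.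
    -- Connectedness of `G / F` replaces the part of `s` between them by that of `t`.
    obtain ⟨lo, ⟨hlo, F, hFs, hFt, hFr⟩, hlomax⟩ := Int.exists_greatest_of_bdd
      (P := fun k => k ≤ rk x ∧ ∃ y ∈ s, y ∈ t ∧ rk y = k) ⟨rk x, fun k hk => hk.1⟩
      ⟨-1, hR.neg_one_le x, b, hR.least_mem_flag s hbr, hR.least_mem_flag t hbr, hbr⟩
    obtain ⟨hi, ⟨hhi, G, hGs, hGt, hGr⟩, hhimin⟩ := Int.exists_least_of_bdd
      (P := fun k => rk x ≤ k ∧ ∃ y ∈ s, y ∈ t ∧ rk y = k) ⟨rk x, fun k hk => hk.1⟩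
      ⟨n, hR.le_top x, e, hR.greatest_mem_flag s her, hR.greatest_mem_flag t her, her⟩
    have hFG := hR.flag_le s hFs hGs (by omega)
    obtain ⟨s', hs', hconn⟩ := hR.section_connected hFs hGs hFt hGt hFG
      (h.strongly_connected F G hFG)
    -- Strictly between `F` and `G` no face of `s` lies in `t`, so by assumption all these ranks
    -- belong to `I`.
    have hI : ∀ j, rk F < j → j < rk G → j ∈ I := by
      intro j h1 h2
      by_contra hj
      obtain ⟨y, hy, hyr⟩ := hR.exists_mem_flag s (j := j)
        (by have := hR.neg_one_le F; omega) (by have := hR.le_top G; omega)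
      have hyt : y ∈ t := hst y (by rwa [hyr]) hy
      rcases le_total j (rk x) with hjx | hjx
      · have := hlomax j ⟨hjx, y, hy, hyt, hyr⟩; omega
      · have := hhimin j ⟨hjx, y, hy, hyt, hyr⟩; omega
    refine Relation.ReflTransGen.trans
      (Relation.ReflTransGen.mono (fun u v ⟨j, h1, h2, h3⟩ => ⟨j, hI j h1 h2, h3⟩) _ _ hconn) (ih _ ?_ s' ?_ rfl)
    · rw [← hd]
      apply Finset.card_lt_card
      rw [Finset.ssubset_iff_of_subset]
      · refine ⟨rk x, ?_, ?_⟩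
        · simp only [Finset.mem_filter, Finset.mem_Icc]
          exact ⟨⟨hR.neg_one_le x, hR.le_top x⟩, x, hx, rfl, hxt⟩
        · simp only [Finset.mem_filter, not_and, not_exists]
          rintro - y hy hyr hyt
          rcases (hs' y).1 hy with ⟨hys, hy'⟩ | hy'
          · rw [hR.flag_inj s hys hx hyr] at hy' hyt
            rcases hy' with hy' | hy'
            · have := hR.strictMono.monotone hy'
              exact hyt (by rwa [hR.flag_inj s hx hFs (by omega)])
            · have := hR.strictMono.monotone hy'
              exact hyt (by rwa [hR.flag_inj s hx hGs (by omega)])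
          · exact hyt hy'.1
      · intro k hk
        simp only [Finset.mem_filter] at hk ⊢
        refine ⟨hk.1, ?_⟩
        obtain ⟨y, hy, hyr, hyt⟩ := hk.2
        rcases (hs' y).1 hy with ⟨hys, -⟩ | hy'
        · exact ⟨y, hys, hyr, hyt⟩
        · exact absurd hy'.1 hyt
    · intro y hyI hy
      rcases (hs' y).1 hy with ⟨hys, -⟩ | hy'
      · exact hst y hyI hys
      · exact hy'.1

theorem exists_flag_mem (x : P) : ∃ s : Flag P, x ∈ s := by
  obtain ⟨s, hs, -⟩ := exists_flag_pair (le_refl x)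
  exact ⟨s, hs⟩

/-- Automorphisms of a polytope are determined by their effect on a flag. -/
theorem eq_one_of_fix (h : IsGradedPolytope n P) {g : P ≃o P} {s : Flag P}
    (hg : ∀ x ∈ s, g x = x) : g = 1 := by
  have hfix : ∀ t : Flag P, Flag.map g t = t → ∀ x ∈ t, g x = x := by
    intro t ht x hx
    refine h.isRankFun.flag_inj t ?_ hx (rk_orderIso g x)
    rw [← ht, Flag.apply_mem_map]; exact hx
  have hs : Flag.map g s = s := (Flag.eq_of_forall_mem fun x hx => by
    rw [← hg x hx, Flag.apply_mem_map]; exact hx).symm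
  -- Fixing a flag propagates to its `j`-adjacent flag, which is unique, and hence to all flags.
  have key : ∀ t, Flag.map g t = t := by
    intro t
    have := h.connected_of_agree Set.univ s t (fun x hx => absurd (Set.mem_univ _) hx)
    induction this with
    | refl => exact hs
    | tail _ hbc ih =>
      obtain ⟨j, -, hj⟩ := hbc
      have := hj.map g
      rw [ih] at this
      exact h.flagAdj_unique this hj
  ext x
  obtain ⟨t, ht⟩ := exists_flag_mem x
  exact hfix t (key t) x ht

theorem eq_of_eqOn (h : IsGradedPolytope n P) {Q : Type*} [PartialOrder Q] {g g' : P ≃o Q}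
    {s : Flag P} (hg : ∀ x ∈ s, g x = g' x) : g = g' := by
  have := h.eq_one_of_fix (g := g.trans g'.symm) (s := s) fun x hx => by
    simp [hg x hx]
  ext x
  have h1 : g'.symm (g x) = x := DFunLike.congr_fun this x
  calc g x = g' (g'.symm (g x)) := by simp
    _ = g' x := by rw [h1]

end IsGradedPolytope

/-! ### Regular polytopes -/

/-- The automorphisms that fix all faces of a flag with ranks outside `I`. -/
def flagStab {P : Type*} [PartialOrder P] (Φ : Flag P) (I : Set ℤ) : Subgroup (P ≃o P) where
  carrier := {g | ∀ x ∈ Φ, rk x ∉ I → g x = x}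
  mul_mem' {a b} ha hb x hx hxI := by rw [RelIso.mul_apply, hb x hx hxI, ha x hx hxI]
  one_mem' _ _ _ := rfl
  inv_mem' {a} ha x hx hxI := by
    conv_lhs => rw [← ha x hx hxI]
    exact RelIso.inv_apply_self a x

section

variable {P : Type*} [PartialOrder P]

theorem flagStab_inf (Φ : Flag P) (I J : Set ℤ) :
    flagStab Φ I ⊓ flagStab Φ J = flagStab Φ (I ∩ J) := by
  ext g
  constructor
  · rintro ⟨h1, h2⟩ x hx hxI
    by_cases h : rk x ∈ I
    · exact h2 x hx fun h' => hxI ⟨h, h'⟩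
    · exact h1 x hx h
  · exact fun h => ⟨fun x hx hxI => h x hx fun h' => hxI h'.1,
      fun x hx hxI => h x hx fun h' => hxI h'.2⟩

theorem flagStab_mono (Φ : Flag P) {I J : Set ℤ} (hIJ : I ⊆ J) : flagStab Φ I ≤ flagStab Φ J :=
  fun _ hg x hx hxJ => hg x hx fun h => hxJ (hIJ h)

end

/-- Regular polytopes of integral rank. -/
structure IsRegularPolytope (n : ℤ) (P : Type*) [PartialOrder P] : Prop
    extends IsGradedPolytope n P where
  flagTransitive : FlagTransitive P

namespace IsRegularPolytope

variable {P : Type*} [PartialOrder P] {n : ℤ} {Φ : Flag P} {i j : ℤ}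

theorem mem_flagStab_of_adj (h : IsRegularPolytope n P) {g : P ≃o P}
    (hg : FlagAdj j Φ (Flag.map g Φ)) : g ∈ flagStab Φ {j} := fun x hx hxj =>
  h.isRankFun.flag_inj (Flag.map g Φ) ((Flag.apply_mem_map g Φ x).2 hx) ((hg.2 x hxj).1 hx)
    (rk_orderIso g x)

theorem adj_of_mem_flagStab (h : IsRegularPolytope n P) {g : P ≃o P} (hg : g ∈ flagStab Φ {j})
    (h1 : g ≠ 1) : FlagAdj j Φ (Flag.map g Φ) := by
  refine ⟨fun he => h1 (h.eq_one_of_fix (s := Φ) fun x hx => ?_), fun x hx => ?_⟩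
  · refine h.isRankFun.flag_inj Φ ?_ hx (rk_orderIso g x)
    rw [he, Flag.apply_mem_map]; exact hx
  · rw [Flag.mem_map]
    constructor
    · intro hxΦ
      rw [show g.symm x = x from (flagStab Φ {j}).inv_mem hg x hxΦ hx]; exact hxΦ
    · intro hxΦ
      rw [← hg _ hxΦ (by rw [rk_orderIso]; exact hx)] at hxΦ
      simpa using hxΦ

theorem exists_stdGen (h : IsRegularPolytope n P) (Φ : Flag P) (h0 : 0 ≤ j) (h1 : j < n) :
    ∃ g : P ≃o P, FlagAdj j Φ (Flag.map g Φ) := by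
  obtain ⟨t, ht⟩ := h.exists_flagAdj Φ h0 h1
  obtain ⟨g, rfl⟩ := h.flagTransitive Φ t
  exact ⟨g, ht⟩

theorem stdGen_adj (h : IsRegularPolytope n P) (Φ : Flag P) (h0 : 0 ≤ j) (h1 : j < n) :
    FlagAdj j Φ (Flag.map (stdGen Φ j) Φ) :=
  Classical.epsilon_spec (h.exists_stdGen Φ h0 h1)

theorem eq_of_map_eq (h : IsRegularPolytope n P) {g g' : P ≃o P}
    (he : Flag.map g Φ = Flag.map g' Φ) : g = g' := by
  refine h.eq_of_eqOn (s := Φ) fun x hx => ?_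
  refine h.isRankFun.flag_inj (Flag.map g Φ) ((Flag.apply_mem_map g Φ x).2 hx) ?_ ?_
  · rw [he, Flag.apply_mem_map]; exact hx
  · rw [rk_orderIso, rk_orderIso]

theorem existsUnique_stdGen (h : IsRegularPolytope n P) (Φ : Flag P) (h0 : 0 ≤ j) (h1 : j < n) :
    ∃! g : P ≃o P, FlagAdj j Φ (Flag.map g Φ) :=
  ⟨stdGen Φ j, h.stdGen_adj Φ h0 h1, fun _ hg =>
    h.eq_of_map_eq (h.flagAdj_unique hg (h.stdGen_adj Φ h0 h1))⟩

/-- This is how standard generators are recognized: no other nontrivial automorphism fixes the base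
faces of all ranks but one. -/
theorem eq_stdGen (h : IsRegularPolytope n P) {g : P ≃o P} (hg : g ∈ flagStab Φ {j})
    (hg1 : g ≠ 1) : g = stdGen Φ j := by
  have hadj := h.adj_of_mem_flagStab hg hg1
  obtain ⟨h0, h1⟩ := h.isRankFun.flagAdj_bounds hadj
  exact h.eq_of_map_eq (h.flagAdj_unique hadj (h.stdGen_adj Φ h0 h1))

theorem stdGen_mem (h : IsRegularPolytope n P) (Φ : Flag P) (h0 : 0 ≤ j) (h1 : j < n) :
    stdGen Φ j ∈ flagStab Φ {j} :=
  h.mem_flagStab_of_adj (h.stdGen_adj Φ h0 h1)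

theorem stdGen_ne_one (h : IsRegularPolytope n P) (Φ : Flag P) (h0 : 0 ≤ j) (h1 : j < n) :
    stdGen Φ j ≠ 1 := by
  intro he
  refine (h.stdGen_adj Φ h0 h1).1 (Flag.eq_of_forall_mem fun x hx => ?_)
  rw [he, Flag.mem_map]; exact hx

/-- A nontrivial square would again be the generator itself, which would then be trivial. -/
theorem stdGen_mul_self (h : IsRegularPolytope n P) (Φ : Flag P) (h0 : 0 ≤ j) (h1 : j < n) :
    stdGen Φ j * stdGen Φ j = 1 := by
  by_contra hne
  have hm := h.stdGen_mem Φ h0 h1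
  have := h.eq_stdGen (mul_mem hm hm) hne
  exact h.stdGen_ne_one Φ h0 h1 (mul_eq_left.1 this)

/-- The conjugate fixes every base face of rank other than `j`, so `eq_stdGen` identifies it. Only
the base face of rank `i` needs an argument. -/
theorem stdGen_mul_mul (h : IsRegularPolytope n P) (Φ : Flag P) (hi0 : 0 ≤ i) (hi1 : i < n)
    (h0 : 0 ≤ j) (h1 : j < n) (hij : i + 2 ≤ j ∨ j + 2 ≤ i) :
    stdGen Φ i * stdGen Φ j * stdGen Φ i = stdGen Φ j := by
  have hR := h.isRankFun
  have hmi := h.stdGen_mem Φ hi0 hi1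
  have hmj := h.stdGen_mem Φ h0 h1
  have hinv : ∀ x, stdGen Φ i (stdGen Φ i x) = x := fun x =>
    DFunLike.congr_fun (h.stdGen_mul_self Φ hi0 hi1) x
  refine h.eq_stdGen (fun x hx hxj => ?_) fun he => h.stdGen_ne_one Φ h0 h1 ?_
  · rw [RelIso.mul_apply, RelIso.mul_apply]
    by_cases hxi : rk x = i
    · obtain ⟨y, hy, hyr⟩ := hR.exists_mem_flag Φ (j := i - 1) (by omega) (by omega)
      obtain ⟨z, hz, hzr⟩ := hR.exists_mem_flag Φ (j := i + 1) (by omega) (by omega)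
      have hyx := hR.flag_lt Φ hy hx (by omega)
      have hxz := hR.flag_lt Φ hx hz (by omega)
      have hiy := hmi y hy (by simp; omega)
      have hiz := hmi z hz (by simp; omega)
      have hjx := hmj x hx hxj
      have hjy := hmj y hy (by simp; omega)
      have hjz := hmj z hz (by simp; omega)
      have hioo : ∀ g : P ≃o P, g y = y → g z = z → ∀ w ∈ Set.Ioo y z, g w ∈ Set.Ioo y z := by
        intro g h1 h2 w hw
        constructor
        · rw [← h1]; exact g.lt_iff_lt.2 hw.1
        · rw [← h2]; exact g.lt_iff_lt.2 hw.2
      have hix := hioo _ hiy hiz x ⟨hyx, hxz⟩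
      -- As `i - 1` and `i + 1` differ from `j`, the generator for `j` fixes `y`, `z` and `x`. Hence
      -- it also fixes the other face of the diamond between `y` and `z`.
      rw [show stdGen Φ j (stdGen Φ i x) = stdGen Φ i x from ?_, hinv]
      by_cases he : stdGen Φ i x = x
      · rw [he, hjx]
      · refine h.eq_of_diamond (by omega) ⟨hyx, hxz⟩ (hioo _ hjy hjz _ hix) hix ?_ he
        intro h'
        exact he ((stdGen Φ j).injective (h'.trans hjx.symm))
    · rw [hmi x hx hxi, hmj x hx hxj, hmi x hx hxi]
  · have h2 := h.stdGen_mul_self Φ hi0 hi1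
    have := congrArg (fun g => stdGen Φ i * g * stdGen Φ i) he
    rwa [show stdGen Φ i * (stdGen Φ i * stdGen Φ j * stdGen Φ i) * stdGen Φ i =
      (stdGen Φ i * stdGen Φ i) * stdGen Φ j * (stdGen Φ i * stdGen Φ i) by group, mul_one, h2,
      one_mul, mul_one] at this

theorem stdGen_commute (h : IsRegularPolytope n P) (Φ : Flag P) (hi0 : 0 ≤ i) (hi1 : i < n)
    (h0 : 0 ≤ j) (h1 : j < n) (hij : i + 2 ≤ j ∨ j + 2 ≤ i) :
    Commute (stdGen Φ i) (stdGen Φ j) := by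
  have h2 := h.stdGen_mul_mul Φ hi0 hi1 h0 h1 hij
  calc stdGen Φ i * stdGen Φ j
      = stdGen Φ i * stdGen Φ j * (stdGen Φ i * stdGen Φ i) := by
        rw [h.stdGen_mul_self Φ hi0 hi1, mul_one]
    _ = (stdGen Φ i * stdGen Φ j * stdGen Φ i) * stdGen Φ i := by group
    _ = _ := by rw [h2]

/-- If `g` fixes the base faces with ranks outside `I`, then `Φ` and its image under `g` are joined
by changes in ranks from `I`. A `j`-step from the image of `Φ` under `k` leads to its image under `k
* stdGen Φ j`, so the path spells `g` as a word. The set `Set.Ico 0 n` excludes ranks for which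
`stdGen` is an arbitrary choice. -/
theorem flagStab_eq_closure (h : IsRegularPolytope n P) (Φ : Flag P) (I : Set ℤ) :
    flagStab Φ I = Subgroup.closure (stdGen Φ '' (I ∩ Set.Ico 0 n)) := by
  apply le_antisymm
  · intro g hg
    have hconn := h.connected_of_agree (I ∩ Set.Ico 0 n) Φ (Flag.map g Φ) fun x hxI hx => by
      suffices g x = x by rw [← this, Flag.apply_mem_map]; exact hx
      by_cases hx' : rk x ∈ I
      · have h1 := h.isRankFun.neg_one_le x
        have h2 := h.isRankFun.le_top x
        by_cases h3 : rk x = -1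
        · exact h.isRankFun.flag_inj Φ (h.isRankFun.least_mem_flag Φ (by rw [rk_orderIso, h3])) hx
            (rk_orderIso g x)
        · have h4 : rk x = n := by
            by_contra h4
            exact hxI ⟨hx', by simp; omega⟩
          exact h.isRankFun.flag_inj Φ (h.isRankFun.greatest_mem_flag Φ (by rw [rk_orderIso, h4]))
            hx (rk_orderIso g x)
      · exact hg x hx hx'
    have key : ∀ t, Relation.ReflTransGen (fun s t => ∃ j ∈ I ∩ Set.Ico 0 n, FlagAdj j s t) Φ t →
        ∃ k ∈ Subgroup.closure (stdGen Φ '' (I ∩ Set.Ico 0 n)), Flag.map k Φ = t := by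
      intro t ht
      induction ht with
      | refl => exact ⟨1, one_mem _, Flag.ext (by simp)⟩
      | tail _ hbc ih =>
        obtain ⟨k, hk, rfl⟩ := ih
        obtain ⟨j, hj, hadj⟩ := hbc
        refine ⟨k * stdGen Φ j, mul_mem hk (Subgroup.subset_closure ⟨j, hj, rfl⟩), ?_⟩
        have h1 := (h.stdGen_adj Φ hj.2.1 hj.2.2).map k
        have h2 : Flag.map k (Flag.map (stdGen Φ j) Φ) = Flag.map (k * stdGen Φ j) Φ := by
          ext x; simp [Set.image_image]
        rw [← h2]
        exact h.flagAdj_unique h1 hadj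
    obtain ⟨k, hk, hkg⟩ := key _ hconn
    rwa [← h.eq_of_map_eq hkg]
  · rw [Subgroup.closure_le]
    rintro _ ⟨j, hj, rfl⟩
    exact flagStab_mono Φ (Set.singleton_subset_iff.2 hj.1) (h.stdGen_mem Φ hj.2.1 hj.2.2)

/-- A product formula for the subgroups generated by standard generators. -/
theorem exists_factor (h : IsRegularPolytope n P) {I J : Set ℤ} {s t : P ≃o P} {F : P} (hF : F ∈ Φ)
    (hs : s ∈ flagStab Φ I) (ht : t ∈ flagStab Φ J) (hst : (s * t) F = F) :
    ∃ k ∈ flagStab Φ I, k F = F ∧ k⁻¹ * (s * t) ∈ flagStab Φ J := by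
  have hR := h.isRankFun
  -- Base faces with ranks outside `I` are fixed by `s`, and the images under `s * t` of those with
  -- ranks outside `J` are images under `s` alone. Hence the two sets together form a chain, and
  -- adding `F`, which `s * t` fixes, keeps it a chain. The factor `k` carries `Φ` to a flag through
  -- this chain.
  have hc : IsChain (· ≤ ·) ({x | x ∈ Φ ∧ rk x ∉ I} ∪
      {y | ∃ x, x ∈ Φ ∧ (rk x ∉ J ∨ x = F) ∧ (s * t) x = y}) := by
    have h1 : ∀ x y, x ∈ Φ ∧ rk x ∉ I → (y ∈ Φ ∧ (rk y ∉ J ∨ y = F)) →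
        x ≤ (s * t) y ∨ (s * t) y ≤ x := by
      rintro x y ⟨hx, hxI⟩ ⟨hy, hy' | rfl⟩
      · rw [← hs x hx hxI, RelIso.mul_apply, ht y hy hy', s.le_iff_le, s.le_iff_le]
        exact Φ.le_or_le hx hy
      · rw [hst]; exact Φ.le_or_le hx hy
    rintro x (hx | ⟨x, hx, hx', rfl⟩) y (hy | ⟨y, hy, hy', rfl⟩) -
    · exact Φ.le_or_le hx.1 hy.1
    · exact h1 _ _ hx ⟨hy, hy'⟩
    · exact (h1 _ _ hy ⟨hx, hx'⟩).symm
    · exact (Φ.le_or_le hx hy).imp (s * t).le_iff_le.2 (s * t).le_iff_le.2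
  obtain ⟨S, hS⟩ := hc.exists_flag
  obtain ⟨k, rfl⟩ := h.flagTransitive Φ S
  have hk : ∀ x ∈ Φ, (rk x ∉ J ∨ x = F) → k x = (s * t) x := fun x hx hx' =>
    hR.flag_inj (Flag.map k Φ) ((Flag.apply_mem_map k Φ x).2 hx) (hS (Or.inr ⟨x, hx, hx', rfl⟩))
      (by rw [rk_orderIso, rk_orderIso])
  refine ⟨k, fun x hx hxI => ?_, ?_, fun x hx hxJ => ?_⟩
  · exact hR.flag_inj (Flag.map k Φ) ((Flag.apply_mem_map k Φ x).2 hx) (hS (Or.inl ⟨hx, hxI⟩))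
      (rk_orderIso k x)
  · rw [hk F hF (Or.inr rfl), hst]
  · rw [RelIso.mul_apply, ← hk x hx (Or.inl hxJ)]; exact RelIso.inv_apply_self k x

end IsRegularPolytope

/-! ### Extension of automorphisms of a facet -/

/-- The automorphism of a lower section induced by an automorphism that fixes its greatest face. -/
def iicAut {P : Type*} [PartialOrder P] {F : P} (g : P ≃o P) (hg : g F = F) :
    Set.Iic F ≃o Set.Iic F where
  toFun x := ⟨g x, (g.le_iff_le.2 x.2).trans_eq hg⟩
  invFun y := ⟨g.symm y, g.symm_apply_le.2 (y.2.trans_eq hg.symm)⟩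
  left_inv x := by simp
  right_inv y := by simp
  map_rel_iff' := by intro a b; exact g.le_iff_le

section Facet

variable {P : Type*} {K : Type*} [PartialOrder P] [PartialOrder K] {n : ℤ} {F : P}
  {e : K ≃o Set.Iic F} {Φ : Flag P}

theorem rk_facetIso (h : IsRankFun (rk : P → ℤ) n) (e : K ≃o Set.Iic F) (x : K) :
    rk (e x : P) = rk x := by
  rw [← h.rk_iic, rk_orderIso]

/-- The flag of a lower section induced by a flag through its greatest face. -/
def inducedFlag (h : IsRankFun (rk : P → ℤ) n) (e : K ≃o Set.Iic F) (hF : F ∈ Φ) : Flag K :=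
  Flag.ofIsMaxChain {x | (e x : P) ∈ Φ} <| ((h.iic F).to_rk.congr e.symm).isMaxChain
    (fun x hx y hy _ => (Φ.le_or_le hx hy).imp e.le_iff_le.1 e.le_iff_le.1) fun j h1 h2 => by
    obtain ⟨x, hx, hxr⟩ := h.exists_mem_flag Φ h1 (h2.trans (h.le_top F))
    refine ⟨e.symm ⟨x, h.flag_le Φ hx hF (by omega)⟩, ?_, ?_⟩
    · simpa using hx
    · rw [rk_orderIso, h.rk_iic]; exact hxr

theorem mem_inducedFlag (h : IsRankFun (rk : P → ℤ) n) (e : K ≃o Set.Iic F) (hF : F ∈ Φ) (x : K) :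
    x ∈ inducedFlag h e hF ↔ (e x : P) ∈ Φ := Iff.rfl

theorem le_facet_or_top (h : IsRankFun (rk : P → ℤ) n) (hFr : rk F = n - 1) (hF : F ∈ Φ) {x : P}
    (hx : x ∈ Φ) : x ≤ F ∨ rk x = n := by
  by_cases hxn : rk x = n
  · exact Or.inr hxn
  · have := h.le_top x
    exact Or.inl (h.flag_le Φ hx hF (by omega))

namespace IsRegularPolytope

/-- A flag through `F` has only one face that is not below `F`, namely the greatest face, whose
image is forced. -/
theorem _root_.IsGradedPolytope.eq_of_eqOn_facet (h : IsGradedPolytope n P) (hFr : rk F = n - 1) (e : K ≃o Set.Iic F)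
    {g g' : P ≃o P} (hg : ∀ x : K, g (e x) = g' (e x)) : g = g' := by
  obtain ⟨Φ, hF⟩ := IsGradedPolytope.exists_flag_mem F
  refine h.eq_of_eqOn (s := Φ) fun x hx => ?_
  rcases le_facet_or_top h.isRankFun hFr hF hx with hx' | hx'
  · have := hg (e.symm ⟨x, hx'⟩)
    simpa using this
  · refine h.isRankFun.flag_inj Φ ?_ ?_ (by rw [rk_orderIso, rk_orderIso]) <;>
    exact h.isRankFun.greatest_mem_flag Φ (by rw [rk_orderIso, hx'])

/-- Flag transitivity yields `g` with the required effect on the faces of one flag below `F`; the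
rigidity of `K` extends the agreement to all of `K`. Existence holds for a face `F` of any rank,
whereas uniqueness needs a facet. -/
theorem exists_extension (h : IsRegularPolytope n P) (e : K ≃o Set.Iic F) (k : K ≃o K) :
    ∃ g : P ≃o P, ∀ x : K, g (e x) = (e (k x) : P) := by
  obtain ⟨Φ, hF⟩ := IsGradedPolytope.exists_flag_mem F
  have hR := h.isRankFun
  have hc : IsChain (· ≤ ·) {y : P | ∃ x : K, (e x : P) ∈ Φ ∧ (e (k x) : P) = y} := by
    rintro _ ⟨x, hx, rfl⟩ _ ⟨y, hy, rfl⟩ -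
    exact (Φ.le_or_le hx hy).imp (fun h => e.le_iff_le.2 (k.le_iff_le.2 (e.le_iff_le.1 h)))
      fun h => e.le_iff_le.2 (k.le_iff_le.2 (e.le_iff_le.1 h))
  obtain ⟨S, hS⟩ := hc.exists_flag
  obtain ⟨g, rfl⟩ := h.flagTransitive Φ S
  have key : ∀ x : K, (e x : P) ∈ Φ → g (e x) = (e (k x) : P) := fun x hx =>
    hR.flag_inj (Flag.map g Φ) ((Flag.apply_mem_map g Φ _).2 hx) (hS ⟨x, hx, rfl⟩) (by
      rw [rk_orderIso, rk_facetIso hR, rk_facetIso hR, rk_orderIso])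
  have hgF : g F = F := by
    have h1 := key (e.symm ⟨F, le_rfl⟩) (by simpa using hF)
    have h2 : (e (k (e.symm ⟨F, le_rfl⟩)) : P) ≤ F := (e (k (e.symm ⟨F, le_rfl⟩))).2
    rw [← h1] at h2
    simp only [OrderIso.apply_symm_apply] at h2
    exact hR.eq_of_comparable (Or.inl h2) (rk_orderIso g F)
  have hK : IsGradedPolytope (rk F) K := (h.iic F).congr e.symm
  have heq : e.trans (iicAut g hgF) = k.trans e :=
    hK.eq_of_eqOn (s := inducedFlag hR e hF) fun x hx => Subtype.ext (key x hx)
  exact ⟨g, fun x => congrArg Subtype.val (DFunLike.congr_fun heq x)⟩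

/-- Uniqueness of extensions makes the choice multiplicative. This justifies the choice made in
`facetHom`. -/
theorem existsUnique_facetHom (h : IsRegularPolytope n P) (hFr : rk F = n - 1)
    (e : K ≃o Set.Iic F) : ∃! ι, ExtendsAut e ι := by
  choose f hf using h.exists_extension e
  refine ⟨MonoidHom.mk' f fun a b => ?_, fun k x => hf k x, fun ι hι => ?_⟩
  · refine h.eq_of_eqOn_facet hFr e fun x => ?_
    rw [hf, RelIso.mul_apply, RelIso.mul_apply, hf, hf]
  · ext1 k
    refine h.eq_of_eqOn_facet hFr e fun x => ?_
    rw [hι]; exact (hf k x).symm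

theorem facetHom_spec (h : IsRegularPolytope n P) (hFr : rk F = n - 1) (e : K ≃o Set.Iic F)
    (k : K ≃o K) (x : K) : facetHom e k (e x) = (e (k x) : P) :=
  Classical.epsilon_spec (h.existsUnique_facetHom hFr e).exists k x

theorem facetHom_injective (h : IsRegularPolytope n P) (hFr : rk F = n - 1)
    (e : K ≃o Set.Iic F) : Function.Injective (facetHom e) := by
  intro a b hab
  ext x
  apply e.injective
  apply Subtype.ext
  rw [← h.facetHom_spec hFr, hab, h.facetHom_spec hFr]

theorem facetHom_apply_facet (h : IsRegularPolytope n P) (hFr : rk F = n - 1)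
    (e : K ≃o Set.Iic F) (k : K ≃o K) : facetHom e k F = F := by
  have h1 := h.facetHom_spec hFr e k (e.symm ⟨F, le_rfl⟩)
  have h2 := (e (k (e.symm ⟨F, le_rfl⟩))).2
  rw [Set.mem_Iic, ← h1] at h2
  simp only [OrderIso.apply_symm_apply] at h2
  exact h.isRankFun.eq_of_comparable (Or.inl h2) (rk_orderIso _ F)

/-- With `facetHom_apply_facet`, this identifies `Γ(K)` with the stabilizer of the facet. -/
theorem mem_range_facetHom (h : IsRegularPolytope n P) (hFr : rk F = n - 1)
    (e : K ≃o Set.Iic F) {g : P ≃o P} (hg : g F = F) : ∃ k, facetHom e k = g := by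
  refine ⟨(e.trans (iicAut g hg)).trans e.symm, h.eq_of_eqOn_facet hFr e fun x => ?_⟩
  rw [h.facetHom_spec hFr]
  simp [iicAut]

/-- The criterion refers to `K` and its induced flag, which makes it comparable between `P` and `Q`.
-/
theorem facetHom_mem_flagStab (h : IsRegularPolytope n P) (hFr : rk F = n - 1)
    (e : K ≃o Set.Iic F) (hF : F ∈ Φ) (k : K ≃o K) (J : Set ℤ) :
    facetHom e k ∈ flagStab Φ J ↔ ∀ x : K, (e x : P) ∈ Φ → rk x ∉ J → k x = x := by
  constructor
  · intro hk x hx hxJ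
    apply e.injective
    apply Subtype.ext
    rw [← h.facetHom_spec hFr]
    exact hk _ hx (by rwa [rk_facetIso h.isRankFun])
  · intro hk x hx hxJ
    rcases le_facet_or_top h.isRankFun hFr hF hx with hx' | hx'
    · obtain ⟨y, rfl⟩ : ∃ y : K, x = e y := ⟨e.symm ⟨x, hx'⟩, by simp⟩
      rw [h.facetHom_spec hFr, hk y hx]
      rwa [rk_facetIso h.isRankFun] at hxJ
    · exact h.isRankFun.flag_inj Φ
        (h.isRankFun.greatest_mem_flag Φ (by rw [rk_orderIso, hx'])) hx (rk_orderIso _ x)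

end IsRegularPolytope

end Facet

/-! ### Subgroups of amalgamated products -/

namespace PushoutWords

open Monoid PushoutI

variable {ι : Type*} {G : ι → Type*} {H : Type*} [∀ i, Group (G i)] [Group H]
  {φ : ∀ i, H →* G i}

/-- Reduced words: neighbouring letters are from distinct factors and no letter is in the
amalgamated subgroup. -/
def IsReduced (φ : ∀ i, H →* G i) (l : List (Σ i, G i)) : Prop :=
  l.IsChain (fun a b => a.1 ≠ b.1) ∧ ∀ a ∈ l, a.2 ∉ (φ a.1).range

/-- The element of the amalgamated product represented by a word. -/
def wordProd (φ : ∀ i, H →* G i) (l : List (Σ i, G i)) : PushoutI φ :=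
  (l.map fun a => of (φ := φ) a.1 a.2).prod

theorem wordProd_cons (a : Σ i, G i) (l : List (Σ i, G i)) :
    wordProd φ (a :: l) = of a.1 a.2 * wordProd φ l := by
  simp [wordProd]

theorem IsReduced.tail {a : Σ i, G i} {l : List (Σ i, G i)} (h : IsReduced φ (a :: l)) :
    IsReduced φ l :=
  ⟨h.1.tail, fun b hb => h.2 b (List.mem_cons_of_mem _ hb)⟩

theorem IsReduced.replace_head {i : ι} {a b : G i} {l : List (Σ i, G i)}
    (h : IsReduced φ (⟨i, a⟩ :: l)) (hb : b ∉ (φ i).range) : IsReduced φ (⟨i, b⟩ :: l) := by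
  refine ⟨?_, ?_⟩
  · cases l with
    | nil => exact List.isChain_singleton _
    | cons c l =>
      have := h.1
      rw [List.isChain_cons_cons] at this ⊢
      exact this
  · intro c hc
    rcases List.mem_cons.1 hc with rfl | hc
    · exact hb
    · exact h.2 c (List.mem_cons_of_mem _ hc)

/-- Passing to coset representatives alters the letters but not the sequence of factors they come
from. -/
theorem IsReduced.exists_normalWord (d : NormalWord.Transversal φ) {l : List (Σ i, G i)}
    (hl : IsReduced φ l) (h : H) : ∃ w : NormalWord d,
      w.prod = base φ h * wordProd φ l ∧ w.toList.map Sigma.fst = l.map Sigma.fst := by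
  let w₀ : CoprodI.Word G := ⟨l, fun a ha h1 => hl.2 a ha (h1 ▸ one_mem _), hl.1⟩
  obtain ⟨w, hw, hw'⟩ := Reduced.exists_normalWord_prod_eq d (w := w₀) hl.2
  refine ⟨h • w, ?_, hw'⟩
  rw [NormalWord.prod_base_smul, hw]
  congr 1
  simp only [CoprodI.Word.prod, map_list_prod, List.map_map, wordProd, w₀]
  congr 1

/-- Reduced words for the same element have the same type. -/
theorem IsReduced.map_fst_eq (hφ : ∀ i, Function.Injective (φ i)) {l m : List (Σ i, G i)}
    (hl : IsReduced φ l) (hm : IsReduced φ m) {h₁ h₂ : H}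
    (he : base φ h₁ * wordProd φ l = base φ h₂ * wordProd φ m) :
    l.map Sigma.fst = m.map Sigma.fst := by
  classical
  -- For fixed coset representatives the normal form of an element is unique.
  obtain ⟨d⟩ := NormalWord.transversal_nonempty φ hφ
  obtain ⟨w, hw, hw'⟩ := hl.exists_normalWord d h₁
  obtain ⟨w₂, hw₂, hw₂'⟩ := hm.exists_normalWord d h₂
  rw [← hw', ← hw₂', NormalWord.prod_injective (hw.trans (he.trans hw₂.symm))]

/-- Elements of the subgroup generated by compatible subgroups of the factors. -/
theorem exists_word [Nonempty ι] {S : ∀ i, Subgroup (G i)}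
    (hS : ∀ i j h, φ i h ∈ S i → φ j h ∈ S j) {g : PushoutI φ}
    (hg : g ∈ ⨆ i, (S i).map (of (φ := φ) i)) :
    ∃ (h : H) (l : List (Σ i, G i)), (∀ i, φ i h ∈ S i) ∧ IsReduced φ l ∧
      (∀ a ∈ l, a.2 ∈ S a.1) ∧ g = base φ h * wordProd φ l := by
  -- Such expressions are stable under left multiplication by `s`: together with the base part it is
  -- absorbed into the amalgamated subgroup, becomes a new first letter, or merges with the first
  -- letter.
  have key : ∀ (i : ι) (s : G i), s ∈ S i → ∀ g : PushoutI φ,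
      (∃ (h : H) (l : List (Σ i, G i)), (∀ i, φ i h ∈ S i) ∧ IsReduced φ l ∧
        (∀ a ∈ l, a.2 ∈ S a.1) ∧ g = base φ h * wordProd φ l) →
      ∃ (h : H) (l : List (Σ i, G i)), (∀ i, φ i h ∈ S i) ∧ IsReduced φ l ∧
        (∀ a ∈ l, a.2 ∈ S a.1) ∧ of i s * g = base φ h * wordProd φ l := by
    rintro i s hs _ ⟨h, l, hh, hl, hlS, rfl⟩
    have hs' : s * φ i h ∈ S i := mul_mem hs (hh i)
    rw [← mul_assoc, ← of_apply_eq_base φ i, ← map_mul]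
    generalize s * φ i h = s' at hs'
    by_cases hr : s' ∈ (φ i).range
    · obtain ⟨h', rfl⟩ := hr
      exact ⟨h', l, fun j => hS i j h' hs', hl, hlS, by rw [of_apply_eq_base]⟩
    · rcases l with _ | ⟨⟨j, b⟩, l⟩
      · refine ⟨1, [⟨i, s'⟩], fun j => by simp, ⟨List.isChain_singleton _, ?_⟩, ?_, ?_⟩
        · simpa using hr
        · simpa using hs'
        · simp [wordProd]
      · by_cases hij : i = j
        · subst hij
          have hb : b ∈ S i := hlS ⟨i, b⟩ List.mem_cons_self
          rw [wordProd_cons, ← mul_assoc, ← map_mul]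
          have hsb : s' * b ∈ S i := mul_mem hs' hb
          by_cases hr' : s' * b ∈ (φ i).range
          · obtain ⟨h', he⟩ := hr'
            refine ⟨h', l, fun j => hS i j h' (he ▸ hsb), hl.tail,
              fun a ha => hlS a (List.mem_cons_of_mem _ ha), by rw [← he, of_apply_eq_base]⟩
          · refine ⟨1, ⟨i, s' * b⟩ :: l, fun j => by simp, hl.replace_head hr', ?_, ?_⟩
            · intro a ha
              rcases List.mem_cons.1 ha with rfl | ha
              · exact hsb
              · exact hlS a (List.mem_cons_of_mem _ ha)
            · rw [wordProd_cons, map_one, one_mul]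
        · refine ⟨1, ⟨i, s'⟩ :: ⟨j, b⟩ :: l, fun j => by simp,
            ⟨List.isChain_cons_cons.2 ⟨hij, hl.1⟩, ?_⟩, ?_, ?_⟩
          · intro a ha
            rcases List.mem_cons.1 ha with rfl | ha
            · exact hr
            · exact hl.2 a ha
          · intro a ha
            rcases List.mem_cons.1 ha with rfl | ha
            · exact hs'
            · exact hlS a ha
          · rw [wordProd_cons (a := ⟨i, s'⟩), map_one, one_mul]
  rw [Subgroup.iSup_eq_closure] at hg
  induction hg using Subgroup.closure_induction_left with
  | one => exact ⟨1, [], fun i => by simp, ⟨List.isChain_nil, by simp⟩, by simp, by simp [wordProd]⟩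
  | mul_left x hx y _ ih =>
    obtain ⟨i, hx⟩ := Set.mem_iUnion.1 hx
    obtain ⟨s, hs, rfl⟩ := hx
    exact key i s hs y ih
  | inv_mul_cancel x hx y _ ih =>
    obtain ⟨i, hx⟩ := Set.mem_iUnion.1 hx
    obtain ⟨s, hs, rfl⟩ := hx
    rw [← map_inv]
    exact key i s⁻¹ (inv_mem hs) y ih

/-- Intersections of subgroups generated by subgroups of the factors. -/
theorem iSup_inf_iSup_le [Nonempty ι] (hφ : ∀ i, Function.Injective (φ i))
    {S T : ∀ i, Subgroup (G i)} (hS : ∀ i j h, φ i h ∈ S i → φ j h ∈ S j)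
    (hT : ∀ i j h, φ i h ∈ T i → φ j h ∈ T j)
    (hTS : ∀ i, ∀ t ∈ T i, ∀ s ∈ S i, ∀ h, t * s = φ i h →
      ∃ k, φ i k ∈ T i ∧ φ i (k⁻¹ * h) ∈ S i) :
    (⨆ i, (S i).map (of (φ := φ) i)) ⊓ (⨆ i, (T i).map (of (φ := φ) i)) ≤
      ⨆ i, (S i ⊓ T i).map (of (φ := φ) i) := by
  rintro g ⟨hgS, hgT⟩
  obtain ⟨h₁, l, hh₁, hl, hlS, hgl⟩ := exists_word hS hgS
  obtain ⟨h₂, m, hh₂, hm, hmT, hgm⟩ := exists_word hT hgT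
  clear hgS hgT
  induction l generalizing g h₁ h₂ m with
  | nil =>
    have hm' : m = [] := by
      have := hl.map_fst_eq hφ hm (hgl.symm.trans hgm)
      simpa using this.symm
    subst hm'
    have h12 : h₁ = h₂ := by
      apply base_injective hφ
      simpa [wordProd] using hgl.symm.trans hgm
    subst h12
    let i : ι := Classical.arbitrary ι
    refine le_iSup (fun i => (S i ⊓ T i).map (of (φ := φ) i)) i ⟨φ i h₁, ⟨hh₁ i, hh₂ i⟩, ?_⟩
    rw [of_apply_eq_base, hgl]; simp [wordProd]
  | cons a l ih =>
    obtain ⟨i, s⟩ := a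
    have hfst := hl.map_fst_eq hφ hm (hgl.symm.trans hgm)
    rcases m with _ | ⟨⟨j, t⟩, m⟩
    · simp at hfst
    obtain rfl : i = j := by simpa using (List.cons.inj hfst).1
    have hs : φ i h₁ * s ∈ S i := mul_mem (hh₁ i) (hlS ⟨i, s⟩ List.mem_cons_self)
    have ht : φ i h₂ * t ∈ T i := mul_mem (hh₂ i) (hmT ⟨i, t⟩ List.mem_cons_self)
    have hgl' : g = of i (φ i h₁ * s) * wordProd φ l := by
      rw [hgl, wordProd_cons, map_mul, of_apply_eq_base, mul_assoc]
    have hgm' : g = of i (φ i h₂ * t) * wordProd φ m := by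
      rw [hgm, wordProd_cons, map_mul, of_apply_eq_base, mul_assoc]
    -- Otherwise this quotient followed by `l` would be a reduced word for the same element as `m`,
    -- although `m` does not begin with a letter from factor `i`.
    have hrange : (φ i h₂ * t)⁻¹ * (φ i h₁ * s) ∈ (φ i).range := by
      by_contra hr
      have h3 : base φ 1 * wordProd φ (⟨i, (φ i h₂ * t)⁻¹ * (φ i h₁ * s)⟩ :: l) =
          base φ 1 * wordProd φ m := by
        rw [wordProd_cons, map_mul, map_inv, map_one, one_mul, one_mul, mul_assoc, ← hgl', hgm',
          inv_mul_cancel_left]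
      have h4 := (hl.replace_head hr).map_fst_eq hφ hm.tail h3
      rcases m with _ | ⟨c, m⟩
      · simp at h4
      · have h5 := (List.isChain_cons_cons.1 hm.1).1
        exact h5 (List.cons.inj h4).1
    obtain ⟨h, hh⟩ := hrange
    -- Splitting the quotient as `k * (k⁻¹ * h)` lets one part be moved to each side. The letter `φ
    -- i h₂ * t * φ i k` then lies in both `S i` and `T i`, and removing it from `g` leaves the
    -- shorter words `l` and `m`.
    obtain ⟨k, hkT, hkS⟩ := hTS i _ (inv_mem ht) _ hs h hh.symm
    have hc : φ i h₂ * t * φ i k = φ i h₁ * s * (φ i (k⁻¹ * h))⁻¹ := by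
      rw [map_mul, map_inv, hh]; group
    have hcT : φ i h₂ * t * φ i k ∈ T i := mul_mem ht hkT
    have hcS : φ i h₂ * t * φ i k ∈ S i := by rw [hc]; exact mul_mem hs (inv_mem hkS)
    have hcm : of i (φ i h₂ * t * φ i k) ∈ ⨆ i, (S i ⊓ T i).map (of (φ := φ) i) :=
      le_iSup (fun i => (S i ⊓ T i).map (of (φ := φ) i)) i ⟨_, ⟨hcS, hcT⟩, rfl⟩
    have hrest := ih (g := (of i (φ i h₂ * t * φ i k))⁻¹ * g) (h₁ := k⁻¹ * h)
      (fun j => hS i j _ hkS) hl.tail (fun a ha => hlS a (List.mem_cons_of_mem _ ha)) ?_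
      (h₂ := k⁻¹) (fun j => hT i j _ (by rw [map_inv]; exact inv_mem hkT)) (m := m) hm.tail
      (fun a ha => hmT a (List.mem_cons_of_mem _ ha)) ?_
    · have := mul_mem hcm hrest
      rwa [mul_inv_cancel_left] at this
    · rw [hc, hgl', ← of_apply_eq_base φ i, map_mul (of i) _ ((φ i _)⁻¹), map_inv]
      group
    · rw [hgm', ← of_apply_eq_base φ i, map_mul (of i) _ (φ i k), map_inv, map_inv]
      group

/-- The product of elements of two factors, not in the amalgamated subgroup, has infinite order. -/
theorem orderOf_of_mul_of (hφ : ∀ i, Function.Injective (φ i)) {i j : ι} (hij : i ≠ j)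
    {a : G i} {b : G j} (ha : a ∉ (φ i).range) (hb : b ∉ (φ j).range) :
    orderOf (of (φ := φ) i a * of j b) = 0 := by
  -- Each power is represented by the alternating word of length `2 * m`, which is reduced and thus
  -- not equivalent to the empty word when `m > 0`.
  have key : ∀ m : ℕ, ∃ l, IsReduced φ l ∧ l.length = 2 * m ∧ (∀ c ∈ l.head?, c.1 = i) ∧
      wordProd φ l = (of (φ := φ) i a * of j b) ^ m := by
    intro m
    induction m with
    | zero => exact ⟨[], ⟨List.isChain_nil, by simp⟩, by simp, by simp, by simp [wordProd]⟩
    | succ m ih =>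
      obtain ⟨l, hl, hlen, hhead, hprod⟩ := ih
      refine ⟨⟨i, a⟩ :: ⟨j, b⟩ :: l, ⟨?_, ?_⟩, by simp; omega, by simp, ?_⟩
      · refine List.isChain_cons_cons.2 ⟨hij, ?_⟩
        cases l with
        | nil => exact List.isChain_singleton _
        | cons c l =>
          refine List.isChain_cons_cons.2 ⟨?_, hl.1⟩
          rw [hhead c (by simp)]; exact hij.symm
      · intro c hc
        rcases List.mem_cons.1 hc with rfl | hc
        · exact ha
        rcases List.mem_cons.1 hc with rfl | hc
        · exact hb
        · exact hl.2 c hc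
      · rw [wordProd_cons, wordProd_cons, hprod, pow_succ', mul_assoc]
  -- The value `0` of `orderOf` stands for infinite order.
  rw [orderOf_eq_zero_iff']
  intro m hm he
  obtain ⟨l, hl, hlen, -, hprod⟩ := key m
  have hnil : IsReduced φ ([] : List (Σ i, G i)) := ⟨List.isChain_nil, by simp⟩
  have := hl.map_fst_eq hφ hnil (h₁ := 1) (h₂ := 1) (by rw [hprod, he]; simp [wordProd])
  have := congrArg List.length this
  simp at this
  simp [this] at hlen
  omega

end PushoutWords

/-- The product formula for automorphisms that extend automorphisms of a facet. -/
theorem IsRegularPolytope.exists_factor_facetHom {X K : Type*} [PartialOrder X] [PartialOrder K]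
    {n : ℤ} {Φ : Flag X} {F : X} (h : IsRegularPolytope n X) (hF : F ∈ Φ) (hFr : rk F = n - 1)
    (e : K ≃o Set.Iic F) {I J : Set ℤ} {s t : X ≃o X} (ht : t ∈ flagStab Φ J)
    (hs : s ∈ flagStab Φ I) {a : K ≃o K} (hts : t * s = facetHom e a) :
    ∃ k, facetHom e k ∈ flagStab Φ J ∧ facetHom e (k⁻¹ * a) ∈ flagStab Φ I := by
  obtain ⟨k, hk, hkF, hk'⟩ := h.exists_factor hF ht hs
    (by rw [hts]; exact h.facetHom_apply_facet hFr e a)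
  obtain ⟨k, rfl⟩ := h.mem_range_facetHom hFr e hkF
  exact ⟨k, hk, by rwa [hts, ← map_inv, ← map_mul] at hk'⟩

/-! ### The amalgamated product as a tail-triangle C-group -/

/-- A regular polytope whose group embeds into `Γ` such that the standard generators correspond to
the generators `gen (idx k)` of `Γ`. -/
structure IsFacetEmbedding {X : Type*} [PartialOrder X] {Γ : Type*} [Group Γ] {n : ℕ}
    (gen : Option (Fin n) → Γ) (idx : Fin n → Option (Fin n)) (Φ : Flag X)
    (ι : (X ≃o X) →* Γ) : Prop where
  regular : IsRegularPolytope n X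
  injective : Function.Injective ι
  gen_eq : ∀ k : Fin n, gen (idx k) = ι (stdGen Φ ((k : ℕ) : ℤ))

/-- The ranks of the generators with indices in `I`. -/
def rankSet {n : ℕ} (idx : Fin n → Option (Fin n)) (I : Set (Option (Fin n))) : Set ℤ :=
  {j | ∃ k : Fin n, ((k : ℕ) : ℤ) = j ∧ idx k ∈ I}

theorem rankSet_inter {n : ℕ} (idx : Fin n → Option (Fin n)) (I J : Set (Option (Fin n))) :
    rankSet idx I ∩ rankSet idx J = rankSet idx (I ∩ J) := by
  ext j
  constructor
  · rintro ⟨⟨k, rfl, hk⟩, ⟨l, hl, hl'⟩⟩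
    obtain rfl : l = k := by ext; exact_mod_cast hl
    exact ⟨l, rfl, hk, hl'⟩
  · rintro ⟨k, rfl, hk⟩
    exact ⟨⟨k, rfl, hk.1⟩, ⟨k, rfl, hk.2⟩⟩

namespace IsFacetEmbedding

variable {X : Type*} [PartialOrder X] {Γ : Type*} [Group Γ] {n : ℕ}
  {gen : Option (Fin n) → Γ} {idx : Fin n → Option (Fin n)} {Φ : Flag X} {ι : (X ≃o X) →* Γ}

theorem map_flagStab (h : IsFacetEmbedding gen idx Φ ι) (I : Set (Option (Fin n))) :
    (flagStab Φ (rankSet idx I)).map ι = Subgroup.closure (gen '' (I ∩ Set.range idx)) := by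
  rw [h.regular.flagStab_eq_closure, MonoidHom.map_closure]
  congr 1
  ext g
  constructor
  · rintro ⟨_, ⟨j, ⟨⟨k, rfl, hk⟩, -⟩, rfl⟩, rfl⟩
    exact ⟨idx k, ⟨hk, k, rfl⟩, h.gen_eq k⟩
  · rintro ⟨_, ⟨hk, k, rfl⟩, rfl⟩
    exact ⟨_, ⟨k, ⟨⟨k, rfl, hk⟩, by simp, by simp⟩, rfl⟩, (h.gen_eq k).symm⟩

theorem gen_mul_self (h : IsFacetEmbedding gen idx Φ ι) (k : Fin n) :
    gen (idx k) * gen (idx k) = 1 := by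
  rw [h.gen_eq, ← map_mul, h.regular.stdGen_mul_self Φ (by simp) (by simp), map_one]

theorem orderOf_gen (h : IsFacetEmbedding gen idx Φ ι) (k : Fin n) :
    orderOf (gen (idx k)) = 2 := by
  refine orderOf_eq_prime (by rw [pow_two, h.gen_mul_self]) fun he => ?_
  rw [h.gen_eq, ← map_one ι] at he
  exact h.regular.stdGen_ne_one Φ (by simp) (by simp) (h.injective he)

theorem commute_gen (h : IsFacetEmbedding gen idx Φ ι) {k l : Fin n} (hkl : (k : ℕ) + 1 < l) :
    Commute (gen (idx k)) (gen (idx l)) := by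
  rw [h.gen_eq, h.gen_eq]
  exact (h.regular.stdGen_commute Φ (by simp) (by simp) (by simp) (by simp)
    (by left; exact_mod_cast hkl)).map ι

end IsFacetEmbedding

/-- The indices of the generators that belong to the two kinds of facets. -/
def facetIdx {n : ℕ} (b : Bool) (k : Fin n) : Option (Fin n) :=
  if b = true ∨ (k : ℕ) + 1 < n then some k else none

theorem facetIdx_true {n : ℕ} (k : Fin n) : facetIdx true k = some k := by simp [facetIdx]

theorem facetIdx_of_lt {n : ℕ} (b : Bool) {k : Fin n} (hk : (k : ℕ) + 1 < n) :
    facetIdx b k = some k := by simp [facetIdx, hk]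

theorem facetIdx_false_last {n : ℕ} {k : Fin n} (hk : (k : ℕ) + 1 = n) :
    facetIdx false k = none := by simp [facetIdx, hk]

section Amalgam

variable {P Q : Type u} {K : Type v} [PartialOrder P] [PartialOrder Q] [PartialOrder K]
  {F : P} {G : Q} {n : ℕ} {Φ : Flag P} {Ψ : Flag Q} {eP : K ≃o Set.Iic F} {eQ : K ≃o Set.Iic G}

/-- The assumptions of the construction: two regular polytopes with isomorphic facets, and base
flags that induce the same flag of the facets. -/
structure IsFacetPair (n : ℕ) (Φ : Flag P) (Ψ : Flag Q) (eP : K ≃o Set.Iic F)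
    (eQ : K ≃o Set.Iic G) : Prop where
  pos : 1 ≤ n
  regularP : IsRegularPolytope n P
  regularQ : IsRegularPolytope n Q
  memP : F ∈ Φ
  memQ : G ∈ Ψ
  rankP : rk F = (n : ℤ) - 1
  rankQ : rk G = (n : ℤ) - 1
  flag_iff : ∀ x : K, (eP x : P) ∈ Φ ↔ (eQ x : Q) ∈ Ψ

/-- The subgroups of the two factors generated by given sets of generators. -/
def factorSub (Φ : Flag P) (Ψ : Flag Q) (I : Set (Option (Fin n))) :
    ∀ b, Subgroup (AutFamily P Q b)
  | true => flagStab Φ (rankSet (facetIdx true) I)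
  | false => flagStab Ψ (rankSet (facetIdx false) I)

/-! ### Compatibility of the two factors and the C-group property of the amalgamated product -/

namespace IsFacetPair

theorem autFamilyHom_injective (h : IsFacetPair n Φ Ψ eP eQ) (b : Bool) :
    Function.Injective (autFamilyHom eP eQ b) := by
  cases b
  · exact h.regularQ.facetHom_injective h.rankQ eQ
  · exact h.regularP.facetHom_injective h.rankP eP

theorem inP_injective (h : IsFacetPair n Φ Ψ eP eQ) : Function.Injective (Amalgam.inP eP eQ) :=
  Monoid.PushoutI.of_injective h.autFamilyHom_injective true

theorem inQ_injective (h : IsFacetPair n Φ Ψ eP eQ) : Function.Injective (Amalgam.inQ eP eQ) :=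
  Monoid.PushoutI.of_injective h.autFamilyHom_injective false

theorem inP_facetHom (eP : K ≃o Set.Iic F) (eQ : K ≃o Set.Iic G) (k : K ≃o K) :
    Amalgam.inP eP eQ (facetHom eP k) = Amalgam.inQ eP eQ (facetHom eQ k) :=
  (Monoid.PushoutI.of_apply_eq_base (autFamilyHom eP eQ) true k).trans
    (Monoid.PushoutI.of_apply_eq_base (autFamilyHom eP eQ) false k).symm

/-- The standard generators of both groups other than the last coincide. -/
theorem inP_stdGen (h : IsFacetPair n Φ Ψ eP eQ) {j : ℤ} (h0 : 0 ≤ j) (h1 : j + 1 < n) :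
    Amalgam.inP eP eQ (stdGen Φ j) = Amalgam.inQ eP eQ (stdGen Ψ j) := by
  have hm := h.regularP.stdGen_mem Φ h0 (show j < n by omega)
  -- Since `j` is not the rank of `F`, the generator fixes `F` and comes from some `k` in `Γ(K)`.
  -- The extension of `k` to `Q` is nontrivial and moves no base face of rank other than `j`.
  obtain ⟨k, hk⟩ := h.regularP.mem_range_facetHom h.rankP eP
    (hm F h.memP (by rw [h.rankP]; simp; omega))
  have hk1 : k ≠ 1 := by
    rintro rfl
    exact h.regularP.stdGen_ne_one Φ h0 (show j < n by omega) (by rw [← hk, map_one])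
  rw [← hk, h.regularP.facetHom_mem_flagStab h.rankP eP h.memP] at hm
  rw [← hk, inP_facetHom, h.regularQ.eq_stdGen (g := facetHom eQ k) (j := j)]
  · rw [h.regularQ.facetHom_mem_flagStab h.rankQ eQ h.memQ]
    exact fun x hx => hm x ((h.flag_iff x).2 hx)
  · exact fun he => hk1 (h.regularQ.facetHom_injective h.rankQ eQ (he.trans (map_one _).symm))

/-- The condition on the right does not mention `b`, so the subgroups generated by `I` in the two
factors meet `Γ(K)` in the same subgroup. The last generators play no role, because their rank is
that of the greatest face of `K`. -/
theorem mem_factorSub (h : IsFacetPair n Φ Ψ eP eQ) (I : Set (Option (Fin n))) (b : Bool)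
    (k : K ≃o K) : autFamilyHom eP eQ b k ∈ factorSub Φ Ψ I b ↔
      ∀ x : K, (eP x : P) ∈ Φ → (¬ ∃ i : Fin n, ((i : ℕ) : ℤ) = rk x ∧ (i : ℕ) + 1 < n ∧ some i ∈ I) →
        k x = x := by
  have hgen : ∀ b' : Bool, (∀ x : K, (eP x : P) ∈ Φ → rk x ∉ rankSet (facetIdx b') I → k x = x) ↔
      ∀ x : K, (eP x : P) ∈ Φ →
        (¬ ∃ i : Fin n, ((i : ℕ) : ℤ) = rk x ∧ (i : ℕ) + 1 < n ∧ some i ∈ I) → k x = x := by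
    intro b'
    have hR := h.regularP.isRankFun
    constructor
    · intro H x hx hxI
      by_cases hx' : rk x ∈ rankSet (facetIdx b') I
      · obtain ⟨i, hi, hiI⟩ := hx'
        by_cases hin : (i : ℕ) + 1 < n
        · rw [facetIdx_of_lt b' hin] at hiI
          exact absurd ⟨i, hi, hin, hiI⟩ hxI
        -- In rank `n - 1` the base face is the facet, which all of `Γ(K)` fixes.
        · have hxF : (eP x : P) = F := by
            refine hR.flag_inj Φ hx h.memP ?_
            rw [rk_facetIso hR, h.rankP]; omega
          apply eP.injective
          apply Subtype.ext
          rw [← h.regularP.facetHom_spec h.rankP eP, hxF, h.regularP.facetHom_apply_facet h.rankP]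
      · exact H x hx hx'
    · intro H x hx hxI
      refine H x hx ?_
      rintro ⟨i, hi, hin, hiI⟩
      exact hxI ⟨i, hi, by rwa [facetIdx_of_lt b' hin]⟩
  cases b
  · rw [← hgen false]
    refine (h.regularQ.facetHom_mem_flagStab h.rankQ eQ h.memQ k _).trans ?_
    exact forall_congr' fun x => imp_congr (h.flag_iff x).symm Iff.rfl
  · rw [← hgen true]
    exact h.regularP.facetHom_mem_flagStab h.rankP eP h.memP k _

theorem factorSub_compatible (h : IsFacetPair n Φ Ψ eP eQ) (I : Set (Option (Fin n))) (b c : Bool)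
    (k : K ≃o K) (hk : autFamilyHom eP eQ b k ∈ factorSub Φ Ψ I b) :
    autFamilyHom eP eQ c k ∈ factorSub Φ Ψ I c := by
  rw [h.mem_factorSub] at hk ⊢; exact hk

theorem factorSub_inf (I J : Set (Option (Fin n))) (b : Bool) :
    factorSub Φ Ψ I b ⊓ factorSub Φ Ψ J b = factorSub Φ Ψ (I ∩ J) b := by
  cases b
  · exact (flagStab_inf _ _ _).trans (by rw [rankSet_inter]; rfl)
  · exact (flagStab_inf _ _ _).trans (by rw [rankSet_inter]; rfl)

theorem factorSub_factor (h : IsFacetPair n Φ Ψ eP eQ) (I J : Set (Option (Fin n))) (b : Bool)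
    (t : AutFamily P Q b) (ht : t ∈ factorSub Φ Ψ J b) (s : AutFamily P Q b)
    (hs : s ∈ factorSub Φ Ψ I b) (a : K ≃o K) (hts : t * s = autFamilyHom eP eQ b a) :
    ∃ k, autFamilyHom eP eQ b k ∈ factorSub Φ Ψ J b ∧
      autFamilyHom eP eQ b (k⁻¹ * a) ∈ factorSub Φ Ψ I b := by
  cases b
  · exact h.regularQ.exists_factor_facetHom h.memQ h.rankQ eQ ht hs hts
  · exact h.regularP.exists_factor_facetHom h.memP h.rankP eP ht hs hts

variable {α : Fin n → Amalgam eP eQ} {β : Amalgam eP eQ}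

theorem isFacetEmbedding_inP (h : IsFacetPair n Φ Ψ eP eQ)
    (hα : ∀ j : Fin n, α j = Amalgam.inP eP eQ (stdGen Φ (j : ℕ))) :
    IsFacetEmbedding (ttGen α β) (facetIdx true) Φ (Amalgam.inP eP eQ) :=
  ⟨h.regularP, h.inP_injective, fun k => by rw [facetIdx_true]; exact hα k⟩

theorem isFacetEmbedding_inQ (h : IsFacetPair n Φ Ψ eP eQ)
    (hα : ∀ j : Fin n, α j = Amalgam.inP eP eQ (stdGen Φ (j : ℕ)))
    (hβ : β = Amalgam.inQ eP eQ (stdGen Ψ ((n : ℤ) - 1))) :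
    IsFacetEmbedding (ttGen α β) (facetIdx false) Ψ (Amalgam.inQ eP eQ) := by
  refine ⟨h.regularQ, h.inQ_injective, fun k => ?_⟩
  by_cases hk : (k : ℕ) + 1 < n
  · rw [facetIdx_of_lt _ hk]
    exact (hα k).trans (h.inP_stdGen (by simp) (by exact_mod_cast hk))
  · have hk' : (k : ℕ) + 1 = n := by omega
    rw [facetIdx_false_last hk']
    refine hβ.trans ?_
    congr 2
    omega

/-- This brings generated subgroups into the form to which the results on reduced words apply: each
generator lies in one of the two factors. -/
theorem closure_gen (h : IsFacetPair n Φ Ψ eP eQ)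
    (hα : ∀ j : Fin n, α j = Amalgam.inP eP eQ (stdGen Φ (j : ℕ)))
    (hβ : β = Amalgam.inQ eP eQ (stdGen Ψ ((n : ℤ) - 1))) (I : Set (Option (Fin n))) :
    Subgroup.closure (ttGen α β '' I) = ⨆ b, (factorSub Φ Ψ I b).map
      (Monoid.PushoutI.of (φ := autFamilyHom eP eQ) b) := by
  have hP := (h.isFacetEmbedding_inP (β := β) hα).map_flagStab I
  have hQ := (h.isFacetEmbedding_inQ hα hβ).map_flagStab I
  rw [iSup_bool_eq]
  refine Eq.trans ?_ (congrArg₂ (· ⊔ ·) hP.symm hQ.symm)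
  rw [← Subgroup.closure_union, ← Set.image_union, ← Set.inter_union_distrib_left]
  congr 2
  refine (Set.inter_eq_left.2 fun x _ => ?_).symm
  rcases x with _ | k
  · exact Or.inr ⟨⟨n - 1, by have := h.pos; omega⟩, facetIdx_false_last (by
      have := h.pos; simp; omega)⟩
  · exact Or.inl ⟨k, facetIdx_true k⟩

/-- Orders and commutation relations are inherited from the factors, as each relation involves
generators of a single factor. The intersection condition is where the amalgamated structure enters.
-/
theorem isTailTriangleCGroup (h : IsFacetPair n Φ Ψ eP eQ)
    (hα : ∀ j : Fin n, α j = Amalgam.inP eP eQ (stdGen Φ (j : ℕ)))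
    (hβ : β = Amalgam.inQ eP eQ (stdGen Ψ ((n : ℤ) - 1))) : IsTailTriangleCGroup α β where
  closure_eq_top := by
    rw [← Set.image_univ, h.closure_gen hα hβ, eq_top_iff]
    have htop : ∀ (b : Bool) (g : AutFamily P Q b), g ∈ factorSub Φ Ψ (Set.univ (α := Option (Fin n))) b := by
      have key : ∀ {X : Type u} [PartialOrder X] (hX : IsRegularPolytope n X) (Θ : Flag X) (c : Bool)
          (g : X ≃o X), g ∈ flagStab Θ (rankSet (n := n) (facetIdx c) Set.univ) := by
        intro X _ hX Θ c g
        have : flagStab Θ (rankSet (n := n) (facetIdx c) Set.univ) = flagStab Θ Set.univ := by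
          rw [hX.flagStab_eq_closure, hX.flagStab_eq_closure]
          congr 2
          ext j
          constructor
          · exact fun hj => ⟨trivial, hj.2⟩
          · rintro ⟨-, h0, h1⟩
            exact ⟨⟨⟨j.toNat, by omega⟩, by simp; omega, trivial⟩, h0, h1⟩
        rw [this]
        exact fun x _ hx => absurd trivial hx
      intro b g
      cases b
      · exact key h.regularQ Ψ false g
      · exact key h.regularP Φ true g
    intro g _
    induction g using Monoid.PushoutI.induction_on with
    | of b g =>
      exact le_iSup (fun b => (factorSub Φ Ψ Set.univ b).map
        (Monoid.PushoutI.of (φ := autFamilyHom eP eQ) b)) b ⟨g, htop b g, rfl⟩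
    | base k =>
      rw [← Monoid.PushoutI.of_apply_eq_base _ true]
      exact le_iSup (fun b => (factorSub Φ Ψ Set.univ b).map
        (Monoid.PushoutI.of (φ := autFamilyHom eP eQ) b)) true ⟨_, htop true _, rfl⟩
    | mul x y hx hy => exact mul_mem (hx trivial) (hy trivial)
  orderOf_eq_two i := by
    rcases i with _ | k
    · have hk : (⟨n - 1, by have := h.pos; omega⟩ : Fin n).val + 1 = n := by
        have := h.pos; simp; omega
      rw [← facetIdx_false_last hk]
      exact (h.isFacetEmbedding_inQ hα hβ).orderOf_gen _
    · rw [← facetIdx_true k]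
      exact (h.isFacetEmbedding_inP hα).orderOf_gen _
  commute_tail i j hij := by
    have := (h.isFacetEmbedding_inP (β := β) hα).commute_gen hij
    rwa [facetIdx_true, facetIdx_true] at this
  commute_right i hi := by
    have := (h.isFacetEmbedding_inQ hα hβ).commute_gen (k := i) (l := ⟨n - 1, by omega⟩)
      (by simp; omega)
    rwa [facetIdx_of_lt _ (by omega), facetIdx_false_last (by simp; omega)] at this
  intersection I J := by
    apply le_antisymm
    · rw [h.closure_gen hα hβ, h.closure_gen hα hβ, h.closure_gen hα hβ]
      refine (PushoutWords.iSup_inf_iSup_le h.autFamilyHom_injective (h.factorSub_compatible I)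
        (h.factorSub_compatible J) (h.factorSub_factor I J)).trans ?_
      simp_rw [factorSub_inf]
      exact le_rfl
    · exact le_inf (Subgroup.closure_mono (Set.image_mono Set.inter_subset_left))
        (Subgroup.closure_mono (Set.image_mono Set.inter_subset_right))

/-- The last generator moves the base facet, whereas `Γ(K)` fixes it. -/
theorem stdGen_last_notMem {X : Type*} [PartialOrder X] {Θ : Flag X} {E : X}
    {e : K ≃o Set.Iic E} (hn : 1 ≤ n) (hX : IsRegularPolytope n X) (hE : E ∈ Θ)
    (hr : rk E = (n : ℤ) - 1) : stdGen Θ ((n : ℤ) - 1) ∉ (facetHom e).range := by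
  rintro ⟨k, hk⟩
  have hadj := hX.stdGen_adj Θ (j := (n : ℤ) - 1) (by omega) (by omega)
  refine hadj.1 (Flag.eq_of_forall_mem fun x hx => ?_)
  by_cases hx' : rk x = (n : ℤ) - 1
  · obtain rfl := hX.isRankFun.flag_inj Θ hx hE (by omega)
    have := hX.facetHom_apply_facet hr e k
    rw [hk] at this
    rw [← this, Flag.apply_mem_map]; exact hx
  · exact (hadj.2 x hx').1 hx

theorem orderOf_last_mul (h : IsFacetPair n Φ Ψ eP eQ) {k : Fin n} (hk : (k : ℕ) + 1 = n)
    (hα : ∀ j : Fin n, α j = Amalgam.inP eP eQ (stdGen Φ (j : ℕ)))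
    (hβ : β = Amalgam.inQ eP eQ (stdGen Ψ ((n : ℤ) - 1))) : orderOf (α k * β) = 0 := by
  have hk' : ((k : ℕ) : ℤ) = (n : ℤ) - 1 := by omega
  rw [hα, hβ, hk']
  exact PushoutWords.orderOf_of_mul_of (φ := autFamilyHom eP eQ) (i := true) (j := false)
    h.autFamilyHom_injective (by simp)
    (stdGen_last_notMem h.pos h.regularP h.memP h.rankP)
    (stdGen_last_notMem h.pos h.regularQ h.memQ h.rankQ)

end IsFacetPair

end Amalgam

/-! ### The face poset of a tail-triangle C-group -/

namespace FaceKind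

variable {n : ℕ}

/-- The generators whose indices are smaller than the rank. -/
def lowGens : FaceKind n → Set (Option (Fin n))
  | bot => ∅
  | proper j => {x | ∃ i : Fin n, x = some i ∧ i < j}
  | facetP => facetP.gens
  | facetQ => facetQ.gens
  | top => Set.univ

/-- The generators in `gens` whose indices are larger than the rank. -/
def highGens (t : FaceKind n) : Set (Option (Fin n)) := t.gens \ t.lowGens

theorem lowGens_subset (t : FaceKind n) : t.lowGens ⊆ t.gens := by
  cases t with
  | bot => exact Set.empty_subset _
  | proper j =>
    rintro _ ⟨i, rfl, hi⟩
    refine ⟨fun he => ?_, fun _ => by simp⟩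
    rw [Option.some.inj he] at hi
    exact lt_irrefl _ hi
  | facetP => exact subset_rfl
  | facetQ => exact subset_rfl
  | top => exact subset_rfl

/-- Hence the upper part of a stabilizer fixes the base faces of smaller rank; by
`lowGens_subset_of_lt` the lower part fixes those of larger rank. -/
theorem highGens_subset_of_lt {t t' : FaceKind n} (h : t'.rank < t.rank) :
    t.highGens ⊆ t'.gens := by
  rintro x ⟨hx, hx'⟩
  cases t with
  | bot => cases t' <;> simp [rank] at h <;> omega
  | proper j =>
    cases t' with
    | bot => trivial
    | proper i =>
      have hij : i < j := by simpa [rank] using h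
      refine ⟨?_, fun hi => ?_⟩
      · rintro rfl
        exact hx' ⟨i, rfl, hij⟩
      · have := j.2
        have : (i : ℕ) < j := hij
        omega
    | facetP => simp [rank] at h; omega
    | facetQ => simp [rank] at h; omega
    | top => trivial
  | facetP => exact absurd hx hx'
  | facetQ => exact absurd hx hx'
  | top => exact absurd hx hx'

theorem lowGens_subset_of_lt {t t' : FaceKind n} (h : t.rank < t'.rank) :
    t.lowGens ⊆ t'.gens := by
  intro x hx
  cases t with
  | bot => exact absurd hx (Set.notMem_empty x)
  | proper j =>
    obtain ⟨i, rfl, hij⟩ := hx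
    cases t' with
    | bot => trivial
    | proper k =>
      have hjk : j < k := by simpa [rank] using h
      exact ⟨fun he => absurd (Option.some.inj he) (hij.trans hjk).ne, fun _ => by simp⟩
    | facetP => simp [gens]
    | facetQ =>
      intro l hl
      obtain rfl := Option.some.inj hl
      have := j.2
      have : (i : ℕ) < j := hij
      omega
    | top => trivial
  | facetP => cases t' with
    | top => trivial
    | _ => simp [rank] at h <;> omega
  | facetQ => cases t' with
    | top => trivial
    | _ => simp [rank] at h <;> omega
  | top => cases t' <;> simp [rank] at h <;> omega

theorem exists_rank_eq {j : ℤ} (h0 : -1 ≤ j) (h1 : j ≤ n + 1) : ∃ t : FaceKind n, t.rank = j := by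
  by_cases h : j = -1
  · exact ⟨bot, h.symm⟩
  by_cases h' : j = n + 1
  · exact ⟨top, h'.symm⟩
  by_cases h'' : j = n
  · exact ⟨facetP, h''.symm⟩
  · exact ⟨proper ⟨j.toNat, by omega⟩, by simp [rank]; omega⟩

theorem neg_one_le_rank (t : FaceKind n) : -1 ≤ t.rank := by
  cases t <;> simp [rank]
  omega

theorem rank_le (t : FaceKind n) : t.rank ≤ n + 1 := by
  cases t <;> simp [rank] <;> omega

/-- The two kinds of facets. -/
def facet (b : Bool) : FaceKind n := if b then facetP else facetQ

theorem rank_facet (b : Bool) : (facet b : FaceKind n).rank = n := by cases b <;> rfl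

theorem eq_bot_of_rank {t : FaceKind n} (h : t.rank = -1) : t = bot := by
  cases t <;> simp [rank] at h ⊢
  omega

theorem eq_top_of_rank {t : FaceKind n} (h : t.rank = n + 1) : t = top := by
  cases t <;> simp [rank] at h ⊢ <;> omega

theorem eq_facet_of_rank {t : FaceKind n} (h : t.rank = n) : ∃ b, t = facet b := by
  cases t with
  | bot => simp [rank] at h
  | proper j => simp [rank] at h; omega
  | facetP => exact ⟨true, rfl⟩
  | facetQ => exact ⟨false, rfl⟩
  | top => simp [rank] at h

theorem eq_proper_of_rank {t : FaceKind n} {j : Fin n} (h : t.rank = (j : ℕ)) : t = proper j := by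
  cases t with
  | bot => simp [rank] at h
  | proper i => simp [rank] at h; simp; ext; exact h
  | facetP => simp [rank] at h; omega
  | facetQ => simp [rank] at h; omega
  | top => simp [rank] at h; omega

theorem range_facetIdx (hn : 1 ≤ n) (b : Bool) :
    Set.range (facetIdx (n := n) b) = (facet b : FaceKind n).gens := by
  ext x
  constructor
  · rintro ⟨k, rfl⟩
    cases b
    · intro i hi
      by_cases hk : (k : ℕ) + 1 < n
      · rw [facetIdx_of_lt _ hk] at hi
        rwa [← Option.some.inj hi]
      · rw [facetIdx_false_last (by omega)] at hi
        simp at hi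
    · rw [facetIdx_true]; simp [facet, gens]
  · intro hx
    cases b
    · rcases x with _ | i
      · exact ⟨⟨n - 1, by omega⟩, facetIdx_false_last (by simp; omega)⟩
      · exact ⟨i, facetIdx_of_lt _ (hx i rfl)⟩
    · rcases x with _ | i
      · exact absurd rfl hx
      · exact ⟨i, facetIdx_true i⟩

end FaceKind

section Wythoff

variable {Γ : Type w} [Group Γ] {n : ℕ} {α : Fin n → Γ} {β : Γ}

/-- The face of a given kind that contains the element `g` of the group. -/
def wface (α : Fin n → Γ) (β : Γ) (t : FaceKind n) (g : Γ) : WythoffFace α β :=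
  ⟨t, (QuotientGroup.mk g : Γ ⧸ stabSubgroup α β t)⟩

theorem kind_wface (t : FaceKind n) (g : Γ) : (wface α β t g).kind = t := rfl

theorem wface_eq_iff {t : FaceKind n} {g g' : Γ} :
    wface α β t g = wface α β t g' ↔ g⁻¹ * g' ∈ stabSubgroup α β t := by
  rw [← QuotientGroup.eq]
  constructor
  · intro h
    exact eq_of_heq (Sigma.mk.inj h).2
  · intro h
    rw [wface, h, wface]

theorem exists_eq_wface (x : WythoffFace α β) : ∃ g, x = wface α β x.kind g := by
  obtain ⟨t, q⟩ := x
  obtain ⟨g, rfl⟩ := QuotientGroup.mk_surjective q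
  exact ⟨g, rfl⟩

theorem below_iff {x y : WythoffFace α β} : x.Below y ↔ x.kind.rank < y.kind.rank ∧
    ∃ g, x = wface α β x.kind g ∧ y = wface α β y.kind g := by
  obtain ⟨t, q⟩ := x
  obtain ⟨t', q'⟩ := y
  refine and_congr Iff.rfl (exists_congr fun g => ?_)
  constructor
  · rintro ⟨h1, h2⟩
    exact ⟨Sigma.ext rfl (heq_of_eq h1.symm), Sigma.ext rfl (heq_of_eq h2.symm)⟩
  · rintro ⟨h1, h2⟩
    exact ⟨(eq_of_heq (Sigma.mk.inj h1).2).symm, (eq_of_heq (Sigma.mk.inj h2).2).symm⟩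

theorem translate_wface (t : FaceKind n) (g g' : Γ) :
    (wface α β t g').translate g = wface α β t (g * g') := rfl

theorem stabSubgroup_mono {t : FaceKind n} {I : Set (Option (Fin n))} (h : I ⊆ t.gens) :
    Subgroup.closure (ttGen α β '' I) ≤ stabSubgroup α β t :=
  Subgroup.closure_mono (Set.image_mono h)

/-! ### Factorization of face stabilizers and transitivity of incidence -/

namespace IsTailTriangleCGroup

theorem gen_mul_self (hC : IsTailTriangleCGroup α β) (i : Option (Fin n)) :
    ttGen α β i * ttGen α β i = 1 := by
  have := pow_orderOf_eq_one (ttGen α β i)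
  rwa [hC.orderOf_eq_two, pow_two] at this

theorem stabSubgroup_inf (hC : IsTailTriangleCGroup α β) (t t' : FaceKind n) :
    stabSubgroup α β t ⊓ stabSubgroup α β t' =
      Subgroup.closure (ttGen α β '' (t.gens ∩ t'.gens)) :=
  hC.intersection _ _

theorem stabSubgroup_eq_top (hC : IsTailTriangleCGroup α β) {t : FaceKind n}
    (ht : t.gens = Set.univ) : stabSubgroup α β t = ⊤ := by
  rw [stabSubgroup, ht, Set.image_univ, hC.closure_eq_top]

/-- Indices on opposite sides of `j` differ by at least two, where `β` counts as having index `n -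
1`. For `j = n - 1` and for facets there are no generators above. -/
theorem commute_low_high (hC : IsTailTriangleCGroup α β) (t : FaceKind n) :
    ∀ x ∈ t.lowGens, ∀ y ∈ t.highGens, Commute (ttGen α β x) (ttGen α β y) := by
  rintro x hx y ⟨hy, hy'⟩
  cases t with
  | bot => exact absurd hx (Set.notMem_empty x)
  | proper j =>
    obtain ⟨i, rfl, hij⟩ := hx
    have hij' : (i : ℕ) < j := hij
    have := j.2
    rcases y with _ | k
    · have : ¬ (j : ℕ) + 1 = n := fun h => hy.2 h rfl
      exact hC.commute_right i (by omega)
    · have hjk : j < k := by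
        refine lt_of_le_of_ne (not_lt.1 fun h => hy' ⟨k, rfl, h⟩) ?_
        rintro rfl
        exact hy.1 rfl
      have hjk' : (j : ℕ) < k := hjk
      exact hC.commute_tail i k (by omega)
  | facetP => exact absurd hy hy'
  | facetQ => exact absurd hy hy'
  | top => exact absurd hy hy'

/-- The stabilizer of a face is the product of the parts below and above its rank. -/
theorem exists_factor (hC : IsTailTriangleCGroup α β) {t : FaceKind n} {g : Γ}
    (hg : g ∈ stabSubgroup α β t) : ∃ a ∈ Subgroup.closure (ttGen α β '' t.highGens),
      ∃ b ∈ Subgroup.closure (ttGen α β '' t.lowGens), g = a * b := by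
  have hcomm : ∀ a ∈ Subgroup.closure (ttGen α β '' t.highGens),
      ∀ b ∈ Subgroup.closure (ttGen α β '' t.lowGens), b * a = a * b := by
    have h1 : Subgroup.closure (ttGen α β '' t.lowGens) ≤
        Subgroup.centralizer (ttGen α β '' t.highGens) := by
      rw [Subgroup.closure_le]
      rintro _ ⟨x, hx, rfl⟩ _ ⟨y, hy, rfl⟩
      exact (hC.commute_low_high t x hx y hy).eq.symm
    have h2 : Subgroup.closure (ttGen α β '' t.highGens) ≤ Subgroup.centralizer
        (Subgroup.closure (ttGen α β '' t.lowGens) : Set Γ) := by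
      rw [Subgroup.closure_le]
      intro y hy b hb
      exact (h1 hb y hy).symm
    exact fun a ha b hb => h2 ha b hb
  have hun : t.gens = t.highGens ∪ t.lowGens := (Set.sdiff_union_of_subset t.lowGens_subset).symm
  rw [stabSubgroup, hun] at hg
  induction hg using Subgroup.closure_induction with
  | mem x hx =>
    obtain ⟨i, hi | hi, rfl⟩ := hx
    · exact ⟨_, Subgroup.subset_closure ⟨i, hi, rfl⟩, 1, one_mem _, (mul_one _).symm⟩
    · exact ⟨1, one_mem _, _, Subgroup.subset_closure ⟨i, hi, rfl⟩, (one_mul _).symm⟩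
  | one => exact ⟨1, one_mem _, 1, one_mem _, (mul_one _).symm⟩
  | mul x y _ _ hx hy =>
    obtain ⟨a, ha, b, hb, rfl⟩ := hx
    obtain ⟨c, hc, d, hd, rfl⟩ := hy
    refine ⟨a * c, mul_mem ha hc, b * d, mul_mem hb hd, ?_⟩
    rw [mul_assoc, ← mul_assoc b, hcomm c hc b hb]
    group
  | inv x _ hx =>
    obtain ⟨a, ha, b, hb, rfl⟩ := hx
    exact ⟨a⁻¹, inv_mem ha, b⁻¹, inv_mem hb, by
      rw [mul_inv_rev, hcomm _ (inv_mem ha) _ (inv_mem hb)]⟩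

/-- Two elements of a face can be joined by steps below and above the rank of the face. -/
theorem exists_common (hC : IsTailTriangleCGroup α β) {t : FaceKind n} {a b : Γ}
    (h : wface α β t a = wface α β t b) : ∃ c, wface α β t c = wface α β t a ∧
      (∀ t' : FaceKind n, t'.rank < t.rank → wface α β t' c = wface α β t' a) ∧
      ∀ t' : FaceKind n, t.rank < t'.rank → wface α β t' c = wface α β t' b := by
  obtain ⟨x, hx, y, hy, hxy⟩ := hC.exists_factor (wface_eq_iff.1 h)
  -- With `a⁻¹ * b = x * y`, passing from `a` to `a * x` keeps the cosets of smaller rank, and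
  -- passing on to `b = a * x * y` keeps those of larger rank.
  refine ⟨a * x, (wface_eq_iff.2 ?_).symm, fun t' ht' => (wface_eq_iff.2 ?_).symm,
    fun t' ht' => wface_eq_iff.2 ?_⟩
  · rw [inv_mul_cancel_left]
    exact stabSubgroup_mono Set.sdiff_subset hx
  · rw [inv_mul_cancel_left]
    exact stabSubgroup_mono (FaceKind.highGens_subset_of_lt ht') hx
  · rw [mul_inv_rev, mul_assoc, hxy, inv_mul_cancel_left]
    exact stabSubgroup_mono (FaceKind.lowGens_subset_of_lt ht') hy

/-- The partial order on the faces. -/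
@[reducible]
def partialOrder (hC : IsTailTriangleCGroup α β) : PartialOrder (WythoffFace α β) where
  le x y := x = y ∨ x.Below y
  le_refl x := Or.inl rfl
  le_trans x y z := by
    rintro (rfl | hxy) (rfl | hyz)
    · exact Or.inl rfl
    · exact Or.inr hyz
    · exact Or.inr hxy
    · right
      rw [below_iff] at hxy hyz ⊢
      obtain ⟨h1, a, hx, hy⟩ := hxy
      obtain ⟨h2, b, hy', hz⟩ := hyz
      -- The two incidences meet `y` in possibly different elements `a` and `b`; `c` has the coset
      -- of `a` below `y` and that of `b` above.
      obtain ⟨c, -, hc1, hc2⟩ := hC.exists_common (hy.symm.trans hy')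
      exact ⟨h1.trans h2, c, hx.trans (hc1 _ h1).symm, hz.trans (hc2 _ h2).symm⟩
  le_antisymm x y := by
    rintro (rfl | hxy) (h | hyx)
    · rfl
    · rfl
    · exact h.symm
    · exact absurd (hxy.1.trans hyx.1) (lt_irrefl _)

end IsTailTriangleCGroup

/-- The partial order on the faces of a tail-triangle C-group is given by incidence. -/
structure IsWythoffOrder (α : Fin n → Γ) (β : Γ) [PartialOrder (WythoffFace α β)] : Prop where
  pos : 1 ≤ n
  cgroup : IsTailTriangleCGroup α β
  le_iff : ∀ x y : WythoffFace α β, x ≤ y ↔ x = y ∨ x.Below y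

namespace IsWythoffOrder

theorem translate_translate (g g' : Γ) (x : WythoffFace α β) :
    (x.translate g').translate g = x.translate (g * g') := by
  obtain ⟨a, hx⟩ := exists_eq_wface x
  rw [hx, translate_wface, translate_wface, translate_wface, mul_assoc]

theorem translate_one (x : WythoffFace α β) : x.translate 1 = x := by
  obtain ⟨a, hx⟩ := exists_eq_wface x
  rw [hx, translate_wface, one_mul]

variable [PartialOrder (WythoffFace α β)]

theorem lt_iff (h : IsWythoffOrder α β) {x y : WythoffFace α β} : x < y ↔
    x.kind.rank < y.kind.rank ∧ ∃ g, x = wface α β x.kind g ∧ y = wface α β y.kind g := by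
  rw [← below_iff]
  constructor
  · intro hxy
    exact ((h.le_iff x y).1 hxy.le).resolve_left hxy.ne
  · intro hxy
    refine lt_of_le_of_ne ((h.le_iff x y).2 (Or.inr hxy)) ?_
    rintro rfl
    exact lt_irrefl _ hxy.1

theorem wface_lt (h : IsWythoffOrder α β) {t t' : FaceKind n} (ht : t.rank < t'.rank) (g : Γ) :
    wface α β t g < wface α β t' g :=
  h.lt_iff.2 ⟨ht, g, rfl, rfl⟩

theorem wface_bot (h : IsWythoffOrder α β) (g g' : Γ) :
    wface α β .bot g = wface α β .bot g' :=
  wface_eq_iff.2 (by rw [h.cgroup.stabSubgroup_eq_top rfl]; trivial)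

theorem wface_top (h : IsWythoffOrder α β) (g g' : Γ) :
    wface α β .top g = wface α β .top g' :=
  wface_eq_iff.2 (by rw [h.cgroup.stabSubgroup_eq_top rfl]; trivial)

theorem isRankFun_kind (h : IsWythoffOrder α β) :
    IsRankFun (fun x : WythoffFace α β => x.kind.rank) ((n + 1 : ℕ) : ℤ) where
  strictMono x y hxy := (h.lt_iff.1 hxy).1
  exists_least := by
    refine ⟨wface α β .bot 1, fun x => ?_, rfl⟩
    obtain ⟨g, hg⟩ := exists_eq_wface x
    rw [h.wface_bot 1 g]
    by_cases hx : x.kind.rank = -1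
    · rw [hg, FaceKind.eq_bot_of_rank hx]
    · rw [hg]
      exact (h.wface_lt (t := .bot) (lt_of_le_of_ne x.kind.neg_one_le_rank (Ne.symm hx)) g).le
  exists_greatest := by
    refine ⟨wface α β .top 1, fun x => ?_, by simp [WythoffFace.kind, wface, FaceKind.rank]⟩
    obtain ⟨g, hg⟩ := exists_eq_wface x
    rw [h.wface_top 1 g]
    by_cases hx : x.kind.rank = n + 1
    · rw [hg, FaceKind.eq_top_of_rank hx]
    · rw [hg]
      exact (h.wface_lt (t' := .top) (lt_of_le_of_ne x.kind.rank_le hx) g).le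
  exists_succ x y hxy := by
    obtain ⟨hr, g, hx, hy⟩ := h.lt_iff.1 hxy
    by_cases hr' : y.kind.rank = x.kind.rank + 1
    · exact ⟨y, hxy, le_rfl, hr'⟩
    · have h1 := x.kind.neg_one_le_rank
      have h2 := y.kind.rank_le
      -- The common element `g` of `x` and `y` has a coset of every kind in between.
      obtain ⟨t, ht⟩ := FaceKind.exists_rank_eq (n := n) (j := x.kind.rank + 1) (by omega)
        (by omega)
      refine ⟨wface α β t g, ?_, ?_, ht⟩
      · conv_lhs => rw [hx]
        exact h.wface_lt (by omega) g
      · conv_rhs => rw [hy]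
        exact (h.wface_lt (by omega) g).le

theorem rk_eq (h : IsWythoffOrder α β) (x : WythoffFace α β) : rk x = x.kind.rank :=
  h.isRankFun_kind.rk_eq x

theorem isRankFun (h : IsWythoffOrder α β) :
    IsRankFun (rk : WythoffFace α β → ℤ) ((n + 1 : ℕ) : ℤ) := h.isRankFun_kind.to_rk

theorem translate_le (h : IsWythoffOrder α β) (g : Γ) {x y : WythoffFace α β} (hxy : x ≤ y) :
    x.translate g ≤ y.translate g := by
  rcases hxy.eq_or_lt with rfl | hxy
  · exact le_rfl
  · obtain ⟨hr, a, hx, hy⟩ := h.lt_iff.1 hxy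
    rw [hx, hy, translate_wface, translate_wface]
    exact (h.wface_lt hr _).le

/-- The action of the group by translation of cosets. -/
def act (h : IsWythoffOrder α β) : Γ →* (WythoffFace α β ≃o WythoffFace α β) :=
  MonoidHom.mk' (fun g =>
    { toFun := fun x => x.translate g
      invFun := fun x => x.translate g⁻¹
      left_inv := fun x => by
        simp only [translate_translate, inv_mul_cancel, translate_one]
      right_inv := fun x => by
        simp only [translate_translate, mul_inv_cancel, translate_one]
      map_rel_iff' := fun {x y} => by
        refine ⟨fun hxy => ?_, h.translate_le g⟩
        have := h.translate_le g⁻¹ hxy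
        simpa only [Equiv.coe_fn_mk, translate_translate, inv_mul_cancel, translate_one] using this })
    fun g g' => by
      ext x
      exact (translate_translate g g' x).symm

theorem act_apply (h : IsWythoffOrder α β) (g : Γ) (x : WythoffFace α β) :
    h.act g x = x.translate g := rfl

theorem act_wface (h : IsWythoffOrder α β) (g g' : Γ) (t : FaceKind n) :
    h.act g (wface α β t g') = wface α β t (g * g') := rfl

end IsWythoffOrder

end Wythoff

/-! ### The facets of the face poset -/

namespace FaceKind

variable {n : ℕ}

/-- The kind of the faces of rank `j` of the facets of a given kind. -/
def ofRank (b : Bool) (j : ℤ) : FaceKind n :=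
  if h : 0 ≤ j ∧ j < n then proper ⟨j.toNat, by omega⟩ else if j < 0 then bot else facet b

theorem ofRank_natCast (b : Bool) (j : Fin n) : ofRank b ((j : ℕ) : ℤ) = proper j := by
  simp [ofRank]

theorem ofRank_self (b : Bool) : (ofRank b (n : ℤ) : FaceKind n) = facet b := by
  simp [ofRank]

theorem ofRank_neg_one (b : Bool) : (ofRank b (-1) : FaceKind n) = bot := by
  simp [ofRank]

theorem rank_ofRank (b : Bool) {j : ℤ} (h0 : -1 ≤ j) (h1 : j ≤ n) :
    (ofRank b j : FaceKind n).rank = j := by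
  unfold ofRank
  split_ifs with h h'
  · simp [rank]; omega
  · simp [rank]; omega
  · rw [rank_facet]; omega

theorem ofRank_rank (b : Bool) {t : FaceKind n} (ht : t.rank < n ∨ t = facet b) :
    ofRank b t.rank = t := by
  rcases ht with ht | rfl
  · cases t with
    | bot => exact ofRank_neg_one b
    | proper j => exact ofRank_natCast b j
    | facetP => simp [rank] at ht
    | facetQ => simp [rank] at ht
    | top => simp [rank] at ht
  · rw [rank_facet, ofRank_self]

/-- Inside a facet, generator `k` fixes all base faces except the one of rank `k`, just as in the
polytope itself; the improper ranks `-1` and `n` are included. -/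
theorem facetIdx_mem_gens (hn : 1 ≤ n) (b : Bool) (k : Fin n) {j : ℤ} (h0 : -1 ≤ j) (h1 : j ≤ n) :
    facetIdx b k ∈ (ofRank b j : FaceKind n).gens ↔ ((k : ℕ) : ℤ) ≠ j := by
  have := k.2
  by_cases hb : j = -1
  · subst hb
    rw [ofRank_neg_one]
    exact iff_of_true trivial (by omega)
  by_cases ht : j = n
  · subst ht
    rw [ofRank_self, ← range_facetIdx hn]
    exact iff_of_true ⟨k, rfl⟩ (by omega)
  obtain ⟨i, rfl⟩ : ∃ i : Fin n, j = (i : ℕ) := ⟨⟨j.toNat, by omega⟩, by simp; omega⟩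
  rw [ofRank_natCast]
  by_cases hk : b = true ∨ (k : ℕ) + 1 < n
  · simp [facetIdx, hk, gens, Fin.ext_iff]
  · have hi := i.2
    simp only [facetIdx, hk, gens]
    simp
    omega

end FaceKind

section Wythoff

variable {Γ : Type w} [Group Γ] {n : ℕ} {α : Fin n → Γ} {β : Γ}
  {X : Type*} [PartialOrder X] {Φ : Flag X} {b : Bool} {ι : (X ≃o X) →* Γ}

/-- Every face of a regular polytope is the image of a face of the base flag. -/
theorem IsRegularPolytope.exists_aut_mem {m : ℤ} (h : IsRegularPolytope m X) (Φ : Flag X) (x : X) :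
    ∃ (a : X ≃o X) (y : X), y ∈ Φ ∧ a y = x := by
  obtain ⟨s, hs⟩ := IsGradedPolytope.exists_flag_mem x
  obtain ⟨a, rfl⟩ := h.flagTransitive Φ s
  rw [Flag.mem_map] at hs
  exact ⟨a, _, hs, by simp⟩

namespace IsFacetEmbedding

theorem range_eq (h : IsFacetEmbedding (ttGen α β) (facetIdx b) Φ ι) (hn : 1 ≤ n) :
    ι.range = stabSubgroup α β (.facet b) := by
  have h1 := h.map_flagStab Set.univ
  rw [Set.univ_inter, FaceKind.range_facetIdx hn] at h1
  rw [stabSubgroup, ← h1, MonoidHom.range_eq_map]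
  congr 1
  rw [h.regular.flagStab_eq_closure, eq_comm]
  have : (⊤ : Subgroup (X ≃o X)) = flagStab Φ Set.univ := by
    ext g; exact iff_of_true trivial fun x _ hx => absurd trivial hx
  rw [this, h.regular.flagStab_eq_closure]
  congr 2
  ext j
  constructor
  · exact fun hj => ⟨trivial, hj.2⟩
  · rintro ⟨-, h0, h1⟩
    exact ⟨⟨⟨j.toNat, by omega⟩, by simp; omega, trivial⟩, h0, h1⟩

/-- The stabilizers of the faces of the base flag correspond to the distinguished subgroups. -/
theorem mem_stab_iff (h : IsFacetEmbedding (ttGen α β) (facetIdx b) Φ ι) (hn : 1 ≤ n)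
    (hC : IsTailTriangleCGroup α β) {y : X} (hy : y ∈ Φ) (a : X ≃o X) :
    ι a ∈ stabSubgroup α β (.ofRank b (rk y)) ↔ a y = y := by
  have hR := h.regular.isRankFun
  have h0 := hR.neg_one_le y
  have h1 := hR.le_top y
  -- By the intersection condition, the part of the face stabilizer in the facet group is generated
  -- by the generators common to both, so it is the image of a flag stabilizer of `X`.
  have hset := hC.stabSubgroup_inf (.ofRank b (rk y)) (.facet b)
  rw [← FaceKind.range_facetIdx hn, ← h.map_flagStab, ← h.range_eq hn] at hset
  have hmem : ι a ∈ stabSubgroup α β (.ofRank b (rk y)) ↔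
      a ∈ flagStab Φ (rankSet (n := n) (facetIdx b) (FaceKind.gens (.ofRank b (rk y)))) := by
    constructor
    · intro ha
      have : ι a ∈ stabSubgroup α β (.ofRank b (rk y)) ⊓ ι.range := ⟨ha, a, rfl⟩
      rw [hset] at this
      obtain ⟨a', ha', he⟩ := this
      rwa [← h.injective he]
    · intro ha
      have : ι a ∈ stabSubgroup α β (.ofRank b (rk y)) ⊓ ι.range := by
        rw [hset]; exact ⟨a, ha, rfl⟩
      exact this.1
  rw [hmem]
  constructor
  · intro ha
    refine ha y hy ?_
    rintro ⟨k, hk, hk'⟩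
    exact (FaceKind.facetIdx_mem_gens hn b k h0 h1).1 hk' hk
  -- A rank outside the set is `rk y`, `-1` or `n`, and improper faces are fixed by every
  -- automorphism.
  · intro ha x hx hxr
    by_cases hxy : rk x = rk y
    · rw [hR.flag_inj Φ hx hy hxy, ha]
    · have hx0 := hR.neg_one_le x
      have hx1 := hR.le_top x
      by_cases hxn : rk x = -1
      · exact hR.flag_inj Φ (hR.least_mem_flag Φ (by rw [rk_orderIso, hxn])) hx (rk_orderIso a x)
      · by_cases hxn' : rk x = n
        · exact hR.flag_inj Φ (hR.greatest_mem_flag Φ (by rw [rk_orderIso, hxn'])) hx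
            (rk_orderIso a x)
        · refine absurd ⟨⟨(rk x).toNat, by omega⟩, by simp; omega, ?_⟩ hxr
          rw [FaceKind.facetIdx_mem_gens hn b _ h0 h1]
          simp; omega

/-- The face of the face poset that corresponds to a face of the polytope. -/
noncomputable def faceMap (h : IsFacetEmbedding (ttGen α β) (facetIdx b) Φ ι) (x : X) :
    WythoffFace α β :=
  wface α β (.ofRank b (rk x)) (ι (h.regular.exists_aut_mem Φ x).choose)

/-- The choice in `faceMap` is immaterial: automorphisms with the same value at `y` differ by its
stabilizer, which `mem_stab_iff` matches with the distinguished subgroup. -/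
theorem faceMap_apply (h : IsFacetEmbedding (ttGen α β) (facetIdx b) Φ ι) (hn : 1 ≤ n)
    (hC : IsTailTriangleCGroup α β) {y : X} (hy : y ∈ Φ) (a : X ≃o X) :
    h.faceMap (a y) = wface α β (.ofRank b (rk y)) (ι a) := by
  obtain ⟨y', hy', he⟩ := (h.regular.exists_aut_mem Φ (a y)).choose_spec
  unfold faceMap
  set a' := (h.regular.exists_aut_mem Φ (a y)).choose
  have hyy : y' = y := h.regular.isRankFun.flag_inj Φ hy' hy (by
    rw [← rk_orderIso a' y', he, rk_orderIso])
  subst hyy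
  rw [rk_orderIso, wface_eq_iff, ← map_inv, ← map_mul, h.mem_stab_iff hn hC hy, RelIso.mul_apply,
    ← he]
  exact RelIso.inv_apply_self a' y'

variable [PartialOrder (WythoffFace α β)]

theorem faceMap_mono (h : IsFacetEmbedding (ttGen α β) (facetIdx b) Φ ι)
    (hW : IsWythoffOrder α β) {x x' : X} (hx : x ≤ x') : h.faceMap x ≤ h.faceMap x' := by
  have hR := h.regular.isRankFun
  rcases hx.eq_or_lt with rfl | hlt
  · exact le_rfl
  obtain ⟨s, hs, hs'⟩ := exists_flag_pair hx
  obtain ⟨a, rfl⟩ := h.regular.flagTransitive Φ s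
  rw [Flag.mem_map] at hs hs'
  obtain ⟨y, rfl⟩ := a.surjective x
  obtain ⟨y', rfl⟩ := a.surjective x'
  rw [OrderIso.symm_apply_apply] at hs hs'
  rw [h.faceMap_apply hW.pos hW.cgroup hs, h.faceMap_apply hW.pos hW.cgroup hs']
  refine (hW.wface_lt ?_ _).le
  rw [FaceKind.rank_ofRank b (hR.neg_one_le y) (hR.le_top y),
    FaceKind.rank_ofRank b (hR.neg_one_le y') (hR.le_top y')]
  exact hR.strictMono (a.lt_iff_lt.1 hlt)

theorem le_of_faceMap_le (h : IsFacetEmbedding (ttGen α β) (facetIdx b) Φ ι)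
    (hW : IsWythoffOrder α β) {x x' : X} (hx : h.faceMap x ≤ h.faceMap x') : x ≤ x' := by
  have hR := h.regular.isRankFun
  obtain ⟨a, y, hy, rfl⟩ := h.regular.exists_aut_mem Φ x
  obtain ⟨a', y', hy', rfl⟩ := h.regular.exists_aut_mem Φ x'
  rw [h.faceMap_apply hW.pos hW.cgroup hy, h.faceMap_apply hW.pos hW.cgroup hy'] at hx
  have hr : ∀ z : X, (FaceKind.ofRank b (rk z) : FaceKind n).rank = rk z := fun z =>
    FaceKind.rank_ofRank b (hR.neg_one_le z) (hR.le_top z)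
  have hstab : ∀ (c d : X ≃o X) (z : X), z ∈ Φ → wface α β (.ofRank b (rk z)) (ι c) =
      wface α β (.ofRank b (rk z)) (ι d) → c z = d z := by
    intro c d z hz hcd
    rw [wface_eq_iff, ← map_inv, ← map_mul, h.mem_stab_iff hW.pos hW.cgroup hz, RelIso.mul_apply]
      at hcd
    have := congrArg c hcd
    rw [RelIso.apply_inv_self] at this
    exact this.symm
  rcases hx.eq_or_lt with he | hlt
  · have hk : (FaceKind.ofRank b (rk y) : FaceKind n) = .ofRank b (rk y') := congrArg Sigma.fst he
    have hyy : y = y' := hR.flag_inj Φ hy hy' (by rw [← hr y, hk, hr])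
    subst hyy
    exact (hstab a a' y hy he).le
  · obtain ⟨hlt, c, hc, hc'⟩ := hW.lt_iff.1 hlt
    simp only [kind_wface] at hlt hc hc'
    rw [hr, hr] at hlt
    by_cases htop : rk y' = n
    · exact hR.le_of_rank_eq_top (by rw [rk_orderIso, htop]) _
    -- The common element `c` need not belong to the facet group. The element `d` agrees with `c`
    -- below the second face and with `ι a'` above it, in particular in the facet, so `d` comes from
    -- `X`.
    · obtain ⟨d, hd, hd1, hd2⟩ := hW.cgroup.exists_common hc'.symm
      have hdr : d ∈ ι.range := by
        rw [h.range_eq hW.pos]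
        have h1 := hd2 (.facet b) (by
          rw [hr, FaceKind.rank_facet]
          exact lt_of_le_of_ne (hR.le_top y') htop)
        rw [eq_comm, wface_eq_iff] at h1
        have h2 : ι a' ∈ stabSubgroup α β (.facet b) := by
          rw [← h.range_eq hW.pos]; exact ⟨a', rfl⟩
        have := mul_mem h2 h1
        rwa [mul_inv_cancel_left] at this
      obtain ⟨d, rfl⟩ := hdr
      have e1 : a y = d y := hstab a d y hy (hc.trans (hd1 _ (by rw [hr, hr]; exact hlt)).symm)
      have e2 : a' y' = d y' := hstab a' d y' hy' (hc'.trans hd.symm)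
      rw [e1, e2, d.le_iff_le]
      exact hR.flag_le Φ hy hy' hlt.le

theorem faceMap_le_iff (h : IsFacetEmbedding (ttGen α β) (facetIdx b) Φ ι)
    (hW : IsWythoffOrder α β) {x x' : X} : h.faceMap x ≤ h.faceMap x' ↔ x ≤ x' :=
  ⟨h.le_of_faceMap_le hW, h.faceMap_mono hW⟩

theorem faceMap_top (h : IsFacetEmbedding (ttGen α β) (facetIdx b) Φ ι)
    (hW : IsWythoffOrder α β) {x : X} (hx : rk x = n) :
    h.faceMap x = wface α β (.facet b) 1 := by
  have := h.faceMap_apply hW.pos hW.cgroup (h.regular.isRankFun.greatest_mem_flag Φ hx) 1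
  rw [map_one, hx, FaceKind.ofRank_self] at this
  exact this

theorem exists_faceMap_eq (h : IsFacetEmbedding (ttGen α β) (facetIdx b) Φ ι)
    (hW : IsWythoffOrder α β) {f : WythoffFace α β} (hf : f ≤ wface α β (.facet b) 1) :
    ∃ x, h.faceMap x = f := by
  have hR := h.regular.isRankFun
  rcases hf.eq_or_lt with rfl | hlt
  · obtain ⟨t, -, ht⟩ := hR.exists_greatest
    exact ⟨t, h.faceMap_top hW ht⟩
  · obtain ⟨hr, c, hc, hc'⟩ := hW.lt_iff.1 hlt
    rw [kind_wface, wface_eq_iff, inv_one, one_mul, ← h.range_eq hW.pos] at hc'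
    obtain ⟨a, rfl⟩ := hc'
    rw [kind_wface, FaceKind.rank_facet] at hr
    obtain ⟨y, hy, hyr⟩ := hR.exists_mem_flag Φ f.kind.neg_one_le_rank hr.le
    refine ⟨a y, ?_⟩
    rw [h.faceMap_apply hW.pos hW.cgroup hy, hyr, FaceKind.ofRank_rank b (Or.inl hr)]
    exact hc.symm

theorem faceMap_le_facet (h : IsFacetEmbedding (ttGen α β) (facetIdx b) Φ ι)
    (hW : IsWythoffOrder α β) (x : X) : h.faceMap x ≤ wface α β (.facet b) 1 := by
  obtain ⟨t, ht, htr⟩ := h.regular.isRankFun.exists_greatest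
  rw [← h.faceMap_top hW htr]
  exact h.faceMap_mono hW (ht x)

/-- The base facet is isomorphic to the polytope. -/
noncomputable def facetIso (h : IsFacetEmbedding (ttGen α β) (facetIdx b) Φ ι)
    (hW : IsWythoffOrder α β) : X ≃o Set.Iic (wface α β (.facet b) 1) :=
  RelIso.ofSurjective (OrderEmbedding.ofMapLEIff
    (fun x => (⟨h.faceMap x, h.faceMap_le_facet hW x⟩ : Set.Iic (wface α β (.facet b) 1)))
    fun _ _ => h.faceMap_le_iff hW) fun f => by
      obtain ⟨x, hx⟩ := h.exists_faceMap_eq hW f.2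
      exact ⟨x, Subtype.ext hx⟩

theorem facetIso_apply (h : IsFacetEmbedding (ttGen α β) (facetIdx b) Φ ι)
    (hW : IsWythoffOrder α β) (x : X) : (h.facetIso hW x : WythoffFace α β) = h.faceMap x := rfl

/-- Equivariance is what later identifies an automorphism fixing the base facet with a translation.
-/
theorem faceMap_aut (h : IsFacetEmbedding (ttGen α β) (facetIdx b) Φ ι)
    (hW : IsWythoffOrder α β) (a : X ≃o X) (x : X) :
    h.faceMap (a x) = hW.act (ι a) (h.faceMap x) := by
  obtain ⟨c, y, hy, rfl⟩ := h.regular.exists_aut_mem Φ x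
  rw [h.faceMap_apply hW.pos hW.cgroup hy, hW.act_wface, ← map_mul,
    ← h.faceMap_apply hW.pos hW.cgroup hy]
  rfl

theorem nonempty_iso_of_kind (h : IsFacetEmbedding (ttGen α β) (facetIdx b) Φ ι)
    (hW : IsWythoffOrder α β) {f : WythoffFace α β} (hf : f.kind = .facet b) :
    Nonempty (Set.Iic f ≃o X) := by
  obtain ⟨g, hg⟩ := exists_eq_wface f
  rw [hf] at hg
  have e := (hW.act g).iicCongr (wface α β (.facet b) 1)
  rw [hW.act_wface, mul_one, ← hg] at e
  exact ⟨e.symm.trans (h.facetIso hW).symm⟩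

end IsFacetEmbedding

end Wythoff

/-! ### The face poset is a polytope -/

section Wythoff

variable {Γ : Type w} [Group Γ] {n : ℕ} {α : Fin n → Γ} {β : Γ}

theorem FaceKind.ridge_gens_subset {j : Fin n} (hj : (j : ℕ) + 1 = n) (b : Bool) :
    (FaceKind.proper j).gens ⊆ (FaceKind.facet b).gens := by
  rintro x ⟨h1, h2⟩
  rcases x with _ | i
  · exact absurd rfl (h2 hj)
  · have hij : i ≠ j := fun h => h1 (congrArg some h)
    have hij' : (i : ℕ) ≠ j := fun h => hij (Fin.ext h)
    cases b
    · intro k hk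
      obtain rfl := Option.some.inj hk
      have := i.2
      omega
    · simp [facet, gens]

theorem exists_eq_facetIdx (hn : 1 ≤ n) (x : Option (Fin n)) : ∃ b k, x = facetIdx b k := by
  rcases x with _ | k
  · exact ⟨false, ⟨n - 1, by omega⟩, (facetIdx_false_last (by simp; omega)).symm⟩
  · exact ⟨true, k, (facetIdx_true k).symm⟩

theorem eq_wface_ridge {R : WythoffFace α β} {j : Fin n} (hj : (j : ℕ) + 1 = n)
    (hR : R.kind.rank = (n : ℤ) - 1) : ∃ g, R = wface α β (.proper j) g := by
  obtain ⟨g, hg⟩ := exists_eq_wface R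
  exact ⟨g, by rw [← FaceKind.eq_proper_of_rank (t := R.kind) (j := j) (by omega)]; exact hg⟩

namespace IsWythoffOrder

variable [PartialOrder (WythoffFace α β)]

theorem exists_facet_ge (h : IsWythoffOrder α β) {x : WythoffFace α β} (hx : x.kind.rank ≤ n) :
    ∃ f : WythoffFace α β, f.kind.rank = n ∧ x ≤ f := by
  obtain ⟨t, -, htop⟩ := h.isRankFun_kind.exists_greatest
  obtain ⟨b, -, hb⟩ := h.isRankFun_kind.exists_greatest
  obtain ⟨z, h1, -, h3⟩ := h.isRankFun_kind.exists_le (j := n)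
    (h.isRankFun_kind.le_of_rank_eq_top hb x) hx (by rw [hb]; simp)
  exact ⟨z, h3, h1⟩

/-- The stabilizer of a ridge is contained in both kinds of facet stabilizers, so a ridge determines
its facet of each kind. -/
theorem facet_eq_of_ridge_lt (h : IsWythoffOrder α β) {j : Fin n} (hj : (j : ℕ) + 1 = n) {g : Γ}
    {f : WythoffFace α β} {b : Bool} (hf : f.kind = .facet b) (hlt : wface α β (.proper j) g < f) :
    f = wface α β (.facet b) g := by
  obtain ⟨-, c, hc, hc'⟩ := h.lt_iff.1 hlt
  rw [kind_wface, wface_eq_iff] at hc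
  rw [hc', hf, eq_comm, wface_eq_iff]
  exact stabSubgroup_mono (FaceKind.ridge_gens_subset hj b) hc

theorem ridge_lt_facet (h : IsWythoffOrder α β) (j : Fin n) (b : Bool) (g : Γ) :
    wface α β (.proper j) g < wface α β (.facet b) g :=
  h.wface_lt (by rw [FaceKind.rank_facet]; simp [FaceKind.rank]) g

/-- The flag of all faces that contain a given element of the group, except for one facet. -/
def baseFlag (h : IsWythoffOrder α β) (b : Bool) (g : Γ) : Flag (WythoffFace α β) :=
  Flag.ofIsMaxChain {x | x.kind ≠ .facet (!b) ∧ x = wface α β x.kind g} <|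
    h.isRankFun_kind.isMaxChain (by
      rintro x ⟨hx, hx'⟩ y ⟨hy, hy'⟩ hxy
      rcases lt_trichotomy x.kind.rank y.kind.rank with hr | hr | hr
      · exact Or.inl (h.lt_iff.2 ⟨hr, g, hx', hy'⟩).le
      · refine absurd ?_ hxy
        have : x.kind = y.kind := by
          by_cases hn : x.kind.rank = n
          · obtain ⟨c, hc⟩ := FaceKind.eq_facet_of_rank hn
            obtain ⟨d, hd⟩ := FaceKind.eq_facet_of_rank (hr.symm.trans hn)
            rw [hc, hd]
            have h1 : c ≠ !b := fun h => hx (by rw [hc, h])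
            have h2 : d ≠ !b := fun h => hy (by rw [hd, h])
            congr 1
            revert h1 h2; cases b <;> cases c <;> cases d <;> simp
          · by_cases hn' : x.kind.rank < n
            · rw [← FaceKind.ofRank_rank b (Or.inl hn'), hr,
                FaceKind.ofRank_rank b (Or.inl (hr ▸ hn'))]
            · have h1 := x.kind.rank_le
              rw [FaceKind.eq_top_of_rank (t := x.kind) (by omega),
                FaceKind.eq_top_of_rank (t := y.kind) (by omega)]
        rw [hx', hy', this]
      · exact Or.inr (h.lt_iff.2 ⟨hr, g, hy', hx'⟩).le) fun j h0 h1 => by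
    push_cast at h1
    by_cases hj : j = n + 1
    · exact ⟨wface α β .top g, ⟨by cases b <;> simp [kind_wface, FaceKind.facet], rfl⟩, hj.symm⟩
    · have hr := FaceKind.rank_ofRank (n := n) b h0 (by omega)
      refine ⟨wface α β (.ofRank b j) g, ⟨?_, rfl⟩, hr⟩
      rw [kind_wface]
      intro he
      rw [he, FaceKind.rank_facet] at hr
      subst hr
      rw [FaceKind.ofRank_self] at he
      revert he; cases b <;> simp [FaceKind.facet]

theorem facet_mem_baseFlag (h : IsWythoffOrder α β) (b : Bool) (g : Γ) :
    wface α β (.facet b) g ∈ h.baseFlag b g :=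
  ⟨by cases b <;> simp [kind_wface, FaceKind.facet], rfl⟩

theorem mem_baseFlag_of_rank_ne (h : IsWythoffOrder α β) (b : Bool) {g : Γ} {x : WythoffFace α β}
    (hx : x.kind.rank ≠ n) (hx' : x = wface α β x.kind g) : x ∈ h.baseFlag b g :=
  ⟨fun he => hx (by rw [he, FaceKind.rank_facet]), hx'⟩

theorem flagAdj_baseFlag (h : IsWythoffOrder α β) (b : Bool) (g : Γ) :
    FlagAdj n (h.baseFlag b g) (h.baseFlag (!b) g) := by
  refine ⟨fun he => ?_, fun x hx => ?_⟩
  · have h1 := h.facet_mem_baseFlag b g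
    rw [he] at h1
    exact h1.1 (by rw [Bool.not_not]; rfl)
  · rw [h.rk_eq] at hx
    exact ⟨fun hm => h.mem_baseFlag_of_rank_ne _ hx hm.2,
      fun hm => h.mem_baseFlag_of_rank_ne _ hx hm.2⟩

/-- Adjacent steps between flags through a face. -/
def Step (F : WythoffFace α β) (s t : Flag (WythoffFace α β)) : Prop :=
  (∃ j, FlagAdj j s t) ∧ F ∈ t

theorem step_of_adj {F : WythoffFace α β} {s t : Flag (WythoffFace α β)}
    (hF : F ∈ s)
    (hst : Relation.ReflTransGen (fun s t => ∃ j, rk F ≠ j ∧ FlagAdj j s t) s t) :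
    Relation.ReflTransGen (Step F) s t := by
  suffices Relation.ReflTransGen (Step F) s t ∧ F ∈ t from this.1
  induction hst with
  | refl => exact ⟨.refl, hF⟩
  | tail _ hbc ih =>
    obtain ⟨j, hj, hadj⟩ := hbc
    have := (hadj.2 F hj).1 ih.2
    exact ⟨ih.1.tail ⟨⟨j, hadj⟩, this⟩, this⟩

variable (Hf : ∀ f : WythoffFace α β, f.kind.rank = n → IsGradedPolytope n (Set.Iic f))

include Hf in
theorem flagConnected_of_le_facet {F G f : WythoffFace α β} (hf : f.kind.rank = n) (hFG : F ≤ G)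
    (hGf : G ≤ f) : FlagConnected (Set.Icc F G) :=
  ((Hf f hf).strongly_connected ⟨F, hFG.trans hGf⟩ ⟨G, hGf⟩ hFG).congr (iccIicIso _ _)

include Hf in
/-- Flags with a common facet are connected via flags through any face of the facet. -/
theorem step_of_common_facet (h : IsWythoffOrder α β) {F f : WythoffFace α β}
    {s t : Flag (WythoffFace α β)} (hf : f.kind.rank = n) (hFf : F ≤ f) (hFs : F ∈ s) (hFt : F ∈ t)
    (hfs : f ∈ s) (hft : f ∈ t) : Relation.ReflTransGen (Step F) s t := by
  have hR := h.isRankFun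
  obtain ⟨e, he, her⟩ := hR.exists_least
  -- The part between `F` and `f` is adjusted before the part below `F`. Neither phase touches `F`,
  -- and above `f` there is only the greatest face.
  obtain ⟨s₁, hs₁, hc₁⟩ := hR.section_connected hFs hfs hFt hft hFf
    (flagConnected_of_le_facet Hf hf hFf le_rfl)
  have hF₁ : F ∈ s₁ := (hs₁ F).2 (Or.inl ⟨hFs, Or.inl le_rfl⟩)
  obtain ⟨s₂, hs₂, hc₂⟩ := hR.section_connected (hR.least_mem_flag s₁ her) hF₁
    (hR.least_mem_flag t her) hFt (he F) (flagConnected_of_le_facet Hf hf (he F) hFf)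
  have hst : s₂ = t := Flag.eq_of_forall_mem fun x hx => by
    have hle : ∀ y ∈ s, f ≤ y → y ∈ t := by
      intro y hy hfy
      rcases hfy.eq_or_lt with rfl | hlt
      · exact hft
      · have h1 := h.isRankFun_kind.strictMono hlt
        have h2 := h.isRankFun_kind.le_top y
        simp only [hf] at h1
        exact hR.greatest_mem_flag t (by rw [h.rk_eq]; push_cast at *; omega)
    rcases (hs₂ x).1 hx with ⟨hx₁, hx'⟩ | hx'
    · rcases (hs₁ x).1 hx₁ with ⟨hxs, hxs'⟩ | hxt
      · rcases hx' with hx' | hx'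
        · rw [← (he x).antisymm hx']; exact hR.least_mem_flag t her
        · rcases hxs' with hxs' | hxs'
          · rw [hxs'.antisymm hx']; exact hFt
          · exact hle x hxs hxs'
      · exact hxt.1
    · exact hx'.1
  rw [← hst]
  refine (step_of_adj hFs (Relation.ReflTransGen.mono ?_ _ _ hc₁)).trans
    (step_of_adj hF₁ (Relation.ReflTransGen.mono ?_ _ _ hc₂))
  · rintro u v ⟨j, h1, h2, h3⟩; exact ⟨j, h1.ne, h3⟩
  · rintro u v ⟨j, h1, h2, h3⟩; exact ⟨j, h2.ne', h3⟩

theorem step_baseFlag (h : IsWythoffOrder α β) {F : WythoffFace α β} {g : Γ}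
    (hF : F.kind.rank < n) (hg : F = wface α β F.kind g) (b c : Bool) :
    Relation.ReflTransGen (Step F) (h.baseFlag b g) (h.baseFlag c g) := by
  by_cases hbc : c = b
  · subst hbc; exact .refl
  · obtain rfl : c = !b := by revert hbc; cases b <;> cases c <;> simp
    exact .single ⟨⟨n, h.flagAdj_baseFlag b g⟩, h.mem_baseFlag_of_rank_ne _ hF.ne hg⟩

-- Write `σ` as a word in generators fixing `F`. Each generator fixes one of the two base facets, so
-- for the right kind consecutive base flags share a facet and are connected inside it; switching
-- the kind is a single adjacency of rank `n`.
include Hf in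
theorem step_baseFlag_mul (h : IsWythoffOrder α β) {F : WythoffFace α β} {g σ : Γ}
    (hF : F.kind.rank < n) (hg : F = wface α β F.kind g) (hσ : σ ∈ stabSubgroup α β F.kind) :
    Relation.ReflTransGen (Step F) (h.baseFlag true g) (h.baseFlag true (g * σ)) := by
  have hmem : ∀ τ ∈ stabSubgroup α β F.kind, F = wface α β F.kind (g * τ) := by
    intro τ hτ
    refine hg.trans (wface_eq_iff.2 ?_)
    rwa [inv_mul_cancel_left]
  have key : ∀ i ∈ F.kind.gens, ∀ τ ∈ stabSubgroup α β F.kind,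
      Relation.ReflTransGen (Step F) (h.baseFlag true g) (h.baseFlag true (g * τ)) →
      Relation.ReflTransGen (Step F) (h.baseFlag true g)
        (h.baseFlag true (g * (τ * ttGen α β i))) := by
    intro i hi τ hτ ih
    obtain ⟨b, k, hbk⟩ := exists_eq_facetIdx h.pos i
    have hτi : τ * ttGen α β i ∈ stabSubgroup α β F.kind :=
      mul_mem hτ (Subgroup.subset_closure ⟨i, hi, rfl⟩)
    have hfac : wface α β (.facet b) (g * τ) = wface α β (.facet b) (g * (τ * ttGen α β i)) := by
      rw [wface_eq_iff, show (g * τ)⁻¹ * (g * (τ * ttGen α β i)) = ttGen α β i by group]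
      refine Subgroup.subset_closure ⟨i, ?_, rfl⟩
      rw [← FaceKind.range_facetIdx h.pos]
      exact ⟨k, hbk.symm⟩
    have hlt : F < wface α β (.facet b) (g * τ) := by
      have := h.wface_lt (t := F.kind) (t' := .facet b) (by rwa [FaceKind.rank_facet]) (g * τ)
      rwa [← hmem τ hτ] at this
    refine ((ih.trans (h.step_baseFlag hF (hmem τ hτ) true b)).trans ?_).trans
      (h.step_baseFlag hF (hmem _ hτi) b true)
    refine h.step_of_common_facet Hf (f := wface α β (.facet b) (g * τ))
      (FaceKind.rank_facet b) hlt.le (h.mem_baseFlag_of_rank_ne _ hF.ne (hmem τ hτ))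
      (h.mem_baseFlag_of_rank_ne _ hF.ne (hmem _ hτi)) (h.facet_mem_baseFlag b _) ?_
    rw [hfac]; exact h.facet_mem_baseFlag b _
  induction hσ using Subgroup.closure_induction_right with
  | one => rw [mul_one]
  | mul_right τ hτ x hx ih =>
    obtain ⟨i, hi, rfl⟩ := hx
    exact key i hi τ hτ ih
  | mul_inv_cancel τ hτ x hx ih =>
    obtain ⟨i, hi, rfl⟩ := hx
    rw [inv_eq_of_mul_eq_one_right (h.cgroup.gen_mul_self i)]
    exact key i hi τ hτ ih

-- Any flag through `F` shares its facet with the base flag of some element of the coset `F`, and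
-- two elements of this coset differ by the stabilizer treated in `step_baseFlag_mul`.
include Hf in
theorem step_of_mem (h : IsWythoffOrder α β) {F : WythoffFace α β}
    (hF : F.kind.rank < n) {s t : Flag (WythoffFace α β)} (hs : F ∈ s) (ht : F ∈ t) :
    Relation.ReflTransGen (Step F) s t := by
  have hR := h.isRankFun
  have key : ∀ s : Flag (WythoffFace α β), F ∈ s → ∃ b c f, F = wface α β F.kind c ∧
      f ∈ s ∧ f ∈ h.baseFlag b c ∧ f.kind.rank = n ∧ F ≤ f ∧ F ∈ h.baseFlag b c := by
    intro s hs
    obtain ⟨f, hfs, hfr⟩ := hR.exists_mem_flag s (j := n) (by omega) (by push_cast; omega)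
    rw [h.rk_eq] at hfr
    have hlt := hR.flag_lt s hs hfs (by rw [h.rk_eq, h.rk_eq, hfr]; exact hF)
    obtain ⟨-, c, hc, hc'⟩ := h.lt_iff.1 hlt
    obtain ⟨b, hb⟩ := FaceKind.eq_facet_of_rank hfr
    refine ⟨b, c, f, hc, hfs, ?_, hfr, hlt.le, h.mem_baseFlag_of_rank_ne _ hF.ne hc⟩
    rw [hb] at hc'
    rw [hc']; exact h.facet_mem_baseFlag b c
  obtain ⟨b, c, f, hFc, hfs, hfb, hfr, hFf, hFb⟩ := key s hs
  obtain ⟨b', c', f', hFc', hfs', hfb', hfr', hFf', hFb'⟩ := key t ht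
  have hσ : c⁻¹ * c' ∈ stabSubgroup α β F.kind := wface_eq_iff.1 (hFc.symm.trans hFc')
  have h1 := h.step_baseFlag_mul Hf hF hFc hσ
  rw [mul_inv_cancel_left] at h1
  exact ((((h.step_of_common_facet Hf hfr hFf hs hFb hfs hfb).trans
    (h.step_baseFlag hF hFc b true)).trans h1).trans (h.step_baseFlag hF hFc' true b')).trans
    (h.step_of_common_facet Hf hfr' hFf' hFb' ht hfb' hfs')

include Hf in
/-- The face poset is a polytope if its facets are. -/
theorem isGradedPolytope (h : IsWythoffOrder α β) :
    IsGradedPolytope ((n + 1 : ℕ) : ℤ) (WythoffFace α β) where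
  isRankFun := h.isRankFun
  diamond F G hFG hr := by
    rw [h.rk_eq, h.rk_eq] at hr
    -- If `G` is a proper face, or the least one, the diamond lies inside a facet.
    by_cases hG : G.kind.rank ≤ n
    · obtain ⟨f, hf, hGf⟩ := h.exists_facet_ge hG
      have hRf := (h.isRankFun.iic f)
      refine (encard_Ioo_iic (⟨F, hFG.le.trans hGf⟩ : Set.Iic f) ⟨G, hGf⟩).trans ?_
      refine (Hf f hf).diamond _ _ hFG ?_
      rw [h.isRankFun.rk_iic, h.isRankFun.rk_iic, h.rk_eq, h.rk_eq]
      exact hr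
    -- Otherwise `G` is the greatest face and `F` is a ridge, so the two faces in between are its
    -- two facets.
    · have h1 := G.kind.rank_le
      have hn := h.pos
      obtain ⟨j, hj⟩ : ∃ j : Fin n, (j : ℕ) + 1 = n := ⟨⟨n - 1, by omega⟩, by simp; omega⟩
      obtain ⟨g, rfl⟩ := eq_wface_ridge (R := F) hj (by omega)
      have hset : Set.Ioo (wface α β (.proper j) g) G =
          {wface α β (.facet true) g, wface α β (.facet false) g} := by
        ext x
        constructor
        · rintro ⟨hx1, hx2⟩
          have h2 : ((j : ℕ) : ℤ) < x.kind.rank := h.isRankFun_kind.strictMono hx1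
          have h3 : x.kind.rank < G.kind.rank := h.isRankFun_kind.strictMono hx2
          obtain ⟨b, hb⟩ := FaceKind.eq_facet_of_rank (t := x.kind) (by omega)
          rw [h.facet_eq_of_ridge_lt hj hb hx1]
          cases b <;> simp
        · have key : ∀ b, wface α β (.facet b) g ∈
              Set.Ioo (wface α β (.proper j) g) G := fun b =>
            ⟨h.ridge_lt_facet j b g, h.isRankFun.lt_of_comparable
              (Or.inl (h.isRankFun.le_of_rank_eq_top (by rw [h.rk_eq]; push_cast; omega) _))
              (by rw [h.rk_eq, h.rk_eq, kind_wface, FaceKind.rank_facet]; omega)⟩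
          rintro (rfl | rfl)
          · exact key true
          · exact key false
      rw [hset, Set.encard_pair]
      intro he
      have := congrArg Sigma.fst he
      simp [wface, FaceKind.facet] at this
  strongly_connected F G hFG := by
    have hR := h.isRankFun
    by_cases hG : G.kind.rank ≤ n
    · obtain ⟨f, hf, hGf⟩ := h.exists_facet_ge hG
      exact flagConnected_of_le_facet Hf hf hFG hGf
    · have hGr : rk G = ((n + 1 : ℕ) : ℤ) := by
        have := G.kind.rank_le
        rw [h.rk_eq]; push_cast; omega
      rcases hFG.eq_or_lt with rfl | hlt
      · intro s t
        rw [Flag.eq_of_forall_mem (s := s) (t := t)]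
        intro x _
        rw [show x = ⟨F, le_rfl, hFG⟩ from Subtype.ext (x.2.2.antisymm x.2.1)]
        exact hR.left_mem_flag_icc hFG t
      · refine hR.flagConnected_icc hFG fun s t hFs hGs hFt hGt => ?_
        have hstep : Relation.ReflTransGen (Step F) s t := by
          have hFr := (h.isRankFun_kind.strictMono hlt)
          by_cases hF : F.kind.rank < n
          · exact h.step_of_mem Hf hF hFs hFt
          -- Here `F` is itself a facet, common to both flags.
          · refine h.step_of_common_facet Hf (f := F) ?_ le_rfl hFs hFt hFs hFt
            rw [h.rk_eq] at hGr
            simp only [hGr] at hFr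
            push_cast at hFr
            omega
        exact Relation.ReflTransGen.mono
          (fun u v huv => ⟨huv.1, huv.2, hR.greatest_mem_flag v hGr⟩) _ _ hstep

end IsWythoffOrder

end Wythoff

/-! ### The sections above faces of rank `n - 2` -/

section Wythoff

variable {Γ : Type w} [Group Γ] {n : ℕ} {α : Fin n → Γ} {β : Γ}

/-- The alternating products `…, 1, σ, σ τ, σ τ σ, …` of two involutions. -/
def altProd (σ τ : Γ) (i : ℤ) : Γ := (σ * τ) ^ (i / 2) * if i % 2 = 0 then 1 else σ

/-- The factor in the step from `altProd σ τ i` to `altProd σ τ (i + 1)`. -/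
def altStep (σ τ : Γ) (i : ℤ) : Γ := if i % 2 = 0 then σ else τ

theorem altProd_succ (σ τ : Γ) (i : ℤ) :
    altProd σ τ (i + 1) = altProd σ τ i * altStep σ τ i := by
  rcases Int.emod_two_eq_zero_or_one i with h | h
  · have h1 : (i + 1) / 2 = i / 2 := by omega
    have h2 : ¬ (i + 1) % 2 = 0 := by omega
    simp [altProd, altStep, h, h1, h2]
  · have h1 : (i + 1) / 2 = i / 2 + 1 := by omega
    have h2 : (i + 1) % 2 = 0 := by omega
    have h3 : ¬ i % 2 = 0 := by omega
    simp only [altProd, altStep, h1, h2, h3, if_true, if_false, mul_one]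
    rw [zpow_add_one, mul_assoc]

theorem altStep_mul_self {σ τ : Γ} (hσ : σ * σ = 1) (hτ : τ * τ = 1) (i : ℤ) :
    altStep σ τ i * altStep σ τ i = 1 := by
  unfold altStep; split_ifs <;> assumption

/-- One of the two involutions is the next factor of the alternating product and the other cancels
the last one, so the index moves by one. -/
theorem exists_altProd_mul {σ τ : Γ} (hσ : σ * σ = 1) (hτ : τ * τ = 1) (i : ℤ) {x : Γ}
    (hx : x = σ ∨ x = τ) : ∃ k, altProd σ τ i * x = altProd σ τ k := by
  by_cases hs : x = altStep σ τ i
  · exact ⟨i + 1, by rw [altProd_succ, hs]⟩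
  · have hs' : x = altStep σ τ (i - 1) := by
      rcases Int.emod_two_eq_zero_or_one i with h | h
      · have h2 : ¬ (i - 1) % 2 = 0 := by omega
        simp only [altStep, h, h2, if_true, if_false] at hs ⊢
        exact hx.resolve_left hs
      · have h2 : (i - 1) % 2 = 0 := by omega
        have h3 : ¬ i % 2 = 0 := by omega
        simp only [altStep, h3, h2, if_true, if_false] at hs ⊢
        exact hx.resolve_right hs
    refine ⟨i - 1, ?_⟩
    have := altProd_succ σ τ (i - 1)
    rw [sub_add_cancel] at this
    rw [this, hs', mul_assoc, altStep_mul_self hσ hτ, mul_one]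

theorem exists_altProd_eq {σ τ : Γ} (hσ : σ * σ = 1) (hτ : τ * τ = 1) {x : Γ}
    (hx : x ∈ Subgroup.closure {σ, τ}) : ∃ i, x = altProd σ τ i := by
  induction hx using Subgroup.closure_induction_right with
  | one => exact ⟨0, by simp [altProd]⟩
  | mul_right x _ y hy ih =>
    obtain ⟨i, rfl⟩ := ih
    exact exists_altProd_mul hσ hτ i hy
  | mul_inv_cancel x _ y hy ih =>
    obtain ⟨i, rfl⟩ := ih
    have hy' : y⁻¹ = y := by
      rcases hy with rfl | rfl
      · exact inv_eq_of_mul_eq_one_right hσ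
      · exact inv_eq_of_mul_eq_one_right hτ
    rw [hy']
    exact exists_altProd_mul hσ hτ i hy

theorem altProd_mem (σ τ : Γ) (i : ℤ) : altProd σ τ i ∈ Subgroup.closure {σ, τ} := by
  have hσ : σ ∈ Subgroup.closure {σ, τ} := Subgroup.subset_closure (by simp)
  have hτ : τ ∈ Subgroup.closure {σ, τ} := Subgroup.subset_closure (by simp)
  unfold altProd
  refine mul_mem (zpow_mem (mul_mem hσ hτ) _) ?_
  split_ifs
  · exact one_mem _
  · exact hσ

/-- A coincidence between different parities would make `σ` a power of `σ * τ`; since `σ` has square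
one and the product has infinite order, `σ` would be trivial. -/
theorem altProd_injective {σ τ : Γ} (hσ : σ * σ = 1) (hσ1 : σ ≠ 1) (hord : orderOf (σ * τ) = 0) :
    Function.Injective (altProd σ τ) := by
  have hz : ∀ k : ℤ, (σ * τ) ^ k = 1 → k = 0 := by
    intro k hk
    have := orderOf_dvd_iff_zpow_eq_one.2 hk
    rw [hord] at this
    simpa using this
  have hne : ∀ a b : ℤ, (σ * τ) ^ a ≠ (σ * τ) ^ b * σ := by
    intro a b he
    have h1 : σ = (σ * τ) ^ (a - b) := by
      rw [sub_eq_add_neg, add_comm, zpow_add, he, zpow_neg, inv_mul_cancel_left]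
    have h2 : (σ * τ) ^ ((a - b) + (a - b)) = 1 := by rw [zpow_add, ← h1, hσ]
    have h3 := hz _ h2
    rw [show a - b = 0 by omega, zpow_zero] at h1
    exact hσ1 h1
  have heq : ∀ a b : ℤ, (σ * τ) ^ a = (σ * τ) ^ b → a = b := by
    intro a b he
    have := hz (a - b) (by rw [zpow_sub, he, mul_inv_cancel])
    omega
  intro i k hik
  unfold altProd at hik
  split_ifs at hik with h1 h2 h2
  · have := heq _ _ (by simpa using hik); omega
  · exact absurd (by simpa using hik) (hne (i / 2) (k / 2))
  · exact absurd (by simpa using hik.symm) (hne (k / 2) (i / 2))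
  · have := heq _ _ (mul_right_cancel hik); omega

theorem mem_closure_involution {σ x : Γ} (hσ : σ * σ = 1) (hx : x ∈ Subgroup.closure {σ}) :
    x = 1 ∨ x = σ := by
  obtain ⟨k, rfl⟩ := Subgroup.mem_closure_singleton.1 hx
  rcases Int.even_or_odd' k with ⟨m, rfl | rfl⟩
  · left; rw [zpow_mul, zpow_two, hσ, one_zpow]
  · right; rw [zpow_add_one, zpow_mul, zpow_two, hσ, one_zpow, one_mul]

/-! ### The dihedral group of the last two generators and the face stabilizers -/

namespace IsTailTriangleCGroup

variable {j : Fin n}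

/-- Only the last two generators act above rank `n - 2`. For `n = 1` this rank is `-1`, and the face
in question is the least one. -/
theorem highGens_eq (hj : (j : ℕ) + 1 = n) {t : FaceKind n} (ht : t.rank = (n : ℤ) - 2) :
    t.highGens = {some j, none} := by
  have hjn : ∀ i : Fin n, (i : ℕ) + 1 = n ↔ i = j := fun i => by
    rw [Fin.ext_iff]; omega
  cases t with
  | bot =>
    have hn : n = 1 := by simp [FaceKind.rank] at ht; omega
    ext x
    refine iff_of_true ⟨trivial, Set.notMem_empty x⟩ ?_
    rcases x with _ | i
    · simp
    · left; rw [← (hjn i).1 (by have := i.2; omega)]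
  | proper k =>
    have hk : (k : ℕ) + 2 = n := by simp [FaceKind.rank] at ht; omega
    ext x
    constructor
    · rintro ⟨⟨h1, h2⟩, h3⟩
      rcases x with _ | i
      · simp
      · left
        rw [← (hjn i).1]
        have h4 : i ≠ k := fun h => h1 (congrArg some h)
        have h5 : ¬ i < k := fun h => h3 ⟨i, rfl, h⟩
        have h6 : (i : ℕ) ≠ k := fun h => h4 (Fin.ext h)
        have h7 : ¬ (i : ℕ) < k := h5
        have := i.2
        omega
    · rintro (rfl | rfl)
      · refine ⟨⟨fun h => ?_, fun _ => by simp⟩, ?_⟩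
        · obtain rfl := Option.some.inj h; omega
        · rintro ⟨i, hi, hik⟩
          obtain rfl := Option.some.inj hi
          have : (j : ℕ) < k := hik
          omega
      · exact ⟨⟨by simp, fun h => by omega⟩, fun ⟨i, hi, _⟩ => by simp at hi⟩
  | facetP => simp [FaceKind.rank] at ht; omega
  | facetQ => simp [FaceKind.rank] at ht; omega
  | top => simp [FaceKind.rank] at ht; omega

theorem image_pair (α : Fin n → Γ) (β : Γ) (j : Fin n) :
    ttGen α β '' {some j, none} = {α j, β} := by
  rw [Set.image_pair]; rfl

/-- By the intersection condition the dihedral group meets the ridge stabilizer trivially, while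
`facet_inf` leaves a group of order two for a facet. So distinct dihedral elements give distinct
ridges, and each facet is shared by two of them. -/
theorem ridge_inf (hC : IsTailTriangleCGroup α β) (hj : (j : ℕ) + 1 = n) {x : Γ}
    (hx : x ∈ Subgroup.closure {α j, β}) (hx' : x ∈ stabSubgroup α β (.proper j)) : x = 1 := by
  have := hC.intersection {some j, none} (FaceKind.proper j).gens
  rw [image_pair] at this
  have hmem : x ∈ Subgroup.closure {α j, β} ⊓ stabSubgroup α β (.proper j) := ⟨hx, hx'⟩
  rw [stabSubgroup, this] at hmem
  have he : ({some j, none} : Set (Option (Fin n))) ∩ (FaceKind.proper j).gens = ∅ := by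
    rw [Set.eq_empty_iff_forall_notMem]
    rintro y ⟨rfl | rfl, h1, h2⟩
    · exact h1 rfl
    · exact h2 hj rfl
  rwa [he, Set.image_empty, Subgroup.closure_empty, Subgroup.mem_bot] at hmem

theorem facet_inf (hC : IsTailTriangleCGroup α β) (hj : (j : ℕ) + 1 = n) (b : Bool) {x : Γ}
    (hx : x ∈ Subgroup.closure {α j, β}) (hx' : x ∈ stabSubgroup α β (.facet b)) :
    x = 1 ∨ x = ttGen α β (facetIdx b j) := by
  have := hC.intersection {some j, none} (FaceKind.facet b).gens
  rw [image_pair] at this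
  have hmem : x ∈ Subgroup.closure {α j, β} ⊓ stabSubgroup α β (.facet b) := ⟨hx, hx'⟩
  rw [stabSubgroup, this] at hmem
  refine mem_closure_involution (hC.gen_mul_self _) ?_
  have he : ({some j, none} : Set (Option (Fin n))) ∩ (FaceKind.facet b).gens ⊆ {facetIdx b j} := by
    rintro y ⟨rfl | rfl, h1⟩
    · cases b
      · exact absurd (h1 j rfl) (by omega)
      · simp [facetIdx_true]
    · cases b
      · simp [facetIdx_false_last hj]
      · exact absurd rfl h1
  have := Subgroup.closure_mono (Set.image_mono (f := ttGen α β) he) hmem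
  rwa [Set.image_singleton] at this

end IsTailTriangleCGroup

theorem altStep_eq {j : Fin n} (hj : (j : ℕ) + 1 = n) (i : ℤ) :
    altStep (α j) β i = ttGen α β (facetIdx (decide (i % 2 = 0)) j) := by
  by_cases h : i % 2 = 0
  · simp [altStep, h, facetIdx_true, ttGen]
  · simp [altStep, h, facetIdx_false_last hj, ttGen]

/-- The faces above the face `R = wface t g` of rank `n - 2`, indexed by the apeirogon. -/
def apeirogonFace (α : Fin n → Γ) (β : Γ) (j : Fin n) (t : FaceKind n) (g : Γ) :
    Apeirogon → WythoffFace α β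
  | .bot => wface α β t g
  | .vertex i => wface α β (.proper j) (g * altProd (α j) β i)
  | .edge i => wface α β (.facet (decide (i % 2 = 0))) (g * altProd (α j) β i)
  | .top => wface α β .top g

namespace IsWythoffOrder

variable [PartialOrder (WythoffFace α β)] {j : Fin n}

/-- The step from `altProd` at `k` to the one at `k + 1` is the last generator of the facet kind
given by the parity of `k`, and the facet coset contains no other alternating product. -/
theorem apeirogonFace_edge_eq (h : IsWythoffOrder α β) (hj : (j : ℕ) + 1 = n)
    (hord : orderOf (α j * β) = 0) (g : Γ) (i k : ℤ) :
    wface α β (.facet (decide (k % 2 = 0))) (g * altProd (α j) β i) =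
      wface α β (.facet (decide (k % 2 = 0))) (g * altProd (α j) β k) ↔ i = k ∨ i = k + 1 := by
  have hα : α j * α j = 1 := h.cgroup.gen_mul_self (some j)
  have hβ : β * β = 1 := h.cgroup.gen_mul_self none
  have hα1 : α j ≠ 1 := fun he => by
    have := h.cgroup.orderOf_eq_two (some j)
    simp [ttGen, he] at this
  have hinj := altProd_injective hα hα1 hord
  have hmem := mul_mem (inv_mem (altProd_mem (α j) β i)) (altProd_mem (α j) β k)
  rw [wface_eq_iff, show (g * altProd (α j) β i)⁻¹ * (g * altProd (α j) β k) =
    (altProd (α j) β i)⁻¹ * altProd (α j) β k by group]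
  constructor
  · intro hs
    rcases h.cgroup.facet_inf hj _ hmem hs with he | he
    · exact Or.inl (hinj (inv_mul_eq_one.1 he))
    · right
      apply hinj
      rw [altProd_succ, altStep_eq hj, ← mul_inv_eq_one]
      rw [inv_mul_eq_iff_eq_mul] at he
      rw [he, mul_assoc, h.cgroup.gen_mul_self, mul_one, mul_inv_cancel]
  · rintro (rfl | rfl)
    · rw [inv_mul_cancel]; exact one_mem _
    · rw [altProd_succ, mul_inv_rev, mul_assoc, inv_mul_cancel, mul_one, altStep_eq hj]
      refine inv_mem (Subgroup.subset_closure ⟨_, ?_, rfl⟩)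
      rw [← FaceKind.range_facetIdx h.pos]
      exact ⟨j, rfl⟩

theorem apeirogonFace_le_iff (h : IsWythoffOrder α β) (hj : (j : ℕ) + 1 = n)
    (hord : orderOf (α j * β) = 0) {t : FaceKind n} (ht : t.rank = (n : ℤ) - 2) (g : Γ)
    (x y : Apeirogon) :
    apeirogonFace α β j t g x ≤ apeirogonFace α β j t g y ↔ x ≤ y := by
  have hα : α j * α j = 1 := h.cgroup.gen_mul_self (some j)
  have hα1 : α j ≠ 1 := fun he => by
    have := h.cgroup.orderOf_eq_two (some j)
    simp [ttGen, he] at this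
  have hinj := altProd_injective hα hα1 hord
  have hj' : (FaceKind.proper j).rank = (n : ℤ) - 1 := by simp [FaceKind.rank]; omega
  have htop : (FaceKind.top : FaceKind n).rank = (n : ℤ) + 1 := rfl
  have hfac : ∀ b, (FaceKind.facet b : FaceKind n).rank = n := FaceKind.rank_facet
  -- The alternating products stabilize the face of rank `n - 2`, so they may be inserted on the
  -- left.
  have hbot : ∀ (k : FaceKind n) (i : ℤ), t.rank < k.rank →
      wface α β t g ≤ wface α β k (g * altProd (α j) β i) := by
    intro k i hk
    have he : wface α β t g = wface α β t (g * altProd (α j) β i) := by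
      rw [wface_eq_iff, inv_mul_cancel_left]
      have := altProd_mem (α j) β i
      rw [← IsTailTriangleCGroup.image_pair, ← IsTailTriangleCGroup.highGens_eq hj ht] at this
      exact stabSubgroup_mono Set.sdiff_subset this
    rw [he]; exact (h.wface_lt hk _).le
  have hle_top : ∀ z : WythoffFace α β, z ≤ wface α β .top g := fun z =>
    h.isRankFun_kind.le_of_rank_eq_top (by simp [kind_wface, FaceKind.rank]) z
  have hrank : ∀ {z w : WythoffFace α β}, z ≤ w → z.kind.rank ≤ w.kind.rank := fun hzw =>
    h.isRankFun_kind.strictMono.monotone hzw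
  have hpos := h.pos
  have hno : ∀ (k k' : FaceKind n) (c c' : Γ), k'.rank < k.rank →
      ¬ wface α β k c ≤ wface α β k' c' := fun k k' c c' hk hle =>
    absurd (hrank hle) (not_le.2 hk)
  change _ ↔ Apeirogon.le x y
  rcases x with _ | i | i | _ <;> rcases y with _ | k | k | _ <;>
    simp only [apeirogonFace, Apeirogon.le, iff_true, iff_false]
  · exact le_rfl
  · exact hbot _ _ (by omega)
  · exact hbot _ _ (by rw [hfac]; omega)
  · exact hle_top _
  · exact hno _ _ _ _ (by omega)
  · constructor
    · intro hle
      have he := h.isRankFun_kind.eq_of_comparable (Or.inl hle) rfl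
      rw [wface_eq_iff, show (g * altProd (α j) β i)⁻¹ * (g * altProd (α j) β k) =
        (altProd (α j) β i)⁻¹ * altProd (α j) β k by group] at he
      exact hinj (inv_mul_eq_one.1 (h.cgroup.ridge_inf hj
        (mul_mem (inv_mem (altProd_mem (α j) β i)) (altProd_mem (α j) β k)) he))
    · rintro rfl; exact le_rfl
  · rw [← h.apeirogonFace_edge_eq hj hord g i k]
    constructor
    · intro hle
      refine (h.facet_eq_of_ridge_lt hj rfl (lt_of_le_of_ne hle fun he => ?_)).symm
      have := congrArg (fun z : WythoffFace α β => z.kind.rank) he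
      simp only [kind_wface, hfac] at this
      omega
    · intro he
      rw [← he]; exact (h.ridge_lt_facet j _ _).le
  · exact hle_top _
  · exact hno _ _ _ _ (by rw [hfac]; omega)
  · exact hno _ _ _ _ (by rw [hfac]; omega)
  · constructor
    · intro hle
      have he := h.isRankFun_kind.eq_of_comparable (Or.inl hle) (by
        simp only [kind_wface, hfac])
      have hk : (FaceKind.facet (decide (i % 2 = 0)) : FaceKind n) =
        FaceKind.facet (decide (k % 2 = 0)) := congrArg Sigma.fst he
      rw [hk, h.apeirogonFace_edge_eq hj hord] at he
      rcases he with he | he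
      · exact he
      -- Neighbouring edges have facets of different kinds.
      · exfalso
        by_cases h1 : i % 2 = 0 <;> by_cases h2 : k % 2 = 0 <;>
          simp [h1, h2, FaceKind.facet] at hk <;> omega
    · rintro rfl; exact le_rfl
  · exact hle_top _
  · exact hno _ _ _ _ (by omega)
  · exact hno _ _ _ _ (by omega)
  · exact hno _ _ _ _ (by rw [hfac]; omega)
  · exact le_rfl

theorem exists_apeirogonFace_eq (h : IsWythoffOrder α β) (hj : (j : ℕ) + 1 = n)
    {t : FaceKind n} (ht : t.rank = (n : ℤ) - 2) (g : Γ) {f : WythoffFace α β}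
    (hf : wface α β t g ≤ f) : ∃ x, apeirogonFace α β j t g x = f := by
  have hα : α j * α j = 1 := h.cgroup.gen_mul_self (some j)
  have hβ : β * β = 1 := h.cgroup.gen_mul_self none
  rcases hf.eq_or_lt with rfl | hlt
  · exact ⟨.bot, rfl⟩
  obtain ⟨hr, c, hc, hc'⟩ := h.lt_iff.1 hlt
  rw [kind_wface] at hr hc
  -- A common element of the two faces has the form `g * x * y`. The lower part `y` also stabilizes
  -- the larger face and can be dropped, so `x` in the dihedral group remains.
  obtain ⟨x, hx, y, hy, hxy⟩ := h.cgroup.exists_factor (wface_eq_iff.1 hc)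
  rw [IsTailTriangleCGroup.highGens_eq hj ht, IsTailTriangleCGroup.image_pair] at hx
  obtain ⟨i, rfl⟩ := exists_altProd_eq hα hβ hx
  have hfi : f = wface α β f.kind (g * altProd (α j) β i) := by
    refine hc'.trans (wface_eq_iff.2 ?_)
    have hcy : c⁻¹ * (g * altProd (α j) β i) = y⁻¹ := by
      rw [eq_mul_inv_iff_mul_eq.2 hxy.symm]; group
    rw [hcy]
    exact inv_mem (stabSubgroup_mono (FaceKind.lowGens_subset_of_lt hr) hy)
  have h1 := f.kind.rank_le
  by_cases h2 : f.kind.rank = n + 1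
  · refine ⟨.top, ?_⟩
    rw [hfi, FaceKind.eq_top_of_rank h2]
    exact h.wface_top _ _
  by_cases h3 : f.kind.rank = n
  · obtain ⟨b, hb⟩ := FaceKind.eq_facet_of_rank h3
    rw [hb] at hfi
    rw [hfi]
    by_cases hb' : b = decide (i % 2 = 0)
    · exact ⟨.edge i, by rw [hb']; rfl⟩
    -- The ridge with index `i` lies on the edges `i` and `i - 1`; the facet of the other kind is
    -- the edge `i - 1`.
    · have hb'' : b = decide ((i - 1) % 2 = 0) := by
        rcases Int.emod_two_eq_zero_or_one i with h4 | h4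
        · have : ¬ (i - 1) % 2 = 0 := by omega
          simp [h4] at hb'
          simp [this, hb']
        · have : (i - 1) % 2 = 0 := by omega
          simp [h4] at hb'
          simp [this, hb']
      refine ⟨.edge (i - 1), ?_⟩
      rw [hb'', eq_comm]
      change wface _ _ _ _ = wface _ _ _ _
      rw [wface_eq_iff]
      have hs := altProd_succ (α j) β (i - 1)
      rw [sub_add_cancel] at hs
      rw [hs, show (g * (altProd (α j) β (i - 1) * altStep (α j) β (i - 1)))⁻¹ *
        (g * altProd (α j) β (i - 1)) = (altStep (α j) β (i - 1))⁻¹ by group, altStep_eq hj]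
      refine inv_mem (Subgroup.subset_closure ⟨_, ?_, rfl⟩)
      rw [← FaceKind.range_facetIdx h.pos]
      exact ⟨j, rfl⟩
  · refine ⟨.vertex i, ?_⟩
    rw [hfi, FaceKind.eq_proper_of_rank (t := f.kind) (j := j) (by omega)]
    rfl

/-- The section above a face of rank `n - 2` is an apeirogon with alternating kinds of facets. -/
theorem exists_apeirogon (h : IsWythoffOrder α β) (hj : (j : ℕ) + 1 = n)
    (hord : orderOf (α j * β) = 0) {R : WythoffFace α β} (hR : R.kind.rank = (n : ℤ) - 2) :
    ∃ e : Apeirogon ≃o Set.Ici R, ∀ i : ℤ,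
      (e (.edge (2 * i))).1.kind = .facetP ∧ (e (.edge (2 * i + 1))).1.kind = .facetQ := by
  obtain ⟨g, hg⟩ := exists_eq_wface R
  generalize R.kind = t at hR hg
  subst hg
  let f : Apeirogon ↪o Set.Ici (wface α β t g) := OrderEmbedding.ofMapLEIff
    (fun x => ⟨apeirogonFace α β j t g x, (h.apeirogonFace_le_iff hj hord hR g .bot x).2 trivial⟩)
    fun x y => h.apeirogonFace_le_iff hj hord hR g x y
  refine ⟨RelIso.ofSurjective f fun y => ?_, fun i => ⟨?_, ?_⟩⟩
  · obtain ⟨x, hx⟩ := h.exists_apeirogonFace_eq hj hR g y.2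
    exact ⟨x, Subtype.ext hx⟩
  · change FaceKind.facet (decide (2 * i % 2 = 0)) = _
    simp [FaceKind.facet]
  · change FaceKind.facet (decide ((2 * i + 1) % 2 = 0)) = _
    simp [FaceKind.facet]

end IsWythoffOrder

end Wythoff

/-! ### Facets, ridges and vertices -/

section Wythoff

variable {Γ : Type w} [Group Γ] {n : ℕ} {α : Fin n → Γ} {β : Γ}
  {X : Type*} [PartialOrder X] {Φ : Flag X} {b : Bool} {ι : (X ≃o X) →* Γ}
  [PartialOrder (WythoffFace α β)]

namespace IsFacetEmbedding

theorem nonempty_ridge_iso (h : IsFacetEmbedding (ttGen α β) (facetIdx b) Φ ι)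
    (hW : IsWythoffOrder α β) {K : Type*} [PartialOrder K] {F : X} (hF : F ∈ Φ)
    (hFr : rk F = (n : ℤ) - 1) (e : K ≃o Set.Iic F) {R : WythoffFace α β}
    (hR : R.kind.rank = (n : ℤ) - 1) : Nonempty (Set.Iic R ≃o K) := by
  obtain ⟨j, hj⟩ : ∃ j : Fin n, (j : ℕ) + 1 = n :=
    ⟨⟨n - 1, by have := hW.pos; omega⟩, by have := hW.pos; simp; omega⟩
  obtain ⟨g, rfl⟩ := eq_wface_ridge hj hR
  have hmap : h.faceMap F = wface α β (.proper j) 1 := by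
    have := h.faceMap_apply hW.pos hW.cgroup hF 1
    rwa [map_one, hFr, show (n : ℤ) - 1 = ((j : ℕ) : ℤ) by omega, FaceKind.ofRank_natCast] at this
  have e1 := (hW.act g).iicCongr (h.faceMap F)
  rw [hmap, hW.act_wface, mul_one, ← hmap] at e1
  exact ⟨((e.trans ((h.facetIso hW).iicCongr F)).trans ((iicIicIso _).trans e1)).symm⟩

/-- An automorphism of the face poset that maps the base facet to a facet of the same kind
belongs to the group. -/
theorem exists_act_eq (h : IsFacetEmbedding (ttGen α β) (facetIdx b) Φ ι)
    (hW : IsWythoffOrder α β) (hU : IsGradedPolytope ((n + 1 : ℕ) : ℤ) (WythoffFace α β))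
    {g : WythoffFace α β ≃o WythoffFace α β} (hg : (g (wface α β (.facet b) 1)).kind = .facet b) :
    ∃ γ, hW.act γ = g := by
  obtain ⟨c, hc⟩ := exists_eq_wface (g (wface α β (.facet b) 1))
  rw [hg] at hc
  -- A translation brings the image of the base facet back.
  have hfix : (hW.act c⁻¹ * g) (wface α β (.facet b) 1) = wface α β (.facet b) 1 := by
    rw [RelIso.mul_apply, hc, hW.act_wface, inv_mul_cancel]
  set g₁ := hW.act c⁻¹ * g with hg₁
  -- The restriction to the base facet is an automorphism `a` of `X`. The translation by `ι a`
  -- agrees with it on that facet, hence everywhere.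
  let a : X ≃o X := ((h.facetIso hW).trans (iicAut g₁ hfix)).trans (h.facetIso hW).symm
  have ha : hW.act (ι a) = g₁ := by
    refine hU.eq_of_eqOn_facet (F := wface α β (.facet b) 1) ?_ (h.facetIso hW) fun x => ?_
    · rw [hW.rk_eq, kind_wface, FaceKind.rank_facet]; push_cast; omega
    · rw [h.facetIso_apply, ← h.faceMap_aut hW, ← h.facetIso_apply hW, ← h.facetIso_apply hW]
      simp [a, iicAut]
  refine ⟨c * ι a, ?_⟩
  rw [map_mul, ha, hg₁, ← mul_assoc, ← map_mul, mul_inv_cancel, map_one, one_mul]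

/-- An element acting trivially lies in the facet group, so it comes from an automorphism of `X`
that fixes the whole base flag. -/
theorem act_injective (h : IsFacetEmbedding (ttGen α β) (facetIdx b) Φ ι)
    (hW : IsWythoffOrder α β) : Function.Injective hW.act := by
  rw [injective_iff_map_eq_one]
  intro γ hγ
  have hfix : ∀ t, γ ∈ stabSubgroup α β t := by
    intro t
    have : wface α β t (γ * 1) = wface α β t 1 := by rw [← hW.act_wface, hγ]; rfl
    rw [eq_comm, wface_eq_iff] at this
    simpa using this
  have hr := hfix (.facet b)
  rw [← h.range_eq hW.pos] at hr
  obtain ⟨a, rfl⟩ := hr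
  rw [h.regular.eq_one_of_fix (g := a) (s := Φ) fun y hy =>
    (h.mem_stab_iff hW.pos hW.cgroup hy a).1 (hfix _), map_one]

/-- The group is transitive on the flags that contain the base facet. -/
theorem exists_act_map (h : IsFacetEmbedding (ttGen α β) (facetIdx b) Φ ι)
    (hW : IsWythoffOrder α β) {s t : Flag (WythoffFace α β)}
    (hs : wface α β (.facet b) 1 ∈ s) (ht : wface α β (.facet b) 1 ∈ t) :
    ∃ γ, Flag.map (hW.act γ) s = t := by
  have hR := hW.isRankFun
  obtain ⟨a, ha⟩ := h.regular.flagTransitive (inducedFlag hR (h.facetIso hW) hs)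
    (inducedFlag hR (h.facetIso hW) ht)
  refine ⟨ι a, Flag.eq_of_forall_mem fun y hy => ?_⟩
  obtain ⟨y, rfl⟩ := (hW.act (ι a)).surjective y
  rw [Flag.apply_mem_map] at hy
  rcases le_facet_or_top hR (by rw [hW.rk_eq, kind_wface, FaceKind.rank_facet]; push_cast; omega)
    hs hy with hy' | hy'
  · obtain ⟨x, rfl⟩ := h.exists_faceMap_eq hW hy'
    rw [← h.faceMap_aut hW, ← h.facetIso_apply hW, ← mem_inducedFlag hR (h.facetIso hW) ht, ← ha,
      Flag.apply_mem_map]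
    exact hy
  · exact hR.greatest_mem_flag t (by rw [rk_orderIso, hy'])

end IsFacetEmbedding

namespace IsWythoffOrder

/-- As `n ≥ 1`, there is only one kind of vertices, and translations are transitive on the cosets of
one subgroup. -/
theorem vertex_transitive (h : IsWythoffOrder α β) {x y : WythoffFace α β} (hx : rk x = 0)
    (hy : rk y = 0) : ∃ g : WythoffFace α β ≃o WythoffFace α β, g x = y := by
  rw [h.rk_eq] at hx hy
  have hk : x.kind = y.kind := by
    rw [FaceKind.eq_proper_of_rank (t := x.kind) (j := ⟨0, h.pos⟩) (by simpa using hx),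
      FaceKind.eq_proper_of_rank (t := y.kind) (j := ⟨0, h.pos⟩) (by simpa using hy)]
  obtain ⟨a, ha⟩ := exists_eq_wface x
  obtain ⟨c, hc⟩ := exists_eq_wface y
  refine ⟨h.act (c * a⁻¹), ?_⟩
  rw [ha, h.act_wface, inv_mul_cancel_right, hc, hk]

theorem existsUnique_facet (h : IsWythoffOrder α β) {R : WythoffFace α β}
    (hR : R.kind.rank = (n : ℤ) - 1) (b : Bool) :
    ∃! x : WythoffFace α β, x.kind = .facet b ∧ R < x := by
  obtain ⟨j, hj⟩ : ∃ j : Fin n, (j : ℕ) + 1 = n :=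
    ⟨⟨n - 1, by have := h.pos; omega⟩, by have := h.pos; simp; omega⟩
  obtain ⟨g, rfl⟩ := eq_wface_ridge hj hR
  exact ⟨wface α β (.facet b) g, ⟨rfl, h.ridge_lt_facet j b g⟩, fun x hx =>
    h.facet_eq_of_ridge_lt hj hx.1 hx.2⟩

end IsWythoffOrder

end Wythoff

/-! ### The automorphism that interchanges the kinds of facets -/

/-- Interchange the last two generators. -/
def swapIdx {n : ℕ} (j : Fin n) : Option (Fin n) → Option (Fin n)
  | some k => facetIdx false k
  | none => some j

namespace FaceKind

variable {n : ℕ}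

/-- Interchange the two kinds of facets. -/
def swap : FaceKind n → FaceKind n
  | facetP => facetQ
  | facetQ => facetP
  | t => t

theorem swap_swap (t : FaceKind n) : t.swap.swap = t := by cases t <;> rfl

theorem rank_swap (t : FaceKind n) : t.swap.rank = t.rank := by cases t <;> rfl

theorem swap_facet (b : Bool) : (facet b : FaceKind n).swap = facet (!b) := by cases b <;> rfl

theorem swapIdx_mem {j : Fin n} (hj : (j : ℕ) + 1 = n) {t : FaceKind n} {x : Option (Fin n)}
    (hx : x ∈ t.gens) : swapIdx j x ∈ t.swap.gens := by
  cases t with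
  | bot => trivial
  | proper i =>
    obtain ⟨h1, h2⟩ := hx
    rcases x with _ | k
    · refine ⟨fun he => h2 ?_ rfl, fun _ => by simp [swapIdx]⟩
      obtain rfl := Option.some.inj he
      exact hj
    · have hki : (k : ℕ) ≠ i := fun h => h1 (congrArg some (Fin.ext h))
      by_cases hk : (k : ℕ) + 1 < n
      · rw [swapIdx, facetIdx_of_lt _ hk]; exact ⟨h1, h2⟩
      · rw [swapIdx, facetIdx_false_last (by omega)]
        exact ⟨by simp, fun _ => by omega⟩
  | facetP =>
    rcases x with _ | k
    · exact absurd rfl hx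
    · exact (range_facetIdx (by omega) false).subset ⟨k, rfl⟩
  | facetQ =>
    rcases x with _ | k
    · simp [swapIdx, swap, gens]
    · rw [swapIdx, facetIdx_of_lt _ (hx k rfl)]; simp [swap, gens]
  | top => trivial

end FaceKind

section Swap

variable {Γ : Type w} [Group Γ] {n : ℕ} {α : Fin n → Γ} {β : Γ} {j : Fin n} {σ : Γ ≃* Γ}

theorem map_stab_swap (hj : (j : ℕ) + 1 = n)
    (hσ : ∀ i, σ (ttGen α β i) = ttGen α β (swapIdx j i)) {t : FaceKind n} {x : Γ}
    (hx : x ∈ stabSubgroup α β t) : σ x ∈ stabSubgroup α β t.swap := by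
  suffices stabSubgroup α β t ≤ (stabSubgroup α β t.swap).comap σ.toMonoidHom from this hx
  rw [stabSubgroup, Subgroup.closure_le]
  rintro _ ⟨i, hi, rfl⟩
  change σ (ttGen α β i) ∈ stabSubgroup α β t.swap
  rw [hσ]
  exact Subgroup.subset_closure ⟨_, FaceKind.swapIdx_mem hj hi, rfl⟩

/-- The map of faces induced by an automorphism of the group. -/
noncomputable def swapFace (σ : Γ ≃* Γ) (x : WythoffFace α β) : WythoffFace α β :=
  wface α β x.kind.swap (σ (Quotient.out x.2))

/-- The representative chosen in `swapFace` does not matter, since `σ` maps each distinguished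
subgroup into that of the swapped kind. -/
theorem swapFace_wface (hj : (j : ℕ) + 1 = n)
    (hσ : ∀ i, σ (ttGen α β i) = ttGen α β (swapIdx j i)) (t : FaceKind n) (g : Γ) :
    swapFace σ (wface α β t g) = wface α β t.swap (σ g) := by
  rw [swapFace, kind_wface, wface_eq_iff, ← map_inv, ← map_mul]
  refine map_stab_swap hj hσ (QuotientGroup.eq.1 ?_)
  exact Quotient.out_eq _

variable [PartialOrder (WythoffFace α β)]

theorem swapFace_mono (hW : IsWythoffOrder α β) (hj : (j : ℕ) + 1 = n)
    (hσ : ∀ i, σ (ttGen α β i) = ttGen α β (swapIdx j i)) {x y : WythoffFace α β} (hxy : x ≤ y) :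
    swapFace σ x ≤ swapFace σ y := by
  rcases hxy.eq_or_lt with rfl | hlt
  · exact le_rfl
  · obtain ⟨hr, g, hx, hy⟩ := hW.lt_iff.1 hlt
    rw [hx, hy, swapFace_wface hj hσ, swapFace_wface hj hσ]
    exact (hW.wface_lt (by rwa [FaceKind.rank_swap, FaceKind.rank_swap]) _).le

theorem swapFace_swapFace (hj : (j : ℕ) + 1 = n)
    (hσ : ∀ i, σ (ttGen α β i) = ttGen α β (swapIdx j i)) (hσσ : ∀ g, σ (σ g) = g)
    (x : WythoffFace α β) : swapFace σ (swapFace σ x) = x := by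
  obtain ⟨g, hg⟩ := exists_eq_wface x
  rw [hg, swapFace_wface hj hσ, swapFace_wface hj hσ, hσσ, FaceKind.swap_swap]

/-- The automorphism of the face poset that interchanges the kinds of facets. -/
noncomputable def swapIso (hW : IsWythoffOrder α β) (hj : (j : ℕ) + 1 = n)
    (hσ : ∀ i, σ (ttGen α β i) = ttGen α β (swapIdx j i)) (hσσ : ∀ g, σ (σ g) = g) :
    WythoffFace α β ≃o WythoffFace α β where
  toFun := swapFace σ
  invFun := swapFace σ
  left_inv := swapFace_swapFace hj hσ hσσ
  right_inv := swapFace_swapFace hj hσ hσσ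
  map_rel_iff' {x y} := by
    refine ⟨fun hxy => ?_, swapFace_mono hW hj hσ⟩
    have := swapFace_mono hW hj hσ hxy
    simpa only [Equiv.coe_fn_mk, swapFace_swapFace hj hσ hσσ] using this

/-- The homomorphism from the group of order two given by an involution. -/
def involutionHom {M : Type*} [Monoid M] (x : M) (hx : x * x = 1) :
    Multiplicative (ZMod 2) →* M where
  toFun z := if z = 1 then 1 else x
  map_one' := if_pos rfl
  map_mul' a b := by
    have key : ∀ a b : Multiplicative (ZMod 2),
        (a = 1 ∧ b = 1 ∧ a * b = 1) ∨ (a = 1 ∧ b ≠ 1 ∧ a * b ≠ 1) ∨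
        (a ≠ 1 ∧ b = 1 ∧ a * b ≠ 1) ∨ (a ≠ 1 ∧ b ≠ 1 ∧ a * b = 1) := by decide
    rcases key a b with h | h | h | h <;> simp [h, hx]

theorem involutionHom_ofAdd_one {M : Type*} [Monoid M] (x : M) (hx : x * x = 1) :
    involutionHom x hx (Multiplicative.ofAdd 1) = x := by
  change (if (Multiplicative.ofAdd (1 : ZMod 2)) = 1 then 1 else x) = x
  exact if_neg (by decide)

variable {P Q : Type*} [PartialOrder P] [PartialOrder Q] {Φ : Flag P} {Ψ : Flag Q}
  {ιP : (P ≃o P) →* Γ} {ιQ : (Q ≃o Q) →* Γ}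

theorem swapIso_wface (hW : IsWythoffOrder α β) (hj : (j : ℕ) + 1 = n)
    (hσ : ∀ i, σ (ttGen α β i) = ttGen α β (swapIdx j i)) (hσσ : ∀ g, σ (σ g) = g)
    (t : FaceKind n) (g : Γ) :
    swapIso hW hj hσ hσσ (wface α β t g) = wface α β t.swap (σ g) :=
  swapFace_wface hj hσ t g

theorem swapIso_mul_self (hW : IsWythoffOrder α β) (hj : (j : ℕ) + 1 = n)
    (hσ : ∀ i, σ (ttGen α β i) = ttGen α β (swapIdx j i)) (hσσ : ∀ g, σ (σ g) = g) :
    swapIso hW hj hσ hσσ * swapIso hW hj hσ hσσ = 1 := by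
  ext x
  exact swapFace_swapFace hj hσ hσσ x

/-- Conjugation by the swap acts on translations as `σ`, which is the relation required of a
semidirect product. -/
theorem swapIso_mul_act (hW : IsWythoffOrder α β) (hj : (j : ℕ) + 1 = n)
    (hσ : ∀ i, σ (ttGen α β i) = ttGen α β (swapIdx j i)) (hσσ : ∀ g, σ (σ g) = g) (γ : Γ) :
    swapIso hW hj hσ hσσ * hW.act γ = hW.act (σ γ) * swapIso hW hj hσ hσσ := by
  ext x
  obtain ⟨g, hg⟩ := exists_eq_wface x
  rw [RelIso.mul_apply, RelIso.mul_apply, hg, hW.act_wface, swapIso_wface, swapIso_wface,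
    hW.act_wface, map_mul]

theorem kind_of_rank_eq (hW : IsWythoffOrder α β) (g : WythoffFace α β ≃o WythoffFace α β)
    (b : Bool) : ∃ c, (g (wface α β (.facet b) 1)).kind = .facet c := by
  refine FaceKind.eq_facet_of_rank ?_
  rw [← hW.rk_eq, rk_orderIso, hW.rk_eq, kind_wface, FaceKind.rank_facet]

/-- If `g` changes the kind of the base facet, composing it with the swap restores the kind and
`exists_act_eq` applies. -/
theorem exists_act_or_swap (hW : IsWythoffOrder α β) (hj : (j : ℕ) + 1 = n)
    (hσ : ∀ i, σ (ttGen α β i) = ttGen α β (swapIdx j i)) (hσσ : ∀ g, σ (σ g) = g)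
    (hU : IsGradedPolytope ((n + 1 : ℕ) : ℤ) (WythoffFace α β))
    (hP : IsFacetEmbedding (ttGen α β) (facetIdx true) Φ ιP)
    (g : WythoffFace α β ≃o WythoffFace α β) :
    ∃ γ, hW.act γ = g ∨ hW.act γ * swapIso hW hj hσ hσσ = g := by
  obtain ⟨c, hc⟩ := kind_of_rank_eq hW g true
  cases c
  · obtain ⟨a, ha⟩ := exists_eq_wface (g (wface α β (.facet true) 1))
    obtain ⟨γ, hγ⟩ := hP.exists_act_eq hW hU (g := swapIso hW hj hσ hσσ * g) (by
      rw [RelIso.mul_apply, ha, hc, swapIso_wface, kind_wface, FaceKind.swap_facet]; rfl)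
    refine ⟨σ γ, Or.inr ?_⟩
    rw [← swapIso_mul_act, hγ, ← mul_assoc, swapIso_mul_self, one_mul]
  · obtain ⟨γ, hγ⟩ := hP.exists_act_eq hW hU hc
    exact ⟨γ, Or.inl hγ⟩

/-- Translations and the swap bring every flag to one through the base facet of the first kind; on
those flags the group of `P` is already transitive. -/
theorem flagTransitive_of_swap (hW : IsWythoffOrder α β) (hj : (j : ℕ) + 1 = n)
    (hσ : ∀ i, σ (ttGen α β i) = ttGen α β (swapIdx j i)) (hσσ : ∀ g, σ (σ g) = g)
    (hP : IsFacetEmbedding (ttGen α β) (facetIdx true) Φ ιP) :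
    FlagTransitive (WythoffFace α β) := by
  have hR := hW.isRankFun
  have key : ∀ s : Flag (WythoffFace α β), ∃ g : WythoffFace α β ≃o WythoffFace α β,
      wface α β (.facet true) 1 ∈ Flag.map g.symm s := by
    intro s
    obtain ⟨f, hf, hfr⟩ := hR.exists_mem_flag s (j := n) (by omega) (by push_cast; omega)
    rw [hW.rk_eq] at hfr
    obtain ⟨b, hb⟩ := FaceKind.eq_facet_of_rank hfr
    obtain ⟨c, hc⟩ := exists_eq_wface f
    rw [hb] at hc
    cases b
    · refine ⟨hW.act c * swapIso hW hj hσ hσσ, ?_⟩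
      rw [Flag.mem_map, OrderIso.symm_symm, RelIso.mul_apply, swapIso_wface, FaceKind.swap_facet,
        map_one, hW.act_wface, mul_one]
      exact hc ▸ hf
    · refine ⟨hW.act c, ?_⟩
      rw [Flag.mem_map, OrderIso.symm_symm, hW.act_wface, mul_one]
      exact hc ▸ hf
  intro s t
  obtain ⟨g, hg⟩ := key s
  obtain ⟨g', hg'⟩ := key t
  obtain ⟨γ, hγ⟩ := hP.exists_act_map hW hg hg'
  refine ⟨(g.symm.trans (hW.act γ)).trans g', ?_⟩
  ext x
  have := SetLike.ext_iff.1 hγ (g'.symm x)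
  simp only [Flag.mem_map, OrderIso.symm_symm, OrderIso.apply_symm_apply] at this
  rw [Flag.mem_coe_iff, Flag.mem_coe_iff, Flag.mem_map, ← this]
  rfl

theorem exists_semidirect (hW : IsWythoffOrder α β) (hj : (j : ℕ) + 1 = n)
    (hσ : ∀ i, σ (ttGen α β i) = ttGen α β (swapIdx j i)) (hσσ : ∀ g, σ (σ g) = g)
    (hU : IsGradedPolytope ((n + 1 : ℕ) : ℤ) (WythoffFace α β))
    (hP : IsFacetEmbedding (ttGen α β) (facetIdx true) Φ ιP) :
    ∃ (φ : Multiplicative (ZMod 2) →* MulAut Γ)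
      (f : Γ ⋊[φ] Multiplicative (ZMod 2) ≃* (WythoffFace α β ≃o WythoffFace α β)),
      (∀ g, f (SemidirectProduct.inl g) = hW.act g) ∧ φ (Multiplicative.ofAdd 1) = σ := by
  have hσ2 : (σ : MulAut Γ) * σ = 1 := by ext g; exact hσσ g
  have h2 : ∀ z : Multiplicative (ZMod 2), z = 1 ∨ z = Multiplicative.ofAdd 1 := by decide
  set S := swapIso hW hj hσ hσσ with hS
  have hSS : S * S = 1 := swapIso_mul_self hW hj hσ hσσ
  let F := SemidirectProduct.lift (φ := involutionHom (M := MulAut Γ) σ hσ2) hW.act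
    (involutionHom S hSS) (by
      intro z
      ext1 γ
      rcases h2 z with rfl | rfl
      · simp
      · rw [involutionHom_ofAdd_one, involutionHom_ofAdd_one]
        change hW.act (σ γ) = S * hW.act γ * S⁻¹
        rw [hS, swapIso_mul_act, mul_inv_cancel_right])
  have hF : ∀ x, F x = hW.act x.left * involutionHom S hSS x.right := fun x => rfl
  refine ⟨involutionHom (M := MulAut Γ) σ hσ2, MulEquiv.ofBijective F ⟨?_, fun g => ?_⟩,
    fun g => ?_, involutionHom_ofAdd_one (M := MulAut Γ) σ hσ2⟩
  · rw [injective_iff_map_eq_one]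
    rintro ⟨γ, z⟩ hγ
    rw [hF] at hγ
    rcases h2 z with rfl | rfl
    · rw [map_one, mul_one] at hγ
      have := hP.act_injective hW (hγ.trans (map_one _).symm)
      simp only at this
      rw [this]; rfl
    -- A translation composed with the swap changes the kind of the base facet, so it is not the
    -- identity.
    · exfalso
      rw [involutionHom_ofAdd_one] at hγ
      have := congrArg WythoffFace.kind
        (DFunLike.congr_fun hγ (wface α β (.facet true) 1))
      rw [RelIso.mul_apply, hS, swapIso_wface, hW.act_wface, kind_wface, FaceKind.swap_facet] at this
      change FaceKind.facetQ = FaceKind.facetP at this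
      simp at this
  · obtain ⟨γ, hγ | hγ⟩ := exists_act_or_swap hW hj hσ hσσ hU hP g
    · exact ⟨⟨γ, 1⟩, by rw [hF, map_one, mul_one, hγ]⟩
    · exact ⟨⟨γ, Multiplicative.ofAdd 1⟩, by rw [hF, involutionHom_ofAdd_one, hγ]⟩
  · change F _ = _
    rw [hF]; simp

/-- If an automorphism interchanges the kinds of facets, the facets are isomorphic. -/
theorem nonempty_iso_of_kind_ne (hW : IsWythoffOrder α β)
    (hP : IsFacetEmbedding (ttGen α β) (facetIdx true) Φ ιP)
    (hQ : IsFacetEmbedding (ttGen α β) (facetIdx false) Ψ ιQ)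
    {g : WythoffFace α β ≃o WythoffFace α β}
    (hg : (g (wface α β (.facet true) 1)).kind = .facet false) : Nonempty (P ≃o Q) := by
  obtain ⟨e⟩ := hP.nonempty_iso_of_kind hW (f := wface α β (.facet true) 1) rfl
  obtain ⟨e'⟩ := hQ.nonempty_iso_of_kind hW hg
  exact ⟨(e.symm.trans (g.iicCongr _)).trans e'⟩

/-- The two base flags of the identity element have facets of different kinds, so an automorphism
between them interchanges the kinds. -/
theorem nonempty_iso_of_flagTransitive (hW : IsWythoffOrder α β)
    (hP : IsFacetEmbedding (ttGen α β) (facetIdx true) Φ ιP)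
    (hQ : IsFacetEmbedding (ttGen α β) (facetIdx false) Ψ ιQ)
    (hU : FlagTransitive (WythoffFace α β)) : Nonempty (P ≃o Q) := by
  obtain ⟨g, hg⟩ := hU (hW.baseFlag true 1) (hW.baseFlag false 1)
  refine nonempty_iso_of_kind_ne hW hP hQ (g := g) ?_
  obtain ⟨c, hc⟩ := kind_of_rank_eq hW g true
  have hm : g (wface α β (.facet true) 1) ∈ hW.baseFlag false 1 := by
    rw [← hg, Flag.apply_mem_map]; exact hW.facet_mem_baseFlag true 1
  cases c
  · exact hc
  · exact absurd hc hm.1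

end Swap

/-! ### The involution of the amalgamated product of two isomorphic polytopes -/

/-- Transport of automorphisms along an isomorphism. -/
def OrderIso.conjHom {P Q : Type*} [PartialOrder P] [PartialOrder Q] (θ : P ≃o Q) :
    (P ≃o P) →* (Q ≃o Q) where
  toFun g := (θ.symm.trans g).trans θ
  map_one' := by ext x; simp
  map_mul' a b := by ext x; simp

theorem OrderIso.conjHom_apply {P Q : Type*} [PartialOrder P] [PartialOrder Q] (θ : P ≃o Q)
    (g : P ≃o P) (x : P) : θ.conjHom g (θ x) = θ (g x) := by simp [conjHom]

theorem OrderIso.conjHom_symm_conjHom {P Q : Type*} [PartialOrder P] [PartialOrder Q]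
    (θ : P ≃o Q) (g : P ≃o P) : θ.symm.conjHom (θ.conjHom g) = g := by ext x; simp [conjHom]

/-- Transport along an isomorphism that maps base flag to base flag preserves the standard
generators. -/
theorem IsRegularPolytope.conjHom_stdGen {P Q : Type*} [PartialOrder P] [PartialOrder Q] {n j : ℤ}
    (hP : IsRegularPolytope n P) (hQ : IsRegularPolytope n Q) {Φ : Flag P} {Ψ : Flag Q}
    {θ : P ≃o Q} (hθ : Flag.map θ Φ = Ψ) (h0 : 0 ≤ j) (h1 : j < n) :
    θ.conjHom (stdGen Φ j) = stdGen Ψ j := by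
  refine hQ.eq_stdGen (fun y hy hyj => ?_) fun he => hP.stdGen_ne_one Φ h0 h1 ?_
  · obtain ⟨x, rfl⟩ := θ.surjective y
    rw [← hθ, Flag.apply_mem_map] at hy
    rw [rk_orderIso] at hyj
    rw [OrderIso.conjHom_apply, hP.stdGen_mem Φ h0 h1 x hy hyj]
  · rw [← θ.conjHom_symm_conjHom (stdGen Φ j), he, map_one]

/-- Both sides extend `k`, and extensions from a facet are unique. -/
theorem IsRegularPolytope.conjHom_facetHom {P Q K : Type*} [PartialOrder P] [PartialOrder Q]
    [PartialOrder K] {n : ℤ} (hP : IsRegularPolytope n P) (hQ : IsRegularPolytope n Q) {F : P}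
    {G : Q} (hFr : rk F = n - 1) (hGr : rk G = n - 1) {eP : K ≃o Set.Iic F} {eQ : K ≃o Set.Iic G}
    {θ : P ≃o Q} (hθ : ∀ x, θ (eP x) = eQ x) (k : K ≃o K) :
    θ.conjHom (facetHom eP k) = facetHom eQ k := by
  refine hQ.eq_of_eqOn_facet hGr eQ fun x => ?_
  rw [hQ.facetHom_spec hGr, ← hθ, OrderIso.conjHom_apply, hP.facetHom_spec hFr, hθ]

section Amalgam

variable {P Q : Type u} {K : Type v} [PartialOrder P] [PartialOrder Q] [PartialOrder K]
  {F : P} {G : Q} {n : ℕ} {Φ : Flag P} {Ψ : Flag Q} {eP : K ≃o Set.Iic F} {eQ : K ≃o Set.Iic G}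

namespace IsFacetPair

/-- Isomorphic polytopes are isomorphic compatibly with base flags and base facets. -/
theorem exists_iso (h : IsFacetPair n Φ Ψ eP eQ) (e : P ≃o Q) :
    ∃ θ : P ≃o Q, Flag.map θ Φ = Ψ ∧ ∀ x, θ (eP x) = eQ x := by
  -- The regularity of `Q` corrects `e` so that base flags correspond; then the base facets do as
  -- well.
  obtain ⟨a, ha⟩ := h.regularQ.flagTransitive (Flag.map e Φ) Ψ
  obtain ⟨θ, hθ⟩ : ∃ θ : P ≃o Q, Flag.map θ Φ = Ψ := ⟨e.trans a, by
    rw [← ha]; ext x; simp only [Flag.mem_coe_iff, Flag.mem_map]; rfl⟩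
  refine ⟨θ, hθ, ?_⟩
  have hm : ∀ x, θ x ∈ Ψ ↔ x ∈ Φ := fun x => by rw [← hθ, Flag.apply_mem_map]
  obtain rfl : θ F = G := h.regularQ.isRankFun.flag_inj Ψ ((hm F).2 h.memP) h.memQ
    (by rw [rk_orderIso, h.rankP, h.rankQ])
  have hK : IsGradedPolytope (rk F) K := (h.regularP.iic F).congr eP.symm
  have hR := h.regularP.isRankFun
  -- The two identifications of `K` with the base facet of `Q` agree on the induced flag of `K`,
  -- hence everywhere.
  have := hK.eq_of_eqOn (g := eP.trans (θ.iicCongr F)) (g' := eQ)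
    (s := inducedFlag hR eP h.memP) fun x hx => by
      rw [mem_inducedFlag] at hx
      apply Subtype.ext
      refine h.regularQ.isRankFun.flag_inj Ψ ((hm _).2 hx) ((h.flag_iff x).1 hx) ?_
      exact (rk_facetIso h.regularQ.isRankFun (eP.trans (θ.iicCongr F)) x).trans
        (rk_facetIso h.regularQ.isRankFun eQ x).symm
  intro x
  rw [← this]
  rfl

/-- The endomorphism of the amalgamated product that interchanges the factors. -/
noncomputable def swapHom (h : IsFacetPair n Φ Ψ eP eQ) (θ : P ≃o Q)
    (hθ : ∀ x, θ (eP x) = eQ x) : Amalgam eP eQ →* Amalgam eP eQ :=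
  Monoid.PushoutI.lift
    (fun
      | true => (Amalgam.inQ eP eQ).comp θ.conjHom
      | false => (Amalgam.inP eP eQ).comp θ.symm.conjHom)
    -- The amalgamated subgroup is fixed pointwise, because conjugation by `θ` turns the extension
    -- of `k` to `P` into its extension to `Q`.
    (Monoid.PushoutI.base (autFamilyHom eP eQ)) (by
      rintro (_ | _)
      · ext1 k
        change Amalgam.inP eP eQ (θ.symm.conjHom (facetHom eQ k)) = _
        rw [h.regularQ.conjHom_facetHom h.regularP h.rankQ h.rankP (eQ := eP) (fun x => by
          rw [← hθ, θ.symm_apply_apply])]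
        exact Monoid.PushoutI.of_apply_eq_base (autFamilyHom eP eQ) true k
      · ext1 k
        change Amalgam.inQ eP eQ (θ.conjHom (facetHom eP k)) = _
        rw [h.regularP.conjHom_facetHom h.regularQ h.rankP h.rankQ hθ]
        exact Monoid.PushoutI.of_apply_eq_base (autFamilyHom eP eQ) false k)

theorem swapHom_inP (h : IsFacetPair n Φ Ψ eP eQ) (θ : P ≃o Q) (hθ : ∀ x, θ (eP x) = eQ x)
    (g : P ≃o P) : h.swapHom θ hθ (Amalgam.inP eP eQ g) = Amalgam.inQ eP eQ (θ.conjHom g) :=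
  Monoid.PushoutI.lift_of ..

theorem swapHom_inQ (h : IsFacetPair n Φ Ψ eP eQ) (θ : P ≃o Q) (hθ : ∀ x, θ (eP x) = eQ x)
    (g : Q ≃o Q) : h.swapHom θ hθ (Amalgam.inQ eP eQ g) = Amalgam.inP eP eQ (θ.symm.conjHom g) :=
  Monoid.PushoutI.lift_of ..

theorem swapHom_swapHom (h : IsFacetPair n Φ Ψ eP eQ) (θ : P ≃o Q) (hθ : ∀ x, θ (eP x) = eQ x)
    (g : Amalgam eP eQ) : h.swapHom θ hθ (h.swapHom θ hθ g) = g := by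
  have h1 : ∀ g : P ≃o P, h.swapHom θ hθ (h.swapHom θ hθ (Amalgam.inP eP eQ g)) =
      Amalgam.inP eP eQ g := fun g => by
    rw [swapHom_inP, swapHom_inQ, OrderIso.conjHom_symm_conjHom]
  have h2 : ∀ g : Q ≃o Q, h.swapHom θ hθ (h.swapHom θ hθ (Amalgam.inQ eP eQ g)) =
      Amalgam.inQ eP eQ g := fun g => by
    rw [swapHom_inQ, swapHom_inP]
    exact congrArg _ (θ.symm.conjHom_symm_conjHom g)
  induction g using Monoid.PushoutI.induction_on with
  | of b g =>
    cases b
    · exact h2 g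
    · exact h1 g
  | base k => rw [swapHom, Monoid.PushoutI.lift_base, Monoid.PushoutI.lift_base]
  | mul x y hx hy => rw [map_mul, map_mul, hx, hy]

/-- The involution of the amalgamated product that interchanges the last two generators. -/
theorem exists_swap (h : IsFacetPair n Φ Ψ eP eQ) (e : P ≃o Q) {j : Fin n} (hj : (j : ℕ) + 1 = n)
    {α : Fin n → Amalgam eP eQ} (hα : ∀ j : Fin n, α j = Amalgam.inP eP eQ (stdGen Φ (j : ℕ)))
    {β : Amalgam eP eQ} (hβ : β = Amalgam.inQ eP eQ (stdGen Ψ ((n : ℤ) - 1))) :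
    ∃ σ : Amalgam eP eQ ≃* Amalgam eP eQ, (∀ g, σ (σ g) = g) ∧
      ∀ i, σ (ttGen α β i) = ttGen α β (swapIdx j i) := by
  obtain ⟨θ, hθ, hθ'⟩ := h.exists_iso e
  let σ : Amalgam eP eQ ≃* Amalgam eP eQ :=
    { h.swapHom θ hθ' with
      invFun := h.swapHom θ hθ'
      left_inv := h.swapHom_swapHom θ hθ'
      right_inv := h.swapHom_swapHom θ hθ' }
  have hσσ : ∀ g, σ (σ g) = g := h.swapHom_swapHom θ hθ'
  have hσ : ∀ k : Fin n, σ (α k) = ttGen α β (facetIdx false k) := by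
    intro k
    rw [(h.isFacetEmbedding_inQ hα hβ).gen_eq, hα]
    refine (h.swapHom_inP θ hθ' _).trans ?_
    rw [h.regularP.conjHom_stdGen h.regularQ hθ (by simp) (by simp)]
  refine ⟨σ, hσσ, ?_⟩
  rintro (_ | k)
  · have := hσ j
    rw [facetIdx_false_last hj] at this
    change σ β = α j
    rw [show β = σ (α j) from this.symm, hσσ]
  · exact hσ k

end IsFacetPair

end Amalgam

theorem theorem5p5 (n : ℕ) (hn : 1 ≤ n)
    (P Q : Type u) (K : Type v) [PartialOrder P] [PartialOrder Q] [PartialOrder K]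
    (hP : IsPolytope n P) (hQ : IsPolytope n Q) (hPr : FlagTransitive P) (hQr : FlagTransitive Q)
    -- base flags of `P` and `Q` with facets `F` and `G`, both isomorphic to `K`
    (Φ : Flag P) (Ψ : Flag Q) (F : P) (G : Q) (hF : F ∈ Φ) (hG : G ∈ Ψ)
    (hFr : rk F = (n : ℤ) - 1) (hGr : rk G = (n : ℤ) - 1)
    (eP : K ≃o Set.Iic F) (eQ : K ≃o Set.Iic G)
    -- the two base flags induce the same base flag of `K`
    (hflag : ∀ x : K, (eP x : P) ∈ Φ ↔ (eQ x : Q) ∈ Ψ)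
    -- the generators of the amalgamated product
    (α : Fin n → Amalgam eP eQ) (hα : ∀ j : Fin n, α j = Amalgam.inP eP eQ (stdGen Φ (j : ℕ)))
    (β : Amalgam eP eQ) (hβ : β = Amalgam.inQ eP eQ (stdGen Ψ ((n : ℤ) - 1))) :
    -- the standard generators, and the embeddings of `Γ(K)`, are well defined
    (∀ j : Fin n, (∃! g : P ≃o P, FlagAdj (j : ℕ) Φ (Flag.map g Φ)) ∧
      ∃! g : Q ≃o Q, FlagAdj (j : ℕ) Ψ (Flag.map g Ψ)) ∧
    ((∃! ι, ExtendsAut eP ι) ∧ ∃! ι, ExtendsAut eQ ι) ∧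
    (Function.Injective (facetHom eP) ∧ Function.Injective (facetHom eQ)) ∧
    -- the amalgamated product is a tail-triangle C-group in which the last two
    -- generators have a product of infinite order
    (∀ j : Fin n, (j : ℕ) + 1 < n → α j = Amalgam.inQ eP eQ (stdGen Ψ (j : ℕ))) ∧
    IsTailTriangleCGroup α β ∧
    orderOf (α ⟨n - 1, by omega⟩ * β) = 0 ∧
    -- the polytope `U` that Wythoff's construction yields for this group
    ∃ _ : PartialOrder (WythoffFace α β),
      (∀ x y : WythoffFace α β, x ≤ y ↔ x = y ∨ x.Below y) ∧
      IsPolytope (n + 1) (WythoffFace α β) ∧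
      (∀ x : WythoffFace α β, rk x = x.kind.rank) ∧
      IsSemiregular (n + 1) (WythoffFace α β) ∧
      -- facets, ridges, and sections over faces of rank `n - 2`
      (∀ x : WythoffFace α β, x.kind = .facetP → Nonempty (Set.Iic x ≃o P)) ∧
      (∀ x : WythoffFace α β, x.kind = .facetQ → Nonempty (Set.Iic x ≃o Q)) ∧
      (∀ R : WythoffFace α β, rk R = (n : ℤ) - 1 →
        Nonempty (Set.Iic R ≃o K) ∧
        (∃! x : WythoffFace α β, x.kind = .facetP ∧ R < x) ∧
        ∃! x : WythoffFace α β, x.kind = .facetQ ∧ R < x) ∧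
      (∀ R : WythoffFace α β, rk R = (n : ℤ) - 2 →
        ∃ e : Apeirogon ≃o Set.Ici R, ∀ i : ℤ,
          (e (.edge (2 * i))).1.kind = .facetP ∧ (e (.edge (2 * i + 1))).1.kind = .facetQ) ∧
      -- the action of the group, regularity, and the full automorphism group
      ∃ act : Amalgam eP eQ →* (WythoffFace α β ≃o WythoffFace α β),
        (∀ g x, act g x = x.translate g) ∧ Function.Injective act ∧
        (FlagTransitive (WythoffFace α β) ↔ Nonempty (P ≃o Q)) ∧
        (Nonempty (P ≃o Q) →
          ∃ (φ : Multiplicative (ZMod 2) →* MulAut (Amalgam eP eQ))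
            (f : Amalgam eP eQ ⋊[φ] Multiplicative (ZMod 2) ≃*
              (WythoffFace α β ≃o WythoffFace α β)),
            (∀ g, f (SemidirectProduct.inl g) = act g) ∧
            (∀ j : Fin n, (j : ℕ) + 1 < n → φ (Multiplicative.ofAdd 1) (α j) = α j) ∧
            φ (Multiplicative.ofAdd 1) (α ⟨n - 1, by omega⟩) = β ∧
            φ (Multiplicative.ofAdd 1) β = α ⟨n - 1, by omega⟩) ∧
        (¬ Nonempty (P ≃o Q) → Function.Bijective act) := by 
  have h : IsFacetPair n Φ Ψ eP eQ := ⟨hn, ⟨hP.isGradedPolytope, hPr⟩, ⟨hQ.isGradedPolytope, hQr⟩,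
    hF, hG, hFr, hGr, hflag⟩
  have hC := h.isTailTriangleCGroup hα hβ
  set j : Fin n := ⟨n - 1, by omega⟩ with hjdef
  have hj : (j : ℕ) + 1 = n := by simp [hjdef]; omega
  have hord := h.orderOf_last_mul hj hα hβ
  have hEP := h.isFacetEmbedding_inP (β := β) hα
  have hEQ := h.isFacetEmbedding_inQ hα hβ
  refine ⟨fun j => ⟨h.regularP.existsUnique_stdGen Φ (by simp) (by simp),
      h.regularQ.existsUnique_stdGen Ψ (by simp) (by simp)⟩,
    ⟨h.regularP.existsUnique_facetHom hFr eP, h.regularQ.existsUnique_facetHom hGr eQ⟩,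
    ⟨h.regularP.facetHom_injective hFr eP, h.regularQ.facetHom_injective hGr eQ⟩,
    fun j hj => (hα j).trans (h.inP_stdGen (by simp) (by exact_mod_cast hj)), hC, hord,
    hC.partialOrder, fun _ _ => Iff.rfl, ?_⟩
  let _ := hC.partialOrder
  have hW : IsWythoffOrder α β := ⟨hn, hC, fun _ _ => Iff.rfl⟩
  have hreg : ∀ f : WythoffFace α β, f.kind.rank = n → IsRegularPolytope n (Set.Iic f) := by
    intro f hf
    obtain ⟨b, hb⟩ := FaceKind.eq_facet_of_rank hf
    cases b
    · obtain ⟨e⟩ := hEQ.nonempty_iso_of_kind hW hb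
      exact ⟨hQ.isGradedPolytope.congr e.symm, hQr.congr e.symm⟩
    · obtain ⟨e⟩ := hEP.nonempty_iso_of_kind hW hb
      exact ⟨hP.isGradedPolytope.congr e.symm, hPr.congr e.symm⟩
  have hU := hW.isGradedPolytope fun f hf => (hreg f hf).toIsGradedPolytope
  refine ⟨hU.isPolytope, hW.rk_eq, ⟨fun f hf => (hreg f ?_).flagTransitive,
      fun x y => hW.vertex_transitive⟩,
    fun x hx => hEP.nonempty_iso_of_kind hW hx, fun x hx => hEQ.nonempty_iso_of_kind hW hx,
    fun R hR => ?_, fun R hR => hW.exists_apeirogon hj hord (by rwa [← hW.rk_eq]),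
    hW.act, hW.act_apply, hEP.act_injective hW,
    ⟨nonempty_iso_of_flagTransitive hW hEP hEQ, fun ⟨e⟩ => ?_⟩, fun ⟨e⟩ => ?_, fun hne => ?_⟩
  · rw [← hW.rk_eq, hf]; push_cast; ring
  · rw [hW.rk_eq] at hR
    exact ⟨hEP.nonempty_ridge_iso hW hF hFr eP hR, hW.existsUnique_facet hR true,
      hW.existsUnique_facet hR false⟩
  · obtain ⟨σ, hσσ, hσ⟩ := h.exists_swap e hj hα hβ
    exact flagTransitive_of_swap hW hj hσ hσσ hEP
  · obtain ⟨σ, hσσ, hσ⟩ := h.exists_swap e hj hα hβ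
    obtain ⟨φ, f, hf, hφ⟩ := exists_semidirect hW hj hσ hσσ hU hEP
    refine ⟨φ, f, hf, fun k hk => ?_, ?_, ?_⟩
    · rw [hφ]
      have := hσ (some k)
      rwa [swapIdx, facetIdx_of_lt _ hk] at this
    · rw [hφ]
      have := hσ (some j)
      rwa [swapIdx, facetIdx_false_last hj] at this
    · rw [hφ]
      exact hσ none
  · refine ⟨hEP.act_injective hW, fun g => ?_⟩
    obtain ⟨c, hc⟩ := kind_of_rank_eq hW g true
    cases c
    -- Interchanging the kinds would make `P` and `Q` isomorphic, so every automorphism preserves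
    -- the kind of the base facet and is a translation.
    · exact absurd (nonempty_iso_of_kind_ne hW hEP hEQ hc) hne
    · exact hEP.exists_act_eq hW hU hc
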